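/- Let $\mu,\sigma:(0,\infty)\to\mathbb R$ with $\mu$ differentiable, $\sigma$ continuous and $\sigma>0$, and let $X$ be a diffusion on $(0,\infty)$ with continuous paths and generator $\mathcal A f=\mu f'+\tfrac12\sigma^2f''$ (for every $x>0$, under $\mathbb P_x$ the process $X$ starts at $x$ and solves the martingale problem for $\mathcal A$ on $C^2_c((0,\infty))$; in particular $X$ may be a strong solution of $dX_t=\mu(X_t)dt+\sigma(X_t)dW_t$, $X_0=x$). Let $$S'(x)=\exp\Big(-\int_1^x\frac{2\mu(z)}{\sigma^2(z)}dz\Big),\qquad m'(x)=\frac{2}{\sigma^2(x)S'(x)},$$ and assume that the boundaries $0$ and $\infty$ are natural in Feller's sense. For $s>0$ let $\psi_s>0$ and $\varphi_s>0$ be the increasing and the decreasing solution of $(\mathcal A-s)f=0$ (in $C^2((0,\infty))$, unique up to positive factors). Let $\mathcal L_1^s$ be the set of $f$ with $\mathbb E_x\int_0^\infty e^{-st}|f(X_t)|dt<\infty$ for all $x>0$, and let $(R_sf)(x)=\mathbb E_x\int_0^\infty e^{-st}f(X_t)dt$. Let $r,\lambda>0$, $\gamma_d,\gamma_u\in\mathbb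 R$, $\pi:(0,\infty)\to\mathbb R$, and for $n\in\{d,u\}$ put $$\theta_n(x)=\pi(x)+\gamma_n(\mu(x)-rx),\qquad g_n(x)=\gamma_nx-(R_r\pi)(x).$$ Assume that 1. $\gamma_d<\gamma_u$; 2. $\theta_d,\theta_u$ and $x\mapsto x$ belong to $\mathcal L_1^r$; 3. $\pi$ is positive, continuous and non-decreasing; 4. $\mu'(x)<r$ for all $x>0$; 5. $\theta_n$ is differentiable and there is a unique $x_n^*\ge0$ such that, for $x>0$, $\theta_n'(x)>0$ if $x<x_n^*$, $\theta_n'(x)=0$ if $x=x_n^*$, and $\theta_n'(x)<0$ if $x>x_n^*$ ($n\in\{d,u\}$); 6. $\lim_{x\to0+}\theta_n(x)$ exists in $[0,\infty]$ and $\lim_{x\to\infty}\theta_n(x)=-\infty$ ($n\in\{d,u\}$). Define, for $x>0$, $$L_f(x)=(r+\lambda)\int_x^\infty f\varphi_{r+\lambda}m'\,dy+\frac{\varphi_{r+\lambda}'(x)}{S'(x)}f(x),\qquad K_f(x)=(r+\lambda)\int_0^x f\psi_{r+\lambda}m'\,dy-\frac{\psi_{r+\lambda}'(x)}{S'(x)}f(x),$$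 $$H(f,g;x)=\frac{f'(x)K_g(x)-g'(x)K_f(x)}{\psi_{r+\lambda}'(x)},\qquad Q(g,f;x)=\frac{g'(x)L_f(x)-f'(x)L_g(x)}{\varphi_{r+\lambda}'(x)}.$$ If the pair of equations $$H(\psi_r,g_u;a)=Q(g_d,\psi_r;b),\qquad H(\varphi_r,g_u;a)=Q(g_d,\varphi_r;b)$$ has a solution $(a^*,b^*)$ with $0<a^*<b^*$, then it is the only solution $(a,b)$ with $0<a<b$. -/

import Mathlib

open Set Filter Topology MeasureTheory
open scoped NNReal ENNReal

namespace PoissonControl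

noncomputable section

/-- The generator `𝒜 f = μ f' + ½ σ² f''`. -/
def generator (μ σ f : ℝ → ℝ) (x : ℝ) : ℝ :=
  μ x * deriv f x + σ x ^ 2 / 2 * deriv (deriv f) x

/-- Scale density `S'(x) = exp (-∫₁ˣ 2 μ / σ²)` on `(0, ∞)`. Another base point only multiplies
it by a positive constant. -/
def scaleDensity (μ σ : ℝ → ℝ) (x : ℝ) : ℝ :=
  Real.exp (-∫ z in (1 : ℝ)..x, 2 * μ z / σ z ^ 2)

/-- Density of the speed measure `m'(x) = 2 / (σ²(x) S'(x))`. -/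
def speedDensity (μ σ : ℝ → ℝ) (x : ℝ) : ℝ :=
  2 / (σ x ^ 2 * scaleDensity μ σ x)

/-- Feller's criterion for the boundaries `0` and `∞` of `(0, ∞)` to be natural: neither of them
is exit (the two integrals of the mass `m` between `y` and `1` against `dS(y)` diverge), and neither
is entrance (the two integrals of the scale distance between `y` and `1` against `dm(y)` diverge).
The interior reference point `1` is immaterial. -/
structure NaturalBoundaries (μ σ : ℝ → ℝ) : Prop where
  zero_not_exit :
    ∫⁻ y in Ioo (0 : ℝ) 1,
      ENNReal.ofReal ((∫ z in y..1, speedDensity μ σ z) * scaleDensity μ σ y) = ∞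
  zero_not_entrance :
    ∫⁻ y in Ioo (0 : ℝ) 1,
      ENNReal.ofReal ((∫ z in y..1, scaleDensity μ σ z) * speedDensity μ σ y) = ∞
  infty_not_exit :
    ∫⁻ y in Ioi (1 : ℝ),
      ENNReal.ofReal ((∫ z in (1 : ℝ)..y, speedDensity μ σ z) * scaleDensity μ σ y) = ∞
  infty_not_entrance :
    ∫⁻ y in Ioi (1 : ℝ),
      ENNReal.ofReal ((∫ z in (1 : ℝ)..y, scaleDensity μ σ z) * speedDensity μ σ y) = ∞

/-- Under `P`, the process `X` is a diffusion in `(0, ∞)` started at `x` with drift `μ` and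
volatility `σ`: a continuous adapted process that solves the martingale problem for the generator,
with twice continuously differentiable compactly supported test functions. -/
structure IsDiffusionFrom {Ω : Type*} [mΩ : MeasurableSpace Ω] (μ σ : ℝ → ℝ)
    (𝓕 : Filtration ℝ≥0 mΩ) (X : ℝ≥0 → Ω → ℝ) (P : Measure Ω) (x : ℝ) : Prop where
  isProbabilityMeasure : IsProbabilityMeasure P
  adapted : Adapted 𝓕 X
  continuous_paths : ∀ ω, Continuous fun t => X t ω
  pos : ∀ t ω, 0 < X t ω
  start : ∀ᵐ ω ∂P, X 0 ω = x
  martingale : ∀ f : ℝ → ℝ, ContDiff ℝ 2 f → HasCompactSupport f → tsupport f ⊆ Ioi 0 →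
    Martingale
      (fun (t : ℝ≥0) ω =>
        f (X t ω) - ∫ s in (0 : ℝ)..(t : ℝ), generator μ σ f (X s.toNNReal ω)) 𝓕 P

/-- `f ∈ 𝓛₁ˢ`: `E_x ∫₀^∞ e^{-st} |f(X_t)| dt < ∞` for every initial state `x > 0`. -/
def InL1 {Ω : Type*} [MeasurableSpace Ω] (X : ℝ≥0 → Ω → ℝ) (P : ℝ → Measure Ω)
    (s : ℝ) (f : ℝ → ℝ) : Prop :=
  ∀ x, 0 < x →
    ∫⁻ ω, (∫⁻ t in Ioi (0 : ℝ),
      ENNReal.ofReal (Real.exp (-s * t) * |f (X t.toNNReal ω)|)) ∂(P x) < ∞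

/-- The resolvent `(R_s f)(x) = E_x ∫₀^∞ e^{-st} f(X_t) dt`. -/
def resolvent {Ω : Type*} [MeasurableSpace Ω] (X : ℝ≥0 → Ω → ℝ) (P : ℝ → Measure Ω)
    (s : ℝ) (f : ℝ → ℝ) (x : ℝ) : ℝ :=
  ∫ ω, (∫ t in Ioi (0 : ℝ), Real.exp (-s * t) * f (X t.toNNReal ω)) ∂(P x)

/-- A positive classical solution of `(𝒜 - s) f = 0` on `(0, ∞)`. -/
structure IsPositiveSolution (μ σ : ℝ → ℝ) (s : ℝ) (f : ℝ → ℝ) : Prop where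
  contDiffOn : ContDiffOn ℝ 2 f (Ioi 0)
  pos : ∀ x, 0 < x → 0 < f x
  eqn : ∀ x, 0 < x → generator μ σ f x - s * f x = 0

/-- `ψ` is the increasing fundamental solution `ψ_s` (unique up to a positive factor). -/
def IsIncreasingFundamental (μ σ : ℝ → ℝ) (s : ℝ) (ψ : ℝ → ℝ) : Prop :=
  IsPositiveSolution μ σ s ψ ∧ StrictMonoOn ψ (Ioi 0)

/-- `φ` is the decreasing fundamental solution `φ_s` (unique up to a positive factor). -/
def IsDecreasingFundamental (μ σ : ℝ → ℝ) (s : ℝ) (φ : ℝ → ℝ) : Prop :=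
  IsPositiveSolution μ σ s φ ∧ StrictAntiOn φ (Ioi 0)

/-- `θ_γ(x) = π(x) + γ (μ(x) - r x)`. -/
def netYield (μ : ℝ → ℝ) (r : ℝ) (π : ℝ → ℝ) (γ : ℝ) (x : ℝ) : ℝ :=
  π x + γ * (μ x - r * x)

/-- `g_γ(x) = γ x - (R_r π)(x)`. -/
def gFun {Ω : Type*} [MeasurableSpace Ω] (X : ℝ≥0 → Ω → ℝ) (P : ℝ → Measure Ω)
    (r : ℝ) (π : ℝ → ℝ) (γ : ℝ) (x : ℝ) : ℝ :=
  γ * x - resolvent X P r π x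

/-- The conditions on `θ = θ_n`, for each `n ∈ {d, u}`: integrability; differentiability and
unimodality with a unique state `x* ≥ 0` of maximum; a limit in `[0, ∞]` at `0+` and
the limit `-∞` at `∞`. -/
structure YieldConditions {Ω : Type*} [MeasurableSpace Ω] (X : ℝ≥0 → Ω → ℝ) (P : ℝ → Measure Ω)
    (r : ℝ) (θ : ℝ → ℝ) : Prop where
  inL1 : InL1 X P r θ
  differentiableOn : DifferentiableOn ℝ θ (Ioi 0)
  unimodal : ∃! xs : ℝ, 0 ≤ xs ∧ ∀ x, 0 < x →
    (x < xs → 0 < deriv θ x) ∧ (x = xs → deriv θ x = 0) ∧ (xs < x → deriv θ x < 0)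
  limit_zero : ∃ l : EReal, 0 ≤ l ∧ Tendsto (fun x => (θ x : EReal)) (𝓝[>] 0) (𝓝 l)
  limit_infty : Tendsto θ atTop atBot

/-- The main assumptions on the drift `μ`, the payoff `π` and the unit prices `γd`, `γu`. -/
structure MainAssumptions {Ω : Type*} [MeasurableSpace Ω] (X : ℝ≥0 → Ω → ℝ) (P : ℝ → Measure Ω)
    (μ : ℝ → ℝ) (r : ℝ) (π : ℝ → ℝ) (γd γu : ℝ) : Prop where
  gamma_lt : γd < γu
  id_inL1 : InL1 X P r (fun x => x)
  payoff_pos : ∀ x, 0 < x → 0 < π x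
  payoff_continuousOn : ContinuousOn π (Ioi 0)
  payoff_monotoneOn : MonotoneOn π (Ioi 0)
  drift_differentiableOn : DifferentiableOn ℝ μ (Ioi 0)
  drift_deriv_lt : ∀ x, 0 < x → deriv μ x < r
  yield_d : YieldConditions X P r (netYield μ r π γd)
  yield_u : YieldConditions X P r (netYield μ r π γu)

/-- `L_f^s(x) = s ∫ₓ^∞ f φ_s m' dy + (φ_s'(x) / S'(x)) f(x)`, where `φ` stands for `φ_s`. -/
def functionalL (μ σ : ℝ → ℝ) (s : ℝ) (φ f : ℝ → ℝ) (x : ℝ) : ℝ :=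
  s * (∫ y in Ioi x, f y * φ y * speedDensity μ σ y) + deriv φ x / scaleDensity μ σ x * f x

/-- `K_f^s(x) = s ∫₀ˣ f ψ_s m' dy - (ψ_s'(x) / S'(x)) f(x)`, where `ψ` stands for `ψ_s`. -/
def functionalK (μ σ : ℝ → ℝ) (s : ℝ) (ψ f : ℝ → ℝ) (x : ℝ) : ℝ :=
  s * (∫ y in Ioc 0 x, f y * ψ y * speedDensity μ σ y) - deriv ψ x / scaleDensity μ σ x * f x

/-- `H(f, g; x) = (f' K_g^s - g' K_f^s) / ψ_s'` at `x`, used with `s = r + λ`. -/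
def functionH (μ σ : ℝ → ℝ) (s : ℝ) (ψ f g : ℝ → ℝ) (x : ℝ) : ℝ :=
  (deriv f x * functionalK μ σ s ψ g x - deriv g x * functionalK μ σ s ψ f x) / deriv ψ x

/-- `Q(g, f; x) = (g' L_f^s - f' L_g^s) / φ_s'` at `x`, used with `s = r + λ`. -/
def functionQ (μ σ : ℝ → ℝ) (s : ℝ) (φ g f : ℝ → ℝ) (x : ℝ) : ℝ :=
  (deriv g x * functionalL μ σ s φ f x - deriv f x * functionalL μ σ s φ g x) / deriv φ x

/-- `(a, b)` is a pair of thresholds `0 < a < b` that solves the pair of equations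
`H(ψ_r, g_u; a) = Q(g_d, ψ_r; b)` and `H(φ_r, g_u; a) = Q(g_d, φ_r; b)`. Here `s = r + λ`. -/
structure IsThresholdPair (μ σ : ℝ → ℝ) (s : ℝ) (ψr φr ψs φs gd gu : ℝ → ℝ) (a b : ℝ) :
    Prop where
  pos : 0 < a
  lt : a < b
  eq_psi : functionH μ σ s ψs ψr gu a = functionQ μ σ s φs gd ψr b
  eq_phi : functionH μ σ s ψs φr gu a = functionQ μ σ s φs gd φr b

end

end PoissonControl

open PoissonControl

/-! Write `F = f' / S` for the flux of `f`, so that `𝒜 f` is the derivative of `F` with respect to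
`m`. Put `s = r + λ`, let `p = ψ_s` and `q = φ_s`, and let `P`, `Q` be their fluxes.

Each `g_n` equals `-R_r θ_n`, hence solves `(𝒜 - r) g = θ_n`. For this, the resolvent measure is
identified with the Green measure by testing the martingale problem against compactly supported
Green potentials (`integral_eq_greenInt_testFun`), and the identity function is shown to satisfy
`R_r (μ - r x) = -x` (`exists_isGreen_gFun`). The rest is analysis of ordinary differential
equations; the boundary `∞` is reduced to `0` by `x ↦ 1 / x`.

For `f = ψ_r` or `φ_r` one has `λ K_f = r f P - s F p`. For `g_u` the analogous formula has a
remainder `κ_u` (`kappa`) with derivative `-θ_u' P`. It follows that `λ H(f, g_u; ·)` has derivative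
`κ_u m P⁻² (λ K_f)`, and `λ Q(g_d, f; ·)` has derivative `κ_d m Q⁻² (λ L_f)`. Monotonicity is thus a
matter of signs.

The signs of `κ` come from the equations themselves (`TwoBoundary.kappa_neg`). A pair `(a, b)`
solves them exactly when one combination `k` of `ψ_r` and `φ_r` has the derivative of `g_u` at `a`,
that of `g_d` at `b`, and values there prescribed through `κ_u a` and `κ_d b`. If `κ_u a ≥ 0`,
unimodality forces `θ_u' < 0` on `[a, ∞)`. Since `μ' < r`, the function `k' - g_u'` is then driven
by a cooperative system and is positive at `b`, where it equals `γ_d - γ_u < 0`. So `κ_u a < 0`, and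
symmetrically `κ_d b < 0`; unimodality spreads these signs to `(0, a]` and `[b, ∞)`.

Let two solutions have `a₁ < a₂` (`TwoBoundary.not_lt_of_solutions`). If `b₁ ≤ b₂`, the equation for
`ψ_r` is violated: its left side increases and its right side decreases. If `b₂ < b₁`, take `f = A
ψ_r + D φ_r` with `A, D > 0` and `K_f(a₂) = 0`. Then `K_f ≥ 0` on `(0, a₂]` and the flux of `f` is
positive on `[a₂, ∞)`, so both sides are decreasing functions of their thresholds, the right one
strictly, while the thresholds move in opposite directions. With equal `a`, strict monotonicity in
`b` finishes. -/

namespace PoissonControl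

/-! ### Calculus on the half-line: monotonicity, integrability near `0`, primitives. -/

section HalfLine

theorem strictMonoOn_of_hasDerivAt {D : Set ℝ} (hD : Convex ℝ D) {F f : ℝ → ℝ}
    (hF : ∀ x ∈ D, HasDerivAt F (f x) x) (hf : ∀ x ∈ D, 0 < f x) : StrictMonoOn F D :=
  strictMonoOn_of_hasDerivWithinAt_pos hD
    (fun x hx => (hF x hx).continuousAt.continuousWithinAt)
    (fun x hx => (hF x (interior_subset hx)).hasDerivWithinAt)
    (fun x hx => hf x (interior_subset hx))

theorem monotoneOn_of_hasDerivAt {D : Set ℝ} (hD : Convex ℝ D) {F f : ℝ → ℝ}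
    (hF : ∀ x ∈ D, HasDerivAt F (f x) x) (hf : ∀ x ∈ D, 0 ≤ f x) : MonotoneOn F D :=
  monotoneOn_of_hasDerivWithinAt_nonneg hD
    (fun x hx => (hF x hx).continuousAt.continuousWithinAt)
    (fun x hx => (hF x (interior_subset hx)).hasDerivWithinAt)
    (fun x hx => hf x (interior_subset hx))

theorem strictAntiOn_of_hasDerivAt {D : Set ℝ} (hD : Convex ℝ D) {F f : ℝ → ℝ}
    (hF : ∀ x ∈ D, HasDerivAt F (f x) x) (hf : ∀ x ∈ D, f x < 0) : StrictAntiOn F D :=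
  strictAntiOn_of_hasDerivWithinAt_neg hD
    (fun x hx => (hF x hx).continuousAt.continuousWithinAt)
    (fun x hx => (hF x (interior_subset hx)).hasDerivWithinAt)
    (fun x hx => hf x (interior_subset hx))

theorem antitoneOn_of_hasDerivAt {D : Set ℝ} (hD : Convex ℝ D) {F f : ℝ → ℝ}
    (hF : ∀ x ∈ D, HasDerivAt F (f x) x) (hf : ∀ x ∈ D, f x ≤ 0) : AntitoneOn F D :=
  antitoneOn_of_hasDerivWithinAt_nonpos hD
    (fun x hx => (hF x hx).continuousAt.continuousWithinAt)
    (fun x hx => (hF x (interior_subset hx)).hasDerivWithinAt)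
    (fun x hx => hf x (interior_subset hx))

theorem continuousOn_of_hasDerivAt {D : Set ℝ} {F f : ℝ → ℝ}
    (hF : ∀ x ∈ D, HasDerivAt F (f x) x) : ContinuousOn F D :=
  fun x hx => (hF x hx).continuousAt.continuousWithinAt

theorem eq_of_hasDerivAt_zero {F : ℝ → ℝ} (hF : ∀ x, 0 < x → HasDerivAt F 0 x) {x y : ℝ}
    (hx : 0 < x) (hy : 0 < y) : F x = F y :=
  isOpen_Ioi.is_const_of_deriv_eq_zero isPreconnected_Ioi
    (fun z hz => (hF z hz).differentiableAt.differentiableWithinAt)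
    (fun z hz => (hF z hz).deriv) (mem_Ioi.2 hx) (mem_Ioi.2 hy)

theorem eq_of_hasDerivAt_of_tendsto {F G f : ℝ → ℝ} (hF : ∀ x, 0 < x → HasDerivAt F (f x) x)
    (hG : ∀ x, 0 < x → HasDerivAt G (f x) x)
    (h0 : Tendsto (fun x => F x - G x) (𝓝[>] 0) (𝓝 0)) {x : ℝ} (hx : 0 < x) : F x = G x := by
  have hc : ∀ y, 0 < y → F y - G y = F x - G x := fun y hy =>
    eq_of_hasDerivAt_zero (F := fun y => F y - G y)
      (fun z hz => by simpa using (hF z hz).fun_sub (hG z hz)) hy hx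
  have h1 : Tendsto (fun x => F x - G x) (𝓝[>] 0) (𝓝 (F x - G x)) :=
    tendsto_const_nhds.congr' (by
      filter_upwards [self_mem_nhdsWithin] with y hy using (hc y hy).symm)
  exact sub_eq_zero.1 (tendsto_nhds_unique h1 h0)

theorem integrableOn_Icc_of_continuousOn {f : ℝ → ℝ} (hf : ContinuousOn f (Ioi 0)) {a : ℝ}
    (ha : 0 < a) (b : ℝ) : IntegrableOn f (Icc a b) :=
  (hf.mono fun _ hx => lt_of_lt_of_le ha hx.1).integrableOn_Icc

theorem integrableOn_Ioc_of_continuousOn {f : ℝ → ℝ} (hf : ContinuousOn f (Ioi 0)) {a : ℝ}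
    (ha : 0 < a) (b : ℝ) : IntegrableOn f (Ioc a b) :=
  (integrableOn_Icc_of_continuousOn hf ha b).mono_set Ioc_subset_Icc_self

theorem intervalIntegrable_of_continuousOn {f : ℝ → ℝ} (hf : ContinuousOn f (Ioi 0)) {a b : ℝ}
    (ha : 0 < a) (hb : 0 < b) : IntervalIntegrable f volume a b :=
  (hf.mono fun _ hx => lt_of_lt_of_le (lt_min ha hb) hx.1).intervalIntegrable

theorem integrableOn_Ioc_zero_extend {f : ℝ → ℝ} (hf : ContinuousOn f (Ioi 0)) {c : ℝ}
    (hc : 0 < c) (h : IntegrableOn f (Ioc 0 c)) (d : ℝ) : IntegrableOn f (Ioc 0 d) := by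
  refine (h.union (integrableOn_Ioc_of_continuousOn hf hc d)).mono_set fun x hx => ?_
  rcases le_or_gt x c with h1 | h1
  · exact Or.inl ⟨hx.1, h1⟩
  · exact Or.inr ⟨h1, hx.2⟩

/-- A nonnegative derivative of a function that is bounded below near `0` is integrable there. -/
theorem integrableOn_of_hasDerivAt_of_le {F f : ℝ → ℝ} {C c : ℝ} (hc : 0 < c)
    (hF : ∀ x, 0 < x → HasDerivAt F (f x) x) (hf : ContinuousOn f (Ioi 0))
    (hpos : ∀ x, 0 < x → x ≤ c → 0 ≤ f x) (hC : ∀ x, 0 < x → x ≤ c → C ≤ F x) :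
    IntegrableOn f (Ioc 0 c) := by
  have ha : Tendsto (fun n : ℕ => c / ((n : ℝ) + 1)) atTop (𝓝 0) :=
    tendsto_const_nhds.div_atTop (tendsto_atTop_add_const_right _ _ tendsto_natCast_atTop_atTop)
  have hap : ∀ n : ℕ, 0 < c / ((n : ℝ) + 1) := fun n => by positivity
  have hac : ∀ n : ℕ, c / ((n : ℝ) + 1) ≤ c := fun n =>
    div_le_self hc.le (by linarith [Nat.cast_nonneg (α := ℝ) n])
  refine integrableOn_Ioc_of_intervalIntegral_norm_bounded_left (I := F c - C)
    (fun n => integrableOn_Ioc_of_continuousOn hf (hap n) c) ha (Eventually.of_forall fun n => ?_)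
  have h1 : ∫ x in Ioc (c / ((n : ℝ) + 1)) c, ‖f x‖ = ∫ x in Ioc (c / ((n : ℝ) + 1)) c, f x :=
    setIntegral_congr_fun measurableSet_Ioc fun x hx => by
      rw [Real.norm_of_nonneg (hpos x ((hap n).trans hx.1) hx.2)]
  rw [h1, ← intervalIntegral.integral_of_le (hac n),
    intervalIntegral.integral_eq_sub_of_hasDerivAt (f := F)
      (fun x hx => hF x (by
        rw [uIcc_of_le (hac n)] at hx; exact (hap n).trans_le hx.1))
      (intervalIntegrable_of_continuousOn hf (hap n) hc)]
  linarith [hC _ (hap n) (hac n)]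

theorem tendsto_integral_Ioc_zero {f : ℝ → ℝ} {c : ℝ} (hc : 0 < c)
    (h : IntegrableOn f (Ioc 0 c)) :
    Tendsto (fun x => ∫ y in Ioc 0 x, f y) (𝓝[>] 0) (𝓝 0) := by
  have h1 : Tendsto (fun x => ∫ y in Ioc 0 x, f y ∂(volume.restrict (Ioc 0 c)))
      (𝓝[>] 0) (𝓝 0) := by
    refine h.tendsto_setIntegral_nhds_zero ?_
    have h2 : Tendsto (fun x : ℝ => ENNReal.ofReal x) (𝓝[>] 0) (𝓝 0) := by
      have := (ENNReal.continuous_ofReal.tendsto 0).mono_left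
        (nhdsWithin_le_nhds (s := Ioi (0 : ℝ)))
      simpa using this
    refine tendsto_of_tendsto_of_tendsto_of_le_of_le tendsto_const_nhds h2
      (fun x => zero_le) (fun x => ?_)
    refine (Measure.restrict_apply_le _ _).trans ?_
    simp
  refine h1.congr' ?_
  filter_upwards [Ioo_mem_nhdsGT hc] with x hx
  rw [Measure.restrict_restrict measurableSet_Ioc, inter_eq_left.2 (Ioc_subset_Ioc_right hx.2.le)]

theorem hasDerivAt_integral_Ioc {f : ℝ → ℝ} (hf : ContinuousOn f (Ioi 0))
    (h : ∀ c, IntegrableOn f (Ioc 0 c)) {x : ℝ} (hx : 0 < x) :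
    HasDerivAt (fun x => ∫ y in Ioc 0 x, f y) (f x) x := by
  have h1 : HasDerivAt (fun x => ∫ y in (0 : ℝ)..x, f y) (f x) x :=
    intervalIntegral.integral_hasDerivAt_right
      ((intervalIntegrable_iff_integrableOn_Ioc_of_le hx.le).2 (h x))
      (hf.stronglyMeasurableAtFilter isOpen_Ioi x hx) (hf.continuousAt (Ioi_mem_nhds hx))
  refine h1.congr_of_eventuallyEq ?_
  filter_upwards [Ioi_mem_nhds hx] with y hy
  rw [intervalIntegral.integral_of_le (le_of_lt hy)]

theorem hasDerivAt_integral_Ioi {f : ℝ → ℝ} (hf : ContinuousOn f (Ioi 0))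
    (h : ∀ c, 0 < c → IntegrableOn f (Ioi c)) {x : ℝ} (hx : 0 < x) :
    HasDerivAt (fun x => ∫ y in Ioi x, f y) (-f x) x := by
  have hx2 : 0 < x / 2 := half_pos hx
  have h1 : HasDerivAt (fun y => (∫ z in Ioi (x / 2), f z) - ∫ z in (x / 2)..y, f z)
      (-f x) x := by
    have := (intervalIntegral.integral_hasDerivAt_right
      (intervalIntegrable_of_continuousOn hf hx2 hx)
      (hf.stronglyMeasurableAtFilter isOpen_Ioi x hx)
      (hf.continuousAt (Ioi_mem_nhds hx))).const_sub (∫ z in Ioi (x / 2), f z)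
    simpa using this
  refine h1.congr_of_eventuallyEq ?_
  filter_upwards [Ioi_mem_nhds (half_lt_self hx)] with y hy
  have hy : x / 2 < y := hy
  rw [intervalIntegral.integral_of_le hy.le, ← Ioc_union_Ioi_eq_Ioi hy.le,
    setIntegral_union (Ioc_disjoint_Ioi le_rfl) measurableSet_Ioi
      (integrableOn_Ioc_of_continuousOn hf hx2 y) (h y (hx2.trans hy))]
  ring

theorem eq_integral_Ioc_of_hasDerivAt {F f : ℝ → ℝ} (hF : ∀ x, 0 < x → HasDerivAt F (f x) x)
    (hf : ContinuousOn f (Ioi 0)) (h : ∀ c, IntegrableOn f (Ioc 0 c))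
    (h0 : Tendsto F (𝓝[>] 0) (𝓝 0)) {x : ℝ} (hx : 0 < x) : F x = ∫ y in Ioc 0 x, f y :=
  eq_of_hasDerivAt_of_tendsto hF (fun _ hy => hasDerivAt_integral_Ioc hf h hy)
    (by simpa using h0.sub (tendsto_integral_Ioc_zero one_pos (h 1))) hx

theorem integrableOn_const_mul {f : ℝ → ℝ} {t : Set ℝ} (h : IntegrableOn f t) (c : ℝ) :
    IntegrableOn (fun x => c * f x) t :=
  Integrable.const_mul h c

theorem integrableOn_of_continuousOn_of_abs_le {f g : ℝ → ℝ} {c C : ℝ}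
    (hf : ContinuousOn f (Ioi 0)) (hg : IntegrableOn g (Ioc 0 c))
    (hle : ∀ x, 0 < x → x ≤ c → |f x| ≤ C * g x) : IntegrableOn f (Ioc 0 c) :=
  (hg.const_mul C).mono'
    ((hf.mono Ioc_subset_Ioi_self).aestronglyMeasurable measurableSet_Ioc)
    ((ae_restrict_mem measurableSet_Ioc).mono fun x hx => hle x hx.1 hx.2)

theorem exists_tendsto_of_monotoneOn_of_le {F : ℝ → ℝ} (hF : MonotoneOn F (Ioi 0)) {C : ℝ}
    (hC : ∀ x, 0 < x → C ≤ F x) :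
    ∃ l, C ≤ l ∧ Tendsto F (𝓝[>] 0) (𝓝 l) ∧ ∀ x, 0 < x → l ≤ F x := by
  have hb : BddBelow (F '' Ioi 0) := ⟨C, by rintro _ ⟨x, hx, rfl⟩; exact hC x hx⟩
  refine ⟨sInf (F '' Ioi 0), le_csInf ((nonempty_Ioi).image F)
    (by rintro _ ⟨x, hx, rfl⟩; exact hC x hx), hF.tendsto_nhdsGT hb,
    fun x hx => csInf_le hb ⟨x, hx, rfl⟩⟩

end HalfLine

/-! ### Scale, speed and flux: monotone homogeneous solutions near the boundary `0`. -/

/-- A scale density `S` and a speed density `m` on `(0, ∞)`. -/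
structure Densities (S m : ℝ → ℝ) : Prop where
  scale_cont : ContinuousOn S (Ioi 0)
  scale_pos : ∀ x, 0 < x → 0 < S x
  speed_cont : ContinuousOn m (Ioi 0)
  speed_pos : ∀ x, 0 < x → 0 < m x

/-- The boundary `0` is neither exit nor entrance. -/
structure NaturalAtZero (S m : ℝ → ℝ) : Prop where
  not_exit : ¬ IntegrableOn (fun y => (∫ z in y..1, m z) * S y) (Ioo 0 1)
  not_entrance : ¬ IntegrableOn (fun y => (∫ z in y..1, S z) * m y) (Ioo 0 1)

/-- `f` has flux `F = f' / S`, and `(F' / m) = h`. -/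
structure HasFlux (S m h f F : ℝ → ℝ) : Prop where
  deriv : ∀ x, 0 < x → HasDerivAt f (S x * F x) x
  flux_deriv : ∀ x, 0 < x → HasDerivAt F (h x * m x) x

/-- A positive solution of `(d/dm)(d/dS) f = r f` with positive flux. -/
structure IncSol (S m : ℝ → ℝ) (r : ℝ) (f F : ℝ → ℝ) : Prop
    extends HasFlux S m (fun x => r * f x) f F where
  pos : ∀ x, 0 < x → 0 < f x
  flux_pos : ∀ x, 0 < x → 0 < F x

/-- A positive solution of `(d/dm)(d/dS) f = r f` with negative flux. -/
structure DecSol (S m : ℝ → ℝ) (r : ℝ) (f F : ℝ → ℝ) : Prop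
    extends HasFlux S m (fun x => r * f x) f F where
  pos : ∀ x, 0 < x → 0 < f x
  flux_neg : ∀ x, 0 < x → F x < 0

theorem HasFlux.cont {S m h f F : ℝ → ℝ} (hf : HasFlux S m h f F) : ContinuousOn f (Ioi 0) :=
  continuousOn_of_hasDerivAt fun x hx => hf.deriv x hx

theorem HasFlux.flux_cont {S m h f F : ℝ → ℝ} (hf : HasFlux S m h f F) :
    ContinuousOn F (Ioi 0) :=
  continuousOn_of_hasDerivAt fun x hx => hf.flux_deriv x hx

theorem Densities.tail_hasDerivAt {k : ℝ → ℝ} (hk : ContinuousOn k (Ioi 0)) {x : ℝ}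
    (hx : 0 < x) : HasDerivAt (fun y => ∫ z in y..1, k z) (-k x) x :=
  intervalIntegral.integral_hasDerivAt_left (intervalIntegrable_of_continuousOn hk hx one_pos)
    (hk.stronglyMeasurableAtFilter isOpen_Ioi x hx) (hk.continuousAt (Ioi_mem_nhds hx))

theorem tail_nonneg {k : ℝ → ℝ} (hk : ∀ x, 0 < x → 0 < k x) {x : ℝ} (hx : 0 < x)
    (hx1 : x ≤ 1) : 0 ≤ ∫ z in x..1, k z :=
  intervalIntegral.integral_nonneg hx1 fun u hu => (hk u (hx.trans_le hu.1)).le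

theorem tail_cont {k : ℝ → ℝ} (hk : ContinuousOn k (Ioi 0)) :
    ContinuousOn (fun y => ∫ z in y..1, k z) (Ioi 0) :=
  continuousOn_of_hasDerivAt fun _ hx => Densities.tail_hasDerivAt hk hx

namespace IncSol

variable {S m : ℝ → ℝ} {r : ℝ} {f F : ℝ → ℝ}

theorem strictMonoOn (hf : IncSol S m r f F) (hD : Densities S m) : StrictMonoOn f (Ioi 0) :=
  strictMonoOn_of_hasDerivAt (convex_Ioi 0) (fun x hx => hf.deriv x hx)
    fun x hx => mul_pos (hD.scale_pos x hx) (hf.flux_pos x hx)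

theorem flux_strictMonoOn (hf : IncSol S m r f F) (hD : Densities S m) (hr : 0 < r) :
    StrictMonoOn F (Ioi 0) :=
  strictMonoOn_of_hasDerivAt (convex_Ioi 0) (fun x hx => hf.flux_deriv x hx)
    fun x hx => mul_pos (mul_pos hr (hf.pos x hx)) (hD.speed_pos x hx)

/-- `r f m` is the derivative of the flux, which stays above `0`. -/
theorem integrableOn (hf : IncSol S m r f F) (hD : Densities S m) (hr : 0 < r) (c : ℝ) :
    IntegrableOn (fun x => f x * m x) (Ioc 0 c) := by
  have hc : ContinuousOn (fun x => r * f x * m x) (Ioi 0) :=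
    (hf.cont.const_smul r).mul hD.speed_cont
  have h1 := integrableOn_of_hasDerivAt_of_le (C := 0) one_pos hf.flux_deriv hc
    (fun x hx _ => (mul_pos (mul_pos hr (hf.pos x hx)) (hD.speed_pos x hx)).le)
    (fun x hx _ => (hf.flux_pos x hx).le)
  have h2 := integrableOn_Ioc_zero_extend hc one_pos h1 c
  refine (integrableOn_const_mul h2 r⁻¹).congr_fun (fun x _ => ?_) measurableSet_Ioc
  field_simp

/-- The flux increases, so it has a limit `l ≥ 0` at `0`. With `M x = ∫ₓ¹ m`, a positive `l` bounds
`S M` by `l⁻¹ S F M`, which is integrable; this contradicts non-exit. -/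
theorem tendsto_flux (hf : IncSol S m r f F) (hD : Densities S m) (hN : NaturalAtZero S m)
    (hr : 0 < r) : Tendsto F (𝓝[>] 0) (𝓝 0) := by
  obtain ⟨l, hl0, hl, hle⟩ := exists_tendsto_of_monotoneOn_of_le
    (hf.flux_strictMonoOn hD hr).monotoneOn (C := 0) (fun x hx => (hf.flux_pos x hx).le)
  rcases hl0.eq_or_lt with rfl | hlpos
  · exact hl
  refine absurd ?_ hN.not_exit
  have hfm := hf.integrableOn hD hr
  have hfmc : ContinuousOn (fun x => f x * m x) (Ioi 0) := hf.cont.mul hD.speed_cont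
  have hMc := tail_cont hD.speed_cont
  -- The function `f M + ∫₀ˣ f m` is a nonnegative primitive: the derivative of `M` cancels that of
  -- the integral.
  have h1 : IntegrableOn (fun x => S x * F x * ∫ z in x..1, m z) (Ioc 0 1) := by
    refine integrableOn_of_hasDerivAt_of_le (C := 0) one_pos
      (F := fun x => f x * (∫ z in x..1, m z) + ∫ y in Ioc 0 x, f y * m y)
      (fun x hx => ?_) ((hD.scale_cont.mul hf.flux_cont).mul hMc) (fun x hx hx1 => ?_)
      (fun x hx hx1 => ?_)
    · refine (((hf.deriv x hx).fun_mul (Densities.tail_hasDerivAt hD.speed_cont hx)).fun_add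
        (hasDerivAt_integral_Ioc hfmc hfm hx)).congr_deriv ?_
      ring
    · exact mul_nonneg (mul_pos (hD.scale_pos x hx) (hf.flux_pos x hx)).le
        (tail_nonneg hD.speed_pos hx hx1)
    · refine add_nonneg (mul_nonneg (hf.pos x hx).le (tail_nonneg hD.speed_pos hx hx1)) ?_
      exact setIntegral_nonneg measurableSet_Ioc fun y hy =>
        (mul_pos (hf.pos y hy.1) (hD.speed_pos y hy.1)).le
  refine (integrableOn_of_continuousOn_of_abs_le (C := l⁻¹) (hMc.fun_mul hD.scale_cont) h1
    fun x hx hx1 => ?_).mono_set Ioo_subset_Ioc_self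
  have hM := tail_nonneg hD.speed_pos hx hx1
  have hS := hD.scale_pos x hx
  rw [abs_of_nonneg (mul_nonneg hM hS.le), inv_mul_eq_div, le_div_iff₀ hlpos]
  nlinarith [mul_le_mul_of_nonneg_left (hle x hx) (mul_nonneg hM hS.le)]

/-- Twin of the argument for the flux, with `T x = ∫ₓ¹ S`: a positive limit `l` of `f` bounds `T m`
by `(r l)⁻¹ r f m T`, which has the nonnegative primitive `F T + f`. This contradicts non-entrance.
-/
theorem tendsto_zero (hf : IncSol S m r f F) (hD : Densities S m) (hN : NaturalAtZero S m)
    (hr : 0 < r) : Tendsto f (𝓝[>] 0) (𝓝 0) := by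
  obtain ⟨l, hl0, hl, hle⟩ := exists_tendsto_of_monotoneOn_of_le
    (hf.strictMonoOn hD).monotoneOn (C := 0) (fun x hx => (hf.pos x hx).le)
  rcases hl0.eq_or_lt with rfl | hlpos
  · exact hl
  refine absurd ?_ hN.not_entrance
  have hTc := tail_cont hD.scale_cont
  have h1 : IntegrableOn (fun x => r * f x * m x * ∫ z in x..1, S z) (Ioc 0 1) := by
    refine integrableOn_of_hasDerivAt_of_le (C := 0) one_pos
      (F := fun x => F x * (∫ z in x..1, S z) + f x)
      (fun x hx => ?_) (((hf.cont.const_smul r).mul hD.speed_cont).mul hTc) (fun x hx hx1 => ?_)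
      (fun x hx hx1 => ?_)
    · refine (((hf.flux_deriv x hx).fun_mul (Densities.tail_hasDerivAt hD.scale_cont hx)).fun_add
        (hf.deriv x hx)).congr_deriv ?_
      ring
    · exact mul_nonneg (mul_pos (mul_pos hr (hf.pos x hx)) (hD.speed_pos x hx)).le
        (tail_nonneg hD.scale_pos hx hx1)
    · exact add_nonneg (mul_nonneg (hf.flux_pos x hx).le (tail_nonneg hD.scale_pos hx hx1))
        (hf.pos x hx).le
  refine (integrableOn_of_continuousOn_of_abs_le (C := (r * l)⁻¹) (hTc.fun_mul hD.speed_cont) h1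
    fun x hx hx1 => ?_).mono_set Ioo_subset_Ioc_self
  have hT := tail_nonneg hD.scale_pos hx hx1
  have hm := hD.speed_pos x hx
  rw [abs_of_nonneg (mul_nonneg hT hm.le), inv_mul_eq_div, le_div_iff₀ (mul_pos hr hlpos)]
  nlinarith [mul_le_mul_of_nonneg_left (hle x hx) (mul_nonneg (mul_nonneg hT hm.le) hr.le)]

theorem flux_eq (hf : IncSol S m r f F) (hD : Densities S m) (hN : NaturalAtZero S m)
    (hr : 0 < r) {x : ℝ} (hx : 0 < x) : F x = ∫ y in Ioc 0 x, r * f y * m y :=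
  eq_integral_Ioc_of_hasDerivAt hf.flux_deriv ((hf.cont.const_smul r).mul hD.speed_cont)
    (fun c => by simpa only [mul_assoc] using integrableOn_const_mul (hf.integrableOn hD hr c) r)
    (hf.tendsto_flux hD hN hr) hx

/-- `q F → 0` at `0` if `q ≥ 0` is nonincreasing near `0` and `q f m` is integrable there. -/
theorem tendsto_antitone_mul_flux (hf : IncSol S m r f F) (hD : Densities S m)
    (hN : NaturalAtZero S m) (hr : 0 < r) {q : ℝ → ℝ} (hq : ContinuousOn q (Ioi 0))
    (hint : IntegrableOn (fun x => q x * f x * m x) (Ioc 0 1)) {c : ℝ} (hc : 0 < c)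
    (hanti : AntitoneOn q (Ioc 0 c)) (hq0 : ∀ x, 0 < x → x ≤ c → 0 ≤ q x) :
    Tendsto (fun x => q x * F x) (𝓝[>] 0) (𝓝 0) := by
  have hint' := integrableOn_Ioc_zero_extend ((hq.fun_mul hf.cont).fun_mul hD.speed_cont)
    one_pos hint
  have h0 : Tendsto (fun x => r * ∫ y in Ioc 0 x, q y * f y * m y) (𝓝[>] 0) (𝓝 0) := by
    simpa using (tendsto_integral_Ioc_zero one_pos hint).const_mul r
  refine tendsto_of_tendsto_of_tendsto_of_le_of_le' tendsto_const_nhds h0 ?_ ?_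
  · filter_upwards [Ioc_mem_nhdsGT hc] with x hx
    exact mul_nonneg (hq0 x hx.1 hx.2) (hf.flux_pos x hx.1).le
  · filter_upwards [Ioc_mem_nhdsGT hc] with x hx
    -- Write `q x * F x` as `r ∫₀ˣ q(x) f m` and use `q x ≤ q y` for `y ≤ x`.
    rw [hf.flux_eq hD hN hr hx.1, ← integral_const_mul, ← integral_const_mul]
    refine setIntegral_mono_on ?_ (integrableOn_const_mul (hint' x) r) measurableSet_Ioc
      fun y hy => ?_
    · simpa only [mul_assoc] using
        integrableOn_const_mul (integrableOn_const_mul (hf.integrableOn hD hr x) r) (q x)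
    · have h1 := hanti ⟨hy.1, hy.2.trans hx.2⟩ hx hy.2
      have h2 := mul_pos (mul_pos hr (hf.pos y hy.1)) (hD.speed_pos y hy.1)
      nlinarith [mul_le_mul_of_nonneg_right h1 h2.le]

end IncSol

namespace DecSol

variable {S m : ℝ → ℝ} {r : ℝ} {f F : ℝ → ℝ}

theorem strictAntiOn (hf : DecSol S m r f F) (hD : Densities S m) : StrictAntiOn f (Ioi 0) :=
  strictAntiOn_of_hasDerivAt (convex_Ioi 0) (fun x hx => hf.deriv x hx)
    fun x hx => mul_neg_of_pos_of_neg (hD.scale_pos x hx) (hf.flux_neg x hx)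

theorem flux_strictMonoOn (hf : DecSol S m r f F) (hD : Densities S m) (hr : 0 < r) :
    StrictMonoOn F (Ioi 0) :=
  strictMonoOn_of_hasDerivAt (convex_Ioi 0) (fun x hx => hf.flux_deriv x hx)
    fun x hx => mul_pos (mul_pos hr (hf.pos x hx)) (hD.speed_pos x hx)

/-- On `(0, 1]` the flux is at most `F 1 < 0`, so `f x` is at least `-F 1` times `∫ₓ¹ S`.
Integrability of `f m` would make `0` an entrance boundary. -/
theorem not_integrableOn (hf : DecSol S m r f F) (hD : Densities S m) (hN : NaturalAtZero S m)
    (hr : 0 < r) : ¬ IntegrableOn (fun x => f x * m x) (Ioc 0 1) := by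
  intro h
  refine hN.not_entrance ((integrableOn_of_continuousOn_of_abs_le (C := (-F 1)⁻¹)
    ((tail_cont hD.scale_cont).fun_mul hD.speed_cont) h fun x hx hx1 => ?_).mono_set
      Ioo_subset_Ioc_self)
  have hT := tail_nonneg hD.scale_pos hx hx1
  have hm := hD.speed_pos x hx
  have hF1 := hf.flux_neg 1 one_pos
  rw [abs_of_nonneg (mul_nonneg hT hm.le), inv_mul_eq_div, le_div_iff₀ (neg_pos.2 hF1)]
  have hanti : AntitoneOn (fun x => f x + F 1 * ∫ z in x..1, S z) (Ioc 0 1) := by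
    refine antitoneOn_of_hasDerivAt (convex_Ioc 0 1) (fun y hy => (hf.deriv y hy.1).fun_add
      ((Densities.tail_hasDerivAt hD.scale_cont hy.1).const_mul (F 1))) fun y hy => ?_
    have := (hf.flux_strictMonoOn hD hr).monotoneOn hy.1 (mem_Ioi.2 one_pos) hy.2
    nlinarith [hD.scale_pos y hy.1]
  have h1 := hanti ⟨hx, hx1⟩ ⟨one_pos, le_rfl⟩ hx1
  simp only [intervalIntegral.integral_same, mul_zero, add_zero] at h1
  nlinarith [hf.pos 1 one_pos]

end DecSol

/-! ### Two discount rates at the boundary `0` -/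

section TwoRates

variable {S m : ℝ → ℝ} {r s : ℝ} {f F p P : ℝ → ℝ}

theorem hasDerivAt_wronskian {h k : ℝ → ℝ} (hf : HasFlux S m h f F) (hp : HasFlux S m k p P)
    {x : ℝ} (hx : 0 < x) :
    HasDerivAt (fun x => P x * f x - F x * p x) ((k x * f x - h x * p x) * m x) x := by
  refine (((hp.flux_deriv x hx).fun_mul (hf.deriv x hx)).fun_sub
    ((hf.flux_deriv x hx).fun_mul (hp.deriv x hx))).congr_deriv ?_
  ring

/-- The Wronskian starts from `0` at the boundary and has derivative `(s - r) p f m > 0`. -/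
theorem IncSol.wronskian_pos (hf : IncSol S m r f F) (hp : IncSol S m s p P)
    (hD : Densities S m) (hN : NaturalAtZero S m) (hr : 0 < r) (hrs : r < s) {x : ℝ}
    (hx : 0 < x) : 0 < P x * f x - F x * p x := by
  have hs := hr.trans hrs
  have hmono : StrictMonoOn (fun x => P x * f x - F x * p x) (Ioi 0) :=
    strictMonoOn_of_hasDerivAt (convex_Ioi 0)
      (fun y hy => hasDerivAt_wronskian hf.toHasFlux hp.toHasFlux hy) fun y hy => by
        have hy : 0 < y := hy
        have : (s * p y * f y - r * f y * p y) * m y = (s - r) * (p y * f y * m y) := by ring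
        rw [this]
        exact mul_pos (sub_pos.2 hrs)
          (mul_pos (mul_pos (hp.pos y hy) (hf.pos y hy)) (hD.speed_pos y hy))
  have h0 : Tendsto (fun x => P x * f x - F x * p x) (𝓝[>] 0) (𝓝 0) := by
    simpa using ((hp.tendsto_flux hD hN hs).mul (hf.tendsto_zero hD hN hr)).sub
      ((hf.tendsto_flux hD hN hr).mul (hp.tendsto_zero hD hN hs))
  have h1 : (0 : ℝ) ≤ P (x / 2) * f (x / 2) - F (x / 2) * p (x / 2) := by
    refine le_of_tendsto h0 ?_
    filter_upwards [Ioo_mem_nhdsGT (half_pos hx)] with y hy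
    exact (hmono hy.1 (half_pos hx) hy.2).le
  exact h1.trans_lt (hmono (half_pos hx) hx (half_lt_self hx))

/-- The Wronskian `P f - F p` is a sum of two positive terms, and its derivative is `(s - r) p f m ≥
0`. The gap between the two rates is what yields integrability. -/
theorem integrableOn_dec_mul_inc (hf : DecSol S m r f F) (hp : IncSol S m s p P)
    (hD : Densities S m) (hrs : r < s) (c : ℝ) :
    IntegrableOn (fun x => f x * p x * m x) (Ioc 0 c) := by
  have hcont : ContinuousOn (fun x => f x * p x * m x) (Ioi 0) :=
    (hf.cont.mul hp.cont).mul hD.speed_cont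
  refine integrableOn_Ioc_zero_extend hcont one_pos ?_ c
  have h1 := integrableOn_of_hasDerivAt_of_le (C := 0) (c := 1) one_pos
    (fun x hx => hasDerivAt_wronskian hf.toHasFlux hp.toHasFlux hx)
    (f := fun x => (s * p x * f x - r * f x * p x) * m x)
    ((((hp.cont.const_smul s).mul hf.cont).sub ((hf.cont.const_smul r).mul hp.cont)).mul
      hD.speed_cont)
    (fun x hx _ => by
      have : (s * p x * f x - r * f x * p x) * m x = (s - r) * (p x * f x * m x) := by ring
      rw [this]
      exact (mul_pos (sub_pos.2 hrs)
        (mul_pos (mul_pos (hp.pos x hx) (hf.pos x hx)) (hD.speed_pos x hx))).le)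
    (fun x hx _ => by
      nlinarith [mul_pos (hp.flux_pos x hx) (hf.pos x hx),
        mul_pos (neg_pos.2 (hf.flux_neg x hx)) (hp.pos x hx)])
  refine (integrableOn_const_mul h1 (s - r)⁻¹).congr_fun (fun x _ => ?_) measurableSet_Ioc
  have : s - r ≠ 0 := (sub_pos.2 hrs).ne'
  field_simp

theorem tendsto_dec_mul_flux_inc (hf : DecSol S m r f F) (hp : IncSol S m s p P)
    (hD : Densities S m) (hN : NaturalAtZero S m) (hr : 0 < r) (hrs : r < s) :
    Tendsto (fun x => f x * P x) (𝓝[>] 0) (𝓝 0) :=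
  hp.tendsto_antitone_mul_flux hD hN (hr.trans hrs) hf.cont
    (integrableOn_dec_mul_inc hf hp hD hrs 1) one_pos
    ((hf.strictAntiOn hD).antitoneOn.mono Ioc_subset_Ioi_self) fun x hx _ => (hf.pos x hx).le

/-- For `x ≤ c`, monotonicity of `p` gives `-F x * p x ≤ -F c * p x + r ∫ₓᶜ f p m`. The integral is
small if `c` is, and then the first term is small because `p` vanishes at `0`. -/
theorem tendsto_flux_dec_mul_inc (hf : DecSol S m r f F) (hp : IncSol S m s p P)
    (hD : Densities S m) (hN : NaturalAtZero S m) (hr : 0 < r) (hrs : r < s) :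
    Tendsto (fun x => F x * p x) (𝓝[>] 0) (𝓝 0) := by
  have hs := hr.trans hrs
  have hint := integrableOn_dec_mul_inc hf hp hD hrs
  have hcont : ContinuousOn (fun x => f x * p x * m x) (Ioi 0) :=
    (hf.cont.mul hp.cont).mul hD.speed_cont
  have h0 : Tendsto (fun x => r * ∫ y in Ioc 0 x, f y * p y * m y) (𝓝[>] 0) (𝓝 0) := by
    simpa using (tendsto_integral_Ioc_zero one_pos (hint 1)).const_mul r
  rw [Metric.tendsto_nhdsWithin_nhds] at *
  intro ε hε
  obtain ⟨δ, hδ, h1⟩ := h0 (ε / 2) (half_pos hε)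
  -- The fixed right end `c` is `δ / 2`.
  have hc : 0 < δ / 2 := half_pos hδ
  have h2 := h1 (x := δ / 2) hc (by rw [Real.dist_eq, sub_zero, abs_of_pos hc]; linarith)
  rw [Real.dist_eq, sub_zero] at h2
  have h3 : Tendsto (fun x => p x * (-F (δ / 2))) (𝓝[>] 0) (𝓝 0) := by
    simpa using (hp.tendsto_zero hD hN hs).mul_const (-F (δ / 2))
  rw [Metric.tendsto_nhdsWithin_nhds] at h3
  obtain ⟨η, hη, h4⟩ := h3 (ε / 2) (half_pos hε)
  refine ⟨min η (δ / 2), lt_min hη hc, fun {x} hx hxd => ?_⟩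
  have hx : 0 < x := hx
  have h5 := h4 (x := x) hx (hxd.trans_le (min_le_left _ _))
  rw [Real.dist_eq, sub_zero, abs_of_pos hx] at hxd
  rw [Real.dist_eq, sub_zero, abs_of_nonneg
    (mul_nonneg (hp.pos x hx).le (neg_pos.2 (hf.flux_neg _ hc)).le)] at h5
  have hxc : x ≤ δ / 2 := (hxd.trans_le (min_le_right _ _)).le
  have hanti : AntitoneOn (fun y => p x * F y - r * ∫ z in Ioc 0 y, f z * p z * m z)
      (Icc x (δ / 2)) := by
    refine antitoneOn_of_hasDerivAt (convex_Icc _ _)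
      (fun y hy => ((hf.flux_deriv y (hx.trans_le hy.1)).const_mul (p x)).fun_sub
        ((hasDerivAt_integral_Ioc hcont hint (hx.trans_le hy.1)).const_mul r)) fun y hy => ?_
    have hy0 := hx.trans_le hy.1
    have h6 := (hp.strictMonoOn hD).monotoneOn hx hy0 hy.1
    have h7 := mul_pos (mul_pos hr (hf.pos y hy0)) (hD.speed_pos y hy0)
    nlinarith [mul_le_mul_of_nonneg_right h6 h7.le]
  have h8 := hanti ⟨le_rfl, hxc⟩ ⟨hxc, le_rfl⟩ hxc
  have h9 : 0 ≤ r * ∫ z in Ioc 0 x, f z * p z * m z :=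
    mul_nonneg hr.le (setIntegral_nonneg measurableSet_Ioc fun z hz =>
      (mul_pos (mul_pos (hf.pos z hz.1) (hp.pos z hz.1)) (hD.speed_pos z hz.1)).le)
  have h10 := le_abs_self (r * ∫ z in Ioc 0 (δ / 2), f z * p z * m z)
  have h11 := mul_pos (neg_pos.2 (hf.flux_neg x hx)) (hp.pos x hx)
  rw [Real.dist_eq, sub_zero, abs_of_neg (by linarith)]
  simp only at h8
  linarith

end TwoRates

/-! ### Green potentials and the remainder `kappa`. -/

/-- `g = -(φ I + ψ J) / B` with `I' = ψ θ m`, `J' = -φ θ m` and `I` vanishing at `0`, together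
with its flux `G`. -/
structure IsGreen (m ψ Ψ φ Φ θ I J : ℝ → ℝ) (B : ℝ) (g G : ℝ → ℝ) : Prop where
  theta_cont : ContinuousOn θ (Ioi 0)
  integrableOn : IntegrableOn (fun x => ψ x * θ x * m x) (Ioc 0 1)
  I_deriv : ∀ x, 0 < x → HasDerivAt I (ψ x * θ x * m x) x
  J_deriv : ∀ x, 0 < x → HasDerivAt J (-(φ x * θ x * m x)) x
  I_tendsto : Tendsto I (𝓝[>] 0) (𝓝 0)
  wronskian : ∀ x, 0 < x → Ψ x * φ x - Φ x * ψ x = B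
  eq : ∀ x, 0 < x → g x = -(φ x * I x + ψ x * J x) / B
  flux_eq : ∀ x, 0 < x → G x = -(Φ x * I x + Ψ x * J x) / B

/-- `λ K_g - ((r g + θ) P - s G p)`, where `λ = s - r`. -/
noncomputable def kappa (m : ℝ → ℝ) (r s : ℝ) (θ g G p P : ℝ → ℝ) (x : ℝ) : ℝ :=
  (s - r) * (s * (∫ y in Ioc 0 x, g y * p y * m y) - P x * g x)
    - ((r * g x + θ x) * P x - s * G x * p x)

section Green

variable {S m : ℝ → ℝ} {r s : ℝ} {ψ Ψ φ Φ p P θ I J g G : ℝ → ℝ} {B : ℝ}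

theorem IsGreen.wronskian_pos (hg : IsGreen m ψ Ψ φ Φ θ I J B g G) (hψ : IncSol S m r ψ Ψ)
    (hφ : DecSol S m r φ Φ) : 0 < B := by
  rw [← hg.wronskian 1 one_pos]
  nlinarith [mul_pos (hψ.flux_pos 1 one_pos) (hφ.pos 1 one_pos),
    mul_pos (neg_pos.2 (hφ.flux_neg 1 one_pos)) (hψ.pos 1 one_pos)]

/-- Variation of parameters: the terms with `I'` and `J'` cancel in `g'`, and in `G'` they leave the
Wronskian `B`. -/
theorem IsGreen.hasFlux (hg : IsGreen m ψ Ψ φ Φ θ I J B g G) (hψ : IncSol S m r ψ Ψ)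
    (hφ : DecSol S m r φ Φ) : HasFlux S m (fun x => r * g x + θ x) g G := by
  have hB := (hg.wronskian_pos hψ hφ).ne'
  constructor
  · intro x hx
    have h1 : HasDerivAt (fun x => -(φ x * I x + ψ x * J x) / B)
        (S x * (-(Φ x * I x + Ψ x * J x) / B)) x := by
      refine ((((hφ.deriv x hx).fun_mul (hg.I_deriv x hx)).fun_add
        ((hψ.deriv x hx).fun_mul (hg.J_deriv x hx))).fun_neg.div_const B).congr_deriv ?_
      ring
    rw [hg.flux_eq x hx]
    refine h1.congr_of_eventuallyEq ?_
    filter_upwards [Ioi_mem_nhds hx] with y hy using hg.eq y hy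
  · intro x hx
    have h1 : HasDerivAt (fun x => -(Φ x * I x + Ψ x * J x) / B)
        ((r * (-(φ x * I x + ψ x * J x) / B) + θ x) * m x) x := by
      refine ((((hφ.flux_deriv x hx).fun_mul (hg.I_deriv x hx)).fun_add
        ((hψ.flux_deriv x hx).fun_mul (hg.J_deriv x hx))).fun_neg.div_const B).congr_deriv ?_
      have hw := hg.wronskian x hx
      have hw' : (Ψ x * φ x - Φ x * ψ x) / B = 1 := by rw [hw, div_self hB]
      linear_combination (θ x * m x) * hw'
    rw [hg.eq x hx]
    refine h1.congr_of_eventuallyEq ?_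
    filter_upwards [Ioi_mem_nhds hx] with y hy using hg.flux_eq y hy

/-- Near `0`, the part of `g` governed by the outer integral is dominated by `φ`. -/
theorem IsGreen.exists_bound (hg : IsGreen m ψ Ψ φ Φ θ I J B g G) (hψ : IncSol S m r ψ Ψ)
    (hφ : DecSol S m r φ Φ) (hD : Densities S m) :
    ∃ C, ∀ x, 0 < x → x ≤ 1 → |ψ x * J x| ≤ C * φ x ∧ |g x| ≤ C * φ x := by
  have hB := hg.wronskian_pos hψ hφ
  set K := ∫ y in Ioc 0 1, |ψ y * θ y * m y| with hK
  have hint : IntegrableOn (fun y => |ψ y * θ y * m y|) (Ioc 0 1) := hg.integrableOn.abs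
  have hK0 : 0 ≤ K := setIntegral_nonneg measurableSet_Ioc fun _ _ => abs_nonneg _
  have hcI : ContinuousOn (fun y => ψ y * θ y * m y) (Ioi 0) :=
    (hψ.cont.fun_mul hg.theta_cont).fun_mul hD.speed_cont
  have hcJ : ContinuousOn (fun y => φ y * θ y * m y) (Ioi 0) :=
    (hφ.cont.fun_mul hg.theta_cont).fun_mul hD.speed_cont
  have hI : ∀ x, 0 < x → x ≤ 1 → |I x| ≤ K := by
    intro x hx hx1
    rw [eq_integral_Ioc_of_hasDerivAt hg.I_deriv hcI
      (integrableOn_Ioc_zero_extend hcI one_pos hg.integrableOn) hg.I_tendsto hx]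
    exact (abs_integral_le_integral_abs).trans (setIntegral_mono_set hint
      (ae_of_all _ fun _ => abs_nonneg _) (Ioc_subset_Ioc_right hx1).eventuallyLE)
  -- For `x ≤ y` one has `ψ x * φ y ≤ φ x * ψ y`; this trades `φ θ m`, perhaps not integrable at
  -- `0`, for the integrable `ψ θ m`.
  have hJ : ∀ x, 0 < x → x ≤ 1 → |ψ x * (J x - J 1)| ≤ K * φ x := by
    intro x hx hx1
    have h1 : J x - J 1 = ∫ y in Ioc x 1, φ y * θ y * m y := by
      have := intervalIntegral.integral_eq_sub_of_hasDerivAt (f := J) (a := x) (b := 1)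
        (fun y hy => hg.J_deriv y (by rw [uIcc_of_le hx1] at hy; exact hx.trans_le hy.1))
        (intervalIntegrable_of_continuousOn hcJ.fun_neg hx one_pos)
      rw [intervalIntegral.integral_neg, intervalIntegral.integral_of_le hx1] at this
      linarith
    rw [h1, ← integral_const_mul, mul_comm K, ← integral_const_mul]
    refine (abs_integral_le_integral_abs).trans (le_trans ?_ (setIntegral_mono_set
      (integrableOn_const_mul hint (φ x))
      (ae_of_all _ fun _ => mul_nonneg (hφ.pos x hx).le (abs_nonneg _))
      (LE.le.eventuallyLE (Ioc_subset_Ioc_left hx.le))))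
    refine setIntegral_mono_on
      (integrableOn_const_mul (integrableOn_Ioc_of_continuousOn hcJ hx 1) (ψ x)).abs
      (integrableOn_const_mul (hint.mono_set (Ioc_subset_Ioc_left hx.le)) (φ x))
      measurableSet_Ioc fun y hy => ?_
    have hy0 := hx.trans hy.1
    have h2 := (hψ.strictMonoOn hD).monotoneOn hx hy0 hy.1.le
    have h3 := (hφ.strictAntiOn hD).antitoneOn hx hy0 hy.1.le
    have h4 : ψ x * φ y ≤ φ x * ψ y := by
      rw [mul_comm (φ x)]
      exact mul_le_mul h2 h3 (hφ.pos y hy0).le (hψ.pos y hy0).le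
    rw [abs_mul, abs_mul, abs_mul, abs_mul, abs_mul, abs_of_pos (hψ.pos x hx),
      abs_of_pos (hφ.pos y hy0), abs_of_pos (hψ.pos y hy0)]
    have h5 := mul_le_mul_of_nonneg_right h4 (mul_nonneg (abs_nonneg (θ y)) (abs_nonneg (m y)))
    linarith
  have hφ1 := hφ.pos 1 one_pos
  have hψ1 := hψ.pos 1 one_pos
  set C := K + ψ 1 * |J 1| / φ 1 with hC
  have hCn : 0 ≤ C := by positivity
  have hψJ : ∀ x, 0 < x → x ≤ 1 → |ψ x * J x| ≤ C * φ x := by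
    intro x hx hx1
    have h1 : ψ x * J x = ψ x * (J x - J 1) + ψ x * J 1 := by ring
    have h2 : |ψ x * J 1| ≤ ψ 1 * |J 1| / φ 1 * φ x := by
      rw [abs_mul, abs_of_pos (hψ.pos x hx), div_mul_eq_mul_div, le_div_iff₀ hφ1]
      have h2 := (hψ.strictMonoOn hD).monotoneOn hx (mem_Ioi.2 one_pos) hx1
      have h3 := (hφ.strictAntiOn hD).antitoneOn hx (mem_Ioi.2 one_pos) hx1
      exact mul_le_mul (mul_le_mul_of_nonneg_right h2 (abs_nonneg _)) h3 hφ1.le (by positivity)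
    rw [h1]
    refine (abs_add_le _ _).trans ?_
    rw [hC, add_mul]
    exact add_le_add (hJ x hx hx1) h2
  refine ⟨max C ((K + C) / B), fun x hx hx1 => ⟨(hψJ x hx hx1).trans
    (mul_le_mul_of_nonneg_right (le_max_left _ _) (hφ.pos x hx).le), ?_⟩⟩
  refine le_trans ?_ (mul_le_mul_of_nonneg_right (le_max_right _ _) (hφ.pos x hx).le)
  rw [hg.eq x hx, abs_div, abs_neg, abs_of_pos hB, div_mul_eq_mul_div]
  refine div_le_div_of_nonneg_right ((abs_add_le _ _).trans ?_) hB.le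
  rw [add_mul]
  refine add_le_add ?_ (hψJ x hx hx1)
  rw [abs_mul, abs_of_pos (hφ.pos x hx), mul_comm]
  exact mul_le_mul_of_nonneg_right (hI x hx hx1) (hφ.pos x hx).le

/-- Near `0`, `|g| ≤ C φ`, and `φ p m` is integrable because `r < s`. -/
theorem IsGreen.integrableOn_mul (hg : IsGreen m ψ Ψ φ Φ θ I J B g G) (hψ : IncSol S m r ψ Ψ)
    (hφ : DecSol S m r φ Φ) (hp : IncSol S m s p P) (hD : Densities S m) (hrs : r < s) (c : ℝ) :
    IntegrableOn (fun x => g x * p x * m x) (Ioc 0 c) := by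
  obtain ⟨C, hC⟩ := hg.exists_bound hψ hφ hD
  have hcont : ContinuousOn (fun x => g x * p x * m x) (Ioi 0) :=
    ((hg.hasFlux hψ hφ).cont.fun_mul hp.cont).fun_mul hD.speed_cont
  refine integrableOn_Ioc_zero_extend hcont one_pos (integrableOn_of_continuousOn_of_abs_le
    (C := C) hcont (integrableOn_dec_mul_inc hφ hp hD hrs 1) fun x hx hx1 => ?_) c
  have h1 := mul_pos (hp.pos x hx) (hD.speed_pos x hx)
  rw [mul_assoc, mul_assoc, abs_mul, abs_of_pos h1, ← mul_assoc C]
  exact mul_le_mul_of_nonneg_right (hC x hx hx1).2 h1.le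

/-- Up to the factor `-1 / B`, the expression is `(φ P - Φ p) I + (P ψ - Ψ p) J`. The first product
consists of null factors. In the second `J` may be unbounded, but `0 < P ψ - Ψ p ≤ P ψ` and `|ψ J| ≤
C φ` leave the null bound `C φ P`. -/
theorem IsGreen.tendsto_wronskian (hg : IsGreen m ψ Ψ φ Φ θ I J B g G)
    (hψ : IncSol S m r ψ Ψ) (hφ : DecSol S m r φ Φ) (hp : IncSol S m s p P) (hD : Densities S m)
    (hN : NaturalAtZero S m) (hr : 0 < r) (hrs : r < s) :
    Tendsto (fun x => P x * g x - G x * p x) (𝓝[>] 0) (𝓝 0) := by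
  obtain ⟨C, hC⟩ := hg.exists_bound hψ hφ hD
  have hB := hg.wronskian_pos hψ hφ
  have h1 : Tendsto (fun x => (φ x * P x - Φ x * p x) * I x) (𝓝[>] 0) (𝓝 0) := by
    simpa using ((tendsto_dec_mul_flux_inc hφ hp hD hN hr hrs).sub
      (tendsto_flux_dec_mul_inc hφ hp hD hN hr hrs)).mul hg.I_tendsto
  have h2 : Tendsto (fun x => (P x * ψ x - Ψ x * p x) * J x) (𝓝[>] 0) (𝓝 0) := by
    have h3 : Tendsto (fun x => C * (φ x * P x)) (𝓝[>] 0) (𝓝 0) := by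
      simpa using (tendsto_dec_mul_flux_inc hφ hp hD hN hr hrs).const_mul C
    refine squeeze_zero_norm' ?_ h3
    filter_upwards [Ioc_mem_nhdsGT one_pos] with x hx
    have h4 := hψ.wronskian_pos hp hD hN hr hrs hx.1
    have h5 := mul_pos (hψ.flux_pos x hx.1) (hp.pos x hx.1)
    have h6 := (hC x hx.1 hx.2).1
    rw [abs_mul, abs_of_pos (hψ.pos x hx.1)] at h6
    rw [Real.norm_eq_abs, abs_mul, abs_of_pos h4]
    have h7 := mul_le_mul_of_nonneg_left h6 (hp.flux_pos x hx.1).le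
    nlinarith [mul_nonneg h5.le (abs_nonneg (J x))]
  have h3 : Tendsto (fun x => -((φ x * P x - Φ x * p x) * I x + (P x * ψ x - Ψ x * p x) * J x) / B)
      (𝓝[>] 0) (𝓝 0) := by
    simpa using (h1.add h2).neg.div_const B
  refine h3.congr' ?_
  filter_upwards [self_mem_nhdsWithin] with x hx
  rw [hg.eq x hx, hg.flux_eq x hx]
  ring

/-- The purpose of `kappa`: all terms in `g`, `G` and `θ` cancel, so that the sign of `θ'` alone
decides its monotonicity. -/
theorem IsGreen.hasDerivAt_kappa (hg : IsGreen m ψ Ψ φ Φ θ I J B g G)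
    (hψ : IncSol S m r ψ Ψ) (hφ : DecSol S m r φ Φ) (hp : IncSol S m s p P) (hD : Densities S m)
    (hrs : r < s) {x d : ℝ} (hx : 0 < x) (hθ : HasDerivAt θ d x) :
    HasDerivAt (kappa m r s θ g G p P) (-(d * P x)) x := by
  have hgf := hg.hasFlux hψ hφ
  have hcont : ContinuousOn (fun x => g x * p x * m x) (Ioi 0) :=
    (hgf.cont.fun_mul hp.cont).fun_mul hD.speed_cont
  have h1 := hasDerivAt_integral_Ioc hcont (hg.integrableOn_mul hψ hφ hp hD hrs) hx
  refine ((((h1.const_mul s).fun_sub ((hp.flux_deriv x hx).fun_mul (hgf.deriv x hx))).const_mul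
    (s - r)).fun_sub (((((hgf.deriv x hx).const_mul r).fun_add hθ).fun_mul
      (hp.flux_deriv x hx)).fun_sub
        (((hgf.flux_deriv x hx).const_mul s).fun_mul (hp.deriv x hx)))).congr_deriv ?_
  ring

/-- The sum equals `(s - r) s ∫₀ˣ g p m - s (P g - G p)`, and both parts vanish at `0`. -/
theorem IsGreen.tendsto_kappa_add (hg : IsGreen m ψ Ψ φ Φ θ I J B g G)
    (hψ : IncSol S m r ψ Ψ) (hφ : DecSol S m r φ Φ) (hp : IncSol S m s p P) (hD : Densities S m)
    (hN : NaturalAtZero S m) (hr : 0 < r) (hrs : r < s) :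
    Tendsto (fun x => kappa m r s θ g G p P x + θ x * P x) (𝓝[>] 0) (𝓝 0) := by
  have h1 := (tendsto_integral_Ioc_zero one_pos
    (hg.integrableOn_mul hψ hφ hp hD hrs 1)).const_mul ((s - r) * s)
  have h2 := (hg.tendsto_wronskian hψ hφ hp hD hN hr hrs).const_mul s
  have h3 := h1.sub h2
  rw [mul_zero, mul_zero, sub_zero] at h3
  refine h3.congr fun x => ?_
  unfold kappa
  ring

/-- `λ K_f = r f P - s F p` for a solution `f` of the homogeneous equation that is negligible at
`0`. -/
theorem mul_functional_eq {f F : ℝ → ℝ} (hf : HasFlux S m (fun x => r * f x) f F)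
    (hp : IncSol S m s p P) (hD : Densities S m)
    (hint : ∀ c, IntegrableOn (fun x => f x * p x * m x) (Ioc 0 c))
    (h1 : Tendsto (fun x => f x * P x) (𝓝[>] 0) (𝓝 0))
    (h2 : Tendsto (fun x => F x * p x) (𝓝[>] 0) (𝓝 0)) {x : ℝ} (hx : 0 < x) :
    (s - r) * (s * (∫ y in Ioc 0 x, f y * p y * m y) - P x * f x)
      = r * f x * P x - s * F x * p x := by
  have hcont : ContinuousOn (fun x => f x * p x * m x) (Ioi 0) :=
    (hf.cont.fun_mul hp.cont).fun_mul hD.speed_cont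
  -- Both sides have the same derivative, and their difference consists of terms that vanish at `0`.
  refine eq_of_hasDerivAt_of_tendsto
    (F := fun x => (s - r) * (s * (∫ y in Ioc 0 x, f y * p y * m y) - P x * f x))
    (G := fun x => r * f x * P x - s * F x * p x)
    (f := fun x => -((s - r) * (S x * F x * P x)))
    (fun y hy => ?_) (fun y hy => ?_) ?_ hx
  · refine ((((hasDerivAt_integral_Ioc hcont hint hy).const_mul s).fun_sub
      ((hp.flux_deriv y hy).fun_mul (hf.deriv y hy))).const_mul (s - r)).congr_deriv ?_
    ring
  · refine ((((hf.deriv y hy).const_mul r).fun_mul (hp.flux_deriv y hy)).fun_sub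
      (((hf.flux_deriv y hy).const_mul s).fun_mul (hp.deriv y hy))).congr_deriv ?_
    ring
  · have h3 := (((tendsto_integral_Ioc_zero one_pos (hint 1)).const_mul ((s - r) * s)).sub
      (h1.const_mul s)).add (h2.const_mul s)
    simp only [mul_zero, sub_zero, add_zero] at h3
    refine h3.congr fun x => ?_
    ring

theorem mul_functional_inc (hψ : IncSol S m r ψ Ψ) (hp : IncSol S m s p P)
    (hD : Densities S m) (hN : NaturalAtZero S m) (hr : 0 < r) (hrs : r < s) {x : ℝ}
    (hx : 0 < x) :
    (s - r) * (s * (∫ y in Ioc 0 x, ψ y * p y * m y) - P x * ψ x)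
      = r * ψ x * P x - s * Ψ x * p x := by
  have hs := hr.trans hrs
  refine mul_functional_eq hψ.toHasFlux hp hD (fun c => ?_) ?_ ?_ hx
  · rcases le_or_gt c 0 with hc | hc
    · simp [Ioc_eq_empty (not_lt.2 hc)]
    refine integrableOn_of_continuousOn_of_abs_le (C := ψ c)
      ((hψ.cont.fun_mul hp.cont).fun_mul hD.speed_cont) (hp.integrableOn hD hs c)
      fun y hy hyc => ?_
    have h1 := mul_pos (hp.pos y hy) (hD.speed_pos y hy)
    rw [mul_assoc, abs_of_pos (mul_pos (hψ.pos y hy) h1)]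
    exact mul_le_mul_of_nonneg_right ((hψ.strictMonoOn hD).monotoneOn hy hc hyc) h1.le
  · simpa using (hψ.tendsto_zero hD hN hr).mul (hp.tendsto_flux hD hN hs)
  · simpa using (hψ.tendsto_flux hD hN hr).mul (hp.tendsto_zero hD hN hs)

theorem mul_functional_dec (hφ : DecSol S m r φ Φ) (hp : IncSol S m s p P)
    (hD : Densities S m) (hN : NaturalAtZero S m) (hr : 0 < r) (hrs : r < s) {x : ℝ}
    (hx : 0 < x) :
    (s - r) * (s * (∫ y in Ioc 0 x, φ y * p y * m y) - P x * φ x)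
      = r * φ x * P x - s * Φ x * p x :=
  mul_functional_eq hφ.toHasFlux hp hD (integrableOn_dec_mul_inc hφ hp hD hrs)
    (tendsto_dec_mul_flux_inc hφ hp hD hN hr hrs) (tendsto_flux_dec_mul_inc hφ hp hD hN hr hrs) hx

/-- This quantity is `λ K_ψ`: it vanishes at `0` and has derivative `-(s - r) S Ψ P < 0`. -/
theorem IncSol.functional_neg (hψ : IncSol S m r ψ Ψ) (hp : IncSol S m s p P)
    (hD : Densities S m) (hN : NaturalAtZero S m) (hr : 0 < r) (hrs : r < s) {x : ℝ}
    (hx : 0 < x) : r * ψ x * P x - s * Ψ x * p x < 0 := by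
  have hs := hr.trans hrs
  have hanti : StrictAntiOn (fun x => r * ψ x * P x - s * Ψ x * p x) (Ioi 0) := by
    refine strictAntiOn_of_hasDerivAt (f := fun x => -((s - r) * (S x * Ψ x * P x)))
      (convex_Ioi 0) (fun y hy => ?_) fun y hy => ?_
    · refine ((((hψ.deriv y hy).const_mul r).fun_mul (hp.flux_deriv y hy)).fun_sub
        (((hψ.flux_deriv y hy).const_mul s).fun_mul (hp.deriv y hy))).congr_deriv ?_
      ring
    · exact neg_neg_of_pos (mul_pos (sub_pos.2 hrs) (mul_pos (mul_pos (hD.scale_pos y hy)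
        (hψ.flux_pos y hy)) (hp.flux_pos y hy)))
  have h0 : Tendsto (fun x => r * ψ x * P x - s * Ψ x * p x) (𝓝[>] 0) (𝓝 0) := by
    have := (((hψ.tendsto_zero hD hN hr).mul (hp.tendsto_flux hD hN hs)).const_mul r).sub
      (((hψ.tendsto_flux hD hN hr).mul (hp.tendsto_zero hD hN hs)).const_mul s)
    simp only [mul_zero, sub_zero] at this
    exact this.congr fun x => by ring
  have h1 : r * ψ (x / 2) * P (x / 2) - s * Ψ (x / 2) * p (x / 2) ≤ 0 := by
    refine ge_of_tendsto h0 ?_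
    filter_upwards [Ioo_mem_nhdsGT (half_pos hx)] with y hy
    exact (hanti hy.1 (half_pos hx) hy.2).le
  exact (hanti (half_pos hx) hx (half_lt_self hx)).trans_le h1

/-- If `θ` increases on `(0, x)`, then `kappa` is negative at `x`. -/
theorem IsGreen.kappa_neg_of_pos_deriv (hg : IsGreen m ψ Ψ φ Φ θ I J B g G)
    (hψ : IncSol S m r ψ Ψ) (hφ : DecSol S m r φ Φ) (hp : IncSol S m s p P) (hD : Densities S m)
    (hN : NaturalAtZero S m) (hr : 0 < r) (hrs : r < s) {θ' : ℝ → ℝ}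
    (hθ : ∀ x, 0 < x → HasDerivAt θ (θ' x) x)
    (hlim : ∀ ε, 0 < ε → ∀ᶠ x in 𝓝[>] 0, -ε ≤ θ x * P x) {x : ℝ} (hx : 0 < x)
    (hpos : ∀ y, 0 < y → y < x → 0 < θ' y) : kappa m r s θ g G p P x < 0 := by
  have hcont : ContinuousOn (kappa m r s θ g G p P) (Ioc 0 x) :=
    continuousOn_of_hasDerivAt fun y hy => hg.hasDerivAt_kappa hψ hφ hp hD hrs hy.1 (hθ y hy.1)
  have hanti : StrictAntiOn (kappa m r s θ g G p P) (Ioc 0 x) := by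
    refine strictAntiOn_of_hasDerivWithinAt_neg (f' := fun y => -(θ' y * P y)) (convex_Ioc 0 x)
      hcont (fun y hy => ?_) fun y hy => ?_ <;> rw [interior_Ioc] at hy
    · exact (hg.hasDerivAt_kappa hψ hφ hp hD hrs hy.1 (hθ y hy.1)).hasDerivWithinAt
    · exact neg_neg_of_pos (mul_pos (hpos y hy.1 hy.2) (hp.flux_pos y hy.1))
  have h1 : kappa m r s θ g G p P (x / 2) ≤ 0 := by
    -- At some `y` near `0`, `kappa = (kappa + θ P) - θ P ≤ ε / 2 + ε / 2`; the decrease of `kappa`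
    -- carries the bound to `x / 2`.
    refine le_of_forall_pos_le_add fun ε hε => ?_
    have h2 := (hg.tendsto_kappa_add hψ hφ hp hD hN hr hrs).eventually_lt_const (half_pos hε)
    obtain ⟨y, hy1, hy2, hy3⟩ :=
      (h2.and ((hlim (ε / 2) (half_pos hε)).and (Ioo_mem_nhdsGT (half_pos hx)))).exists
    have h3 := hanti ⟨hy3.1, (hy3.2.trans (half_lt_self hx)).le⟩
      ⟨half_pos hx, (half_lt_self hx).le⟩ hy3.2
    linarith
  exact (hanti ⟨half_pos hx, (half_lt_self hx).le⟩ ⟨hx, le_rfl⟩ (half_lt_self hx)).trans_le h1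

/-- For a unimodal `θ` the set where `kappa` is negative is an interval `(0, c)`. -/
theorem IsGreen.kappa_neg_of_le (hg : IsGreen m ψ Ψ φ Φ θ I J B g G)
    (hψ : IncSol S m r ψ Ψ) (hφ : DecSol S m r φ Φ) (hp : IncSol S m s p P) (hD : Densities S m)
    (hrs : r < s) {θ' : ℝ → ℝ} (hθ : ∀ x, 0 < x → HasDerivAt θ (θ' x) x) {x a : ℝ} (hx : 0 < x)
    (hxa : x ≤ a) (ha : kappa m r s θ g G p P a < 0)
    (hU : kappa m r s θ g G p P x < 0 ∨ ∀ y, x < y → θ' y < 0) :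
    kappa m r s θ g G p P x < 0 := by
  rcases hU with h | h
  · exact h
  have hmono : MonotoneOn (kappa m r s θ g G p P) (Icc x a) := by
    refine monotoneOn_of_hasDerivWithinAt_nonneg (f' := fun y => -(θ' y * P y)) (convex_Icc x a)
      (continuousOn_of_hasDerivAt fun y hy => hg.hasDerivAt_kappa hψ hφ hp hD hrs
        (hx.trans_le hy.1) (hθ y (hx.trans_le hy.1))) (fun y hy => ?_) fun y hy => ?_ <;>
      rw [interior_Icc] at hy
    · exact (hg.hasDerivAt_kappa hψ hφ hp hD hrs (hx.trans hy.1)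
        (hθ y (hx.trans hy.1))).hasDerivWithinAt
    · nlinarith [h y hy.1, hp.flux_pos y (hx.trans hy.1)]
  exact (hmono ⟨le_rfl, hxa⟩ ⟨hxa, le_rfl⟩ hxa).trans_lt ha

/-- `θ P → 0` at `0` if `θ` is nonpositive and nondecreasing near `0`. -/
theorem IsGreen.tendsto_theta_mul_flux (hg : IsGreen m ψ Ψ φ Φ θ I J B g G)
    (hψ : IncSol S m r ψ Ψ) (hp : IncSol S m s p P) (hD : Densities S m)
    (hN : NaturalAtZero S m) (hr : 0 < r) (hrs : r < s) {c : ℝ} (hc : 0 < c)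
    (hmono : MonotoneOn θ (Ioc 0 c)) (hneg : ∀ x, 0 < x → x ≤ c → θ x ≤ 0) :
    Tendsto (fun x => θ x * P x) (𝓝[>] 0) (𝓝 0) := by
  have hs := hr.trans hrs
  have hcont : ContinuousOn (fun x => θ x * p x * m x) (Ioi 0) :=
    (hg.theta_cont.fun_mul hp.cont).fun_mul hD.speed_cont
  -- By positivity of the Wronskian `p / ψ` increases, so on `(0, 1]` a multiple of the integrable
  -- `|ψ θ m|` dominates `θ p m`.
  have hratio : MonotoneOn (fun x => p x / ψ x) (Ioi 0) := by
    refine monotoneOn_of_hasDerivAt (convex_Ioi 0)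
      (fun x hx => (hp.deriv x hx).fun_div (hψ.deriv x hx) (hψ.pos x hx).ne') fun x hx => ?_
    refine div_nonneg ?_ (sq_nonneg _)
    have := mul_pos (hD.scale_pos x hx) (hψ.wronskian_pos hp hD hN hr hrs hx)
    nlinarith
  have hint : IntegrableOn (fun x => θ x * p x * m x) (Ioc 0 1) := by
    refine integrableOn_of_continuousOn_of_abs_le (C := p 1 / ψ 1) hcont
      (g := fun x => |ψ x * θ x * m x|) hg.integrableOn.abs fun x hx hx1 => ?_
    have h1 := hratio hx (mem_Ioi.2 one_pos) hx1
    have h2 := hψ.pos x hx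
    simp only [div_le_iff₀ h2] at h1
    rw [abs_mul, abs_mul, abs_mul, abs_mul, abs_of_pos h2, abs_of_pos (hp.pos x hx)]
    nlinarith [mul_le_mul_of_nonneg_right h1 (mul_nonneg (abs_nonneg (θ x)) (abs_nonneg (m x)))]
  have h1 := hp.tendsto_antitone_mul_flux hD hN hs (q := fun x => -θ x) hg.theta_cont.neg
    (by simpa only [neg_mul, one_mul, mul_assoc] using integrableOn_const_mul hint (-1)) hc hmono.neg fun x hx hxc => neg_nonneg.2 (hneg x hx hxc)
  simpa using h1.neg

end Green

/-! ### The Wronskian of an inhomogeneous solution at `0`. -/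

section Wronskian

variable {S m : ℝ → ℝ} {r : ℝ} {ψ Ψ q Q θ : ℝ → ℝ}

/-- If `q` is positive with non-vanishing flux `Q`, `(Q)' = (r q + θ) m`, and `q ψ m`, `θ ψ m` are
integrable at `0`, then the Wronskian of `q` and `ψ` vanishes at `0`. -/
theorem tendsto_wronskian_zero (hψ : IncSol S m r ψ Ψ) (hD : Densities S m)
    (hN : NaturalAtZero S m) (hr : 0 < r)
    (hq : HasFlux S m (fun x => r * q x + θ x) q Q) (hqpos : ∀ x, 0 < x → 0 < q x)
    (hQ : ∀ x, 0 < x → Q x ≠ 0) (hθ : ContinuousOn θ (Ioi 0))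
    (hθint : IntegrableOn (fun x => ψ x * θ x * m x) (Ioc 0 1))
    (hqint : IntegrableOn (fun x => ψ x * q x * m x) (Ioc 0 1))
    (hqΨ : Tendsto (fun x => q x * Ψ x) (𝓝[>] 0) (𝓝 0)) :
    Tendsto (fun x => Q x * ψ x - Ψ x * q x) (𝓝[>] 0) (𝓝 0) := by
  have hcont : ContinuousOn (fun x => ψ x * θ x * m x) (Ioi 0) :=
    (hψ.cont.fun_mul hθ).fun_mul hD.speed_cont
  have hd : ∀ x, 0 < x → HasDerivAt (fun x => Q x * ψ x - Ψ x * q x) (ψ x * θ x * m x) x :=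
    fun x hx => (hasDerivAt_wronskian hψ.toHasFlux hq hx).congr_deriv (by ring)
  have hint := integrableOn_Ioc_zero_extend hcont one_pos hθint
  -- `w` is the limit of the Wronskian at `0`: its value at `1` minus the integral of its
  -- derivative.
  set w := (Q 1 * ψ 1 - Ψ 1 * q 1) - ∫ y in Ioc 0 1, ψ y * θ y * m y with hw
  have hW : ∀ x, 0 < x → Q x * ψ x - Ψ x * q x = (∫ y in Ioc 0 x, ψ y * θ y * m y) + w := by
    intro x hx
    have := eq_of_hasDerivAt_zero
      (F := fun x => Q x * ψ x - Ψ x * q x - ∫ y in Ioc 0 x, ψ y * θ y * m y)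
      (fun y hy => by simpa using (hd y hy).fun_sub (hasDerivAt_integral_Ioc hcont hint hy))
      hx one_pos
    linarith
  have hWlim : Tendsto (fun x => Q x * ψ x - Ψ x * q x) (𝓝[>] 0) (𝓝 w) := by
    have := (tendsto_integral_Ioc_zero one_pos hθint).add_const w
    rw [zero_add] at this
    refine this.congr' ?_
    filter_upwards [self_mem_nhdsWithin] with x hx using (hW x hx).symm
  suffices hw0 : w = 0 by rwa [hw0] at hWlim
  by_contra hne
  have hwpos : 0 < |w| := abs_pos.2 hne
  have hQψ : Tendsto (fun x => Q x * ψ x) (𝓝[>] 0) (𝓝 w) := by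
    have := hWlim.add hqΨ
    rw [add_zero] at this
    exact this.congr fun x => by ring
  have hev : ∀ᶠ x in 𝓝[>] (0 : ℝ), |w| / 2 < |Q x * ψ x| :=
    (hQψ.abs).eventually_const_lt (half_lt_self hwpos)
  obtain ⟨c, hc, hcb⟩ := mem_nhdsGT_iff_exists_Ioc_subset.1 hev
  have hc : 0 < c := hc
  -- If `w ≠ 0`, then `|Q ψ| > |w| / 2` near `0`, whence `|Q' / Q| ≤ k` with `k` integrable. So `log
  -- |Q|` is bounded above there, and `ψ → 0` forces `Q ψ → 0`, a contradiction.
  set k := fun x => 2 / |w| * (r * (ψ x * q x * m x) + |ψ x * θ x * m x|) with hk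
  have hkc : ContinuousOn k (Ioi 0) :=
    continuousOn_const.fun_mul ((continuousOn_const.fun_mul
      ((hψ.cont.fun_mul hq.cont).fun_mul hD.speed_cont)).fun_add hcont.abs)
  have hkint := integrableOn_Ioc_zero_extend hkc one_pos
    (integrableOn_const_mul ((integrableOn_const_mul hqint r).add hθint.abs) (2 / |w|))
  have hk0 : ∀ x, 0 < x → 0 ≤ k x := fun x hx => by
    have h1 := mul_pos (mul_pos (hψ.pos x hx) (hqpos x hx)) (hD.speed_pos x hx)
    exact mul_nonneg (by positivity) (add_nonneg (mul_pos hr h1).le (abs_nonneg _))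
  have hmono : MonotoneOn (fun x => Real.log (Q x) + ∫ y in Ioc 0 x, k y) (Ioc 0 c) := by
    refine monotoneOn_of_hasDerivAt (convex_Ioc 0 c)
      (fun x hx => ((hq.flux_deriv x hx.1).log (hQ x hx.1)).fun_add
        (hasDerivAt_integral_Ioc hkc hkint hx.1)) fun x hx => ?_
    have h1 : |w| / 2 < |Q x * ψ x| := hcb hx
    have h2 := hψ.pos x hx.1
    have h3 : |(r * q x + θ x) * m x / Q x| ≤ k x := by
      have hm := hD.speed_pos x hx.1
      rw [abs_mul, abs_of_pos h2] at h1
      have h4 : |(r * q x + θ x) * m x| * ψ x ≤ r * (ψ x * q x * m x) + |ψ x * θ x * m x| := by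
        rw [abs_mul, abs_mul, abs_mul, abs_of_pos h2, abs_of_pos hm]
        have h5 : |r * q x + θ x| ≤ r * q x + |θ x| := by
          refine (abs_add_le _ _).trans_eq ?_
          rw [abs_of_pos (mul_pos hr (hqpos x hx.1))]
        nlinarith [mul_le_mul_of_nonneg_right h5 (mul_pos hm h2).le]
      rw [abs_div, div_le_iff₀ (abs_pos.2 (hQ x hx.1)), hk]
      have h6 : 0 ≤ r * (ψ x * q x * m x) + |ψ x * θ x * m x| :=
        (mul_nonneg (abs_nonneg _) h2.le).trans h4
      have h7 : |(r * q x + θ x) * m x| * ψ x ≤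
          (2 / |w| * (r * (ψ x * q x * m x) + |ψ x * θ x * m x|) * |Q x|) * ψ x := by
        refine h4.trans ?_
        have h8 : 1 ≤ 2 / |w| * (|Q x| * ψ x) := by
          rw [div_mul_eq_mul_div, le_div_iff₀ hwpos]
          linarith
        nlinarith [mul_le_mul_of_nonneg_left h8 h6]
      exact le_of_mul_le_mul_right h7 h2
    linarith [neg_abs_le ((r * q x + θ x) * m x / Q x)]
  set C := Real.log (Q c) + ∫ y in Ioc 0 c, k y with hC
  have hbound : ∀ x ∈ Ioc 0 c, |Q x| ≤ Real.exp C := by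
    intro x hx
    rw [← Real.exp_log (abs_pos.2 (hQ x hx.1)), Real.log_abs, Real.exp_le_exp]
    have h1 := hmono hx ⟨hc, le_rfl⟩ hx.2
    have h2 : 0 ≤ ∫ y in Ioc 0 x, k y :=
      setIntegral_nonneg measurableSet_Ioc fun y hy => hk0 y hy.1
    simp only at h1
    linarith
  have hz : Tendsto (fun x => Q x * ψ x) (𝓝[>] 0) (𝓝 0) := by
    have h1 : Tendsto (fun x => Real.exp C * ψ x) (𝓝[>] 0) (𝓝 0) := by
      simpa using (hψ.tendsto_zero hD hN hr).const_mul (Real.exp C)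
    refine squeeze_zero_norm' ?_ h1
    filter_upwards [Ioc_mem_nhdsGT hc] with x hx
    rw [Real.norm_eq_abs, abs_mul, abs_of_pos (hψ.pos x hx.1)]
    exact mul_le_mul_of_nonneg_right (hbound x hx) (hψ.pos x hx.1).le
  exact hne (tendsto_nhds_unique hQψ hz)

end Wronskian

/-! ### The reflection `x ↦ 1 / x` -/

section Reflection

/-- `f(1/y)`. -/
noncomputable def reflFun (f : ℝ → ℝ) (y : ℝ) : ℝ := f y⁻¹

/-- The density `S(1/y) / y²`. -/
noncomputable def reflDens (S : ℝ → ℝ) (y : ℝ) : ℝ := S y⁻¹ / y ^ 2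

/-- The flux `-F(1/y)`. -/
noncomputable def reflFlux (F : ℝ → ℝ) (y : ℝ) : ℝ := -F y⁻¹

/-- The boundary `∞` is neither exit nor entrance. -/
structure NaturalAtInfty (S m : ℝ → ℝ) : Prop where
  not_exit : ¬ IntegrableOn (fun y => (∫ z in (1 : ℝ)..y, m z) * S y) (Ioi 1)
  not_entrance : ¬ IntegrableOn (fun y => (∫ z in (1 : ℝ)..y, S z) * m y) (Ioi 1)

theorem continuousOn_reflFun {f : ℝ → ℝ} (hf : ContinuousOn f (Ioi 0)) :
    ContinuousOn (reflFun f) (Ioi 0) :=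
  hf.comp (continuousOn_inv₀.mono fun _ hx => (mem_Ioi.1 hx).ne') fun _ hx => mem_Ioi.2 (inv_pos.2 hx)

theorem continuousOn_reflDens {f : ℝ → ℝ} (hf : ContinuousOn f (Ioi 0)) :
    ContinuousOn (reflDens f) (Ioi 0) :=
  (continuousOn_reflFun hf).div (continuousOn_pow 2) fun _ hx => (pow_pos (mem_Ioi.1 hx) 2).ne'

theorem Densities.reflect {S m : ℝ → ℝ} (hD : Densities S m) :
    Densities (reflDens S) (reflDens m) where
  scale_cont := continuousOn_reflDens hD.scale_cont
  scale_pos _ hx := div_pos (hD.scale_pos _ (inv_pos.2 hx)) (pow_pos hx 2)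
  speed_cont := continuousOn_reflDens hD.speed_cont
  speed_pos _ hx := div_pos (hD.speed_pos _ (inv_pos.2 hx)) (pow_pos hx 2)

theorem hasDerivAt_comp_inv {f : ℝ → ℝ} {d y : ℝ} (hy : 0 < y) (hf : HasDerivAt f d y⁻¹) :
    HasDerivAt (fun y => f y⁻¹) (-(d / y ^ 2)) y := by
  have := hf.comp y (hasDerivAt_inv hy.ne')
  refine this.congr_deriv ?_
  ring

theorem image_inv_Ioo {x : ℝ} (hx : 0 < x) : (fun y : ℝ => y⁻¹) '' Ioo 0 x⁻¹ = Ioi x := by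
  ext y
  constructor
  · rintro ⟨z, hz, rfl⟩
    exact (lt_inv_comm₀ hx hz.1).2 hz.2
  · intro hy
    exact ⟨y⁻¹, ⟨inv_pos.2 (hx.trans hy), (inv_lt_inv₀ (hx.trans hy) hx).2 hy⟩, inv_inv y⟩

theorem integrableOn_Ioi_iff_reflDens {f : ℝ → ℝ} {x : ℝ} (hx : 0 < x) :
    IntegrableOn f (Ioi x) ↔ IntegrableOn (reflDens f) (Ioo 0 x⁻¹) := by
  rw [← image_inv_Ioo hx, integrableOn_image_iff_integrableOn_abs_deriv_smul measurableSet_Ioo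
    (fun y hy => (hasDerivAt_inv hy.1.ne').hasDerivWithinAt) inv_injective.injOn]
  refine integrableOn_congr_fun (fun y hy => ?_) measurableSet_Ioo
  have : 0 < y := hy.1
  simp only [reflDens, smul_eq_mul, abs_neg, abs_inv, abs_pow, abs_of_pos this]
  rw [div_eq_inv_mul]

theorem integral_Ioi_eq_reflDens (f : ℝ → ℝ) {x : ℝ} (hx : 0 < x) :
    ∫ y in Ioi x, f y = ∫ y in Ioc 0 x⁻¹, reflDens f y := by
  rw [← image_inv_Ioo hx, integral_image_eq_integral_abs_deriv_smul measurableSet_Ioo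
    (fun y hy => (hasDerivAt_inv hy.1.ne').hasDerivWithinAt) inv_injective.injOn,
    integral_Ioc_eq_integral_Ioo]
  refine setIntegral_congr_fun measurableSet_Ioo fun y hy => ?_
  have : 0 < y := hy.1
  simp only [reflDens, smul_eq_mul, abs_neg, abs_inv, abs_pow, abs_of_pos this]
  rw [div_eq_inv_mul]

theorem integral_reflDens {k : ℝ → ℝ} (hk : ContinuousOn k (Ioi 0)) {y : ℝ} (hy : 0 < y) :
    ∫ z in y..1, reflDens k z = ∫ z in (1 : ℝ)..y⁻¹, k z := by
  have hpos : ∀ x ∈ uIcc y 1, 0 < x := fun x hx => lt_of_lt_of_le (lt_min hy one_pos) hx.1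
  have := intervalIntegral.integral_comp_mul_deriv' (a := y) (b := 1) (f := fun x : ℝ => x⁻¹)
    (f' := fun x => -(x ^ 2)⁻¹) (g := k) (fun x hx => hasDerivAt_inv (hpos x hx).ne')
    ((continuousOn_pow 2).inv₀ fun x hx => (pow_pos (hpos x hx) 2).ne').neg
    (hk.mono (by rintro _ ⟨x, hx, rfl⟩; exact inv_pos.2 (hpos x hx)))
  rw [inv_one] at this
  rw [intervalIntegral.integral_symm y⁻¹, ← this, ← intervalIntegral.integral_neg]
  refine intervalIntegral.integral_congr fun x _ => ?_
  simp only [reflDens, Function.comp]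
  ring

theorem NaturalAtInfty.reflect {S m : ℝ → ℝ} (hN : NaturalAtInfty S m) (hD : Densities S m) :
    NaturalAtZero (reflDens S) (reflDens m) := by
  have key : ∀ {k l : ℝ → ℝ}, ContinuousOn k (Ioi 0) →
      ¬ IntegrableOn (fun y => (∫ z in (1 : ℝ)..y, k z) * l y) (Ioi 1) →
      ¬ IntegrableOn (fun y => (∫ z in y..1, reflDens k z) * reflDens l y) (Ioo 0 1) := by
    intro k l hk h h'
    refine h ((integrableOn_Ioi_iff_reflDens one_pos).2 ?_)
    rw [inv_one]
    refine h'.congr_fun (fun y hy => ?_) measurableSet_Ioo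
    simp only [integral_reflDens hk hy.1]
    simp only [reflDens]
    ring
  exact ⟨key hD.speed_cont hN.not_exit, key hD.scale_cont hN.not_entrance⟩

variable {S m : ℝ → ℝ} {r : ℝ} {f F : ℝ → ℝ}

/-- The inversion reverses orientation, hence the minus sign in `reflFlux`; increasing and
decreasing solutions therefore trade places. -/
theorem HasFlux.reflect {h : ℝ → ℝ} (hf : HasFlux S m h f F) :
    HasFlux (reflDens S) (reflDens m) (reflFun h) (reflFun f) (reflFlux F) where
  deriv y hy := by
    refine (hasDerivAt_comp_inv hy (hf.deriv _ (inv_pos.2 hy))).congr_deriv ?_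
    simp only [reflDens, reflFlux]
    ring
  flux_deriv y hy := by
    refine (hasDerivAt_comp_inv hy (hf.flux_deriv _ (inv_pos.2 hy))).fun_neg.congr_deriv ?_
    simp only [reflDens, reflFun]
    ring

theorem IncSol.reflect (hf : IncSol S m r f F) :
    DecSol (reflDens S) (reflDens m) r (reflFun f) (reflFlux F) where
  toHasFlux := hf.toHasFlux.reflect
  pos _ hy := hf.pos _ (inv_pos.2 hy)
  flux_neg _ hy := neg_neg_of_pos (hf.flux_pos _ (inv_pos.2 hy))

theorem DecSol.reflect (hf : DecSol S m r f F) :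
    IncSol (reflDens S) (reflDens m) r (reflFun f) (reflFlux F) where
  toHasFlux := hf.toHasFlux.reflect
  pos _ hy := hf.pos _ (inv_pos.2 hy)
  flux_pos _ hy := neg_pos.2 (hf.flux_neg _ (inv_pos.2 hy))

theorem tendsto_atTop_iff_reflFun {l : Filter ℝ} :
    Tendsto f atTop l ↔ Tendsto (reflFun f) (𝓝[>] 0) l := by
  constructor
  · exact fun h => h.comp tendsto_inv_nhdsGT_zero
  · intro h
    refine (h.comp tendsto_inv_atTop_nhdsGT_zero).congr fun x => ?_
    simp [reflFun]

/-- The inversion swaps `ψ` with `φ` and `I` with `J` and keeps `B`. The two extra hypotheses say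
that `J` behaves at `∞` as `I` does at `0`, so results at `0` transfer to `∞`. -/
theorem IsGreen.reflect {ψ Ψ φ Φ θ I J g G : ℝ → ℝ} {B : ℝ}
    (hg : IsGreen m ψ Ψ φ Φ θ I J B g G) (hint : IntegrableOn (fun x => φ x * θ x * m x) (Ioi 1))
    (hJ : Tendsto J atTop (𝓝 0)) :
    IsGreen (reflDens m) (reflFun φ) (reflFlux Φ) (reflFun ψ) (reflFlux Ψ) (reflFun θ)
      (reflFun J) (reflFun I) B (reflFun g) (reflFlux G) where
  theta_cont := continuousOn_reflFun hg.theta_cont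
  integrableOn := by
    rw [integrableOn_Ioi_iff_reflDens one_pos, inv_one, ← integrableOn_Ioc_iff_integrableOn_Ioo]
      at hint
    refine hint.congr_fun (fun y _ => ?_) measurableSet_Ioc
    simp only [reflDens, reflFun]
    ring
  I_deriv y hy := by
    refine (hasDerivAt_comp_inv hy (hg.J_deriv _ (inv_pos.2 hy))).congr_deriv ?_
    simp only [reflDens, reflFun]
    ring
  J_deriv y hy := by
    refine (hasDerivAt_comp_inv hy (hg.I_deriv _ (inv_pos.2 hy))).congr_deriv ?_
    simp only [reflDens, reflFun]
    ring
  I_tendsto := tendsto_atTop_iff_reflFun.1 hJ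
  wronskian y hy := by
    rw [← hg.wronskian _ (inv_pos.2 hy)]
    simp only [reflFlux, reflFun]
    ring
  eq y hy := by
    simp only [reflFun]
    rw [hg.eq _ (inv_pos.2 hy)]
    ring
  flux_eq y hy := by
    simp only [reflFlux, reflFun]
    rw [hg.flux_eq _ (inv_pos.2 hy)]
    ring

/-- The functional at `∞` is the functional at `0` of the reflected data. -/
theorem functional_reflect (f p P : ℝ → ℝ) (s : ℝ) {x : ℝ} (hx : 0 < x) :
    s * (∫ y in Ioc 0 x⁻¹, reflFun f y * reflFun p y * reflDens m y)
        - reflFlux P x⁻¹ * reflFun f x⁻¹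
      = s * (∫ y in Ioi x, f y * p y * m y) + P x * f x := by
  rw [integral_Ioi_eq_reflDens _ hx]
  have : ∀ y, reflDens (fun y => f y * p y * m y) y
      = reflFun f y * reflFun p y * reflDens m y := fun y => by
    simp only [reflDens, reflFun]
    ring
  simp only [this, reflFlux, reflFun, inv_inv]
  ring

end Reflection

/-! ### A comparison principle for a planar system. -/

/-- Forward invariance of the positive quadrant for `y' = α e`, `e' = β y + δ`. -/
theorem pos_of_cooperative_system {a b : ℝ} (hab : a < b) {y e α β δ : ℝ → ℝ}
    (hy : ∀ x ∈ Icc a b, HasDerivAt y (α x * e x) x)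
    (he : ∀ x ∈ Icc a b, HasDerivAt e (β x * y x + δ x) x)
    (hα : ∀ x ∈ Icc a b, 0 < α x) (hβ : ∀ x ∈ Icc a b, 0 ≤ β x) (hδ : ∀ x ∈ Icc a b, 0 < δ x)
    (hya : y a = 0) (hea : 0 ≤ e a) : 0 < y b := by
  have hmono : ∀ T ∈ Ioc a b, (∀ x ∈ Ioo a T, 0 < e x) → StrictMonoOn y (Icc a T) := by
    intro T hT h
    refine strictMonoOn_of_hasDerivWithinAt_pos (f' := fun x => α x * e x) (convex_Icc a T)
      (continuousOn_of_hasDerivAt fun x hx => hy x ⟨hx.1, hx.2.trans hT.2⟩)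
      (fun x hx => ?_) fun x hx => ?_ <;> rw [interior_Icc] at hx
    · exact (hy x ⟨hx.1.le, hx.2.le.trans hT.2⟩).hasDerivWithinAt
    · exact mul_pos (hα x ⟨hx.1.le, hx.2.le.trans hT.2⟩) (h x hx)
  suffices hepos : ∀ x ∈ Ioc a b, 0 < e x by
    have h := hmono b ⟨hab, le_rfl⟩ (fun x hx => hepos x ⟨hx.1, hx.2.le⟩)
      (left_mem_Icc.2 hab.le) (right_mem_Icc.2 hab.le) hab
    rwa [hya] at h
  -- As `y a = 0`, the slope of `e` at `a` is `δ a > 0`; so `e` is positive just after `a` even if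
  -- `e a = 0`.
  have hnear : ∃ c ∈ Ioc a b, ∀ x ∈ Ioo a c, 0 < e x := by
    have hev : ∀ᶠ x in 𝓝[>] a, 0 < e x := by
      have h1 := he a (left_mem_Icc.2 hab.le)
      rw [hya, mul_zero, zero_add] at h1
      have h2 : ∀ᶠ x in 𝓝[>] a, 0 < slope e a x :=
        (hasDerivAt_iff_tendsto_slope.1 h1).mono_left
          (nhdsWithin_mono a fun x hx => ne_of_gt hx) |>.eventually_const_lt
          (hδ a (left_mem_Icc.2 hab.le))
      filter_upwards [h2, self_mem_nhdsWithin] with x hx hxa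
      have hxa : a < x := hxa
      rw [slope_def_field, lt_div_iff₀ (sub_pos.2 hxa)] at hx
      linarith
    obtain ⟨c, hc, hcs⟩ := (mem_nhdsGT_iff_exists_Ioo_subset' hab).1 hev
    exact ⟨min c b, ⟨lt_min hc hab, min_le_right _ _⟩,
      fun x hx => hcs ⟨hx.1, hx.2.trans_le (min_le_left _ _)⟩⟩
  obtain ⟨c, hc, hcpos⟩ := hnear
  by_contra hcon
  push Not at hcon
  obtain ⟨x₀, hx₀, hex₀⟩ := hcon
  have hecont : ContinuousOn e (Icc c b) :=
    continuousOn_of_hasDerivAt fun x hx => he x ⟨hc.1.le.trans hx.1, hx.2⟩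
  have hK : IsCompact (Icc c b ∩ e ⁻¹' Iic 0) :=
    isCompact_Icc.of_isClosed_subset
      (hecont.preimage_isClosed_of_isClosed isClosed_Icc isClosed_Iic) inter_subset_left
  have hne : (Icc c b ∩ e ⁻¹' Iic 0).Nonempty := by
    refine ⟨x₀, ⟨?_, hx₀.2⟩, hex₀⟩
    by_contra h
    exact (hcpos x₀ ⟨hx₀.1, not_le.1 h⟩).not_ge hex₀
  -- `T` is the first point of `[c, b]` with `e ≤ 0`. Up to `T` one has `y ≥ 0`, so `e` increases
  -- strictly from `e a ≥ 0`, which excludes `e T ≤ 0`.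
  obtain ⟨T, ⟨hTm, hTe⟩, hTl⟩ := hK.exists_isLeast hne
  have hTI : T ∈ Ioc a b := ⟨hc.1.trans_le hTm.1, hTm.2⟩
  have hbefore : ∀ x ∈ Ioo a T, 0 < e x := by
    intro x hx
    by_contra h
    rcases lt_or_ge x c with h1 | h1
    · exact h (hcpos x ⟨hx.1, h1⟩)
    · exact (hTl ⟨⟨h1, hx.2.le.trans hTI.2⟩, not_lt.1 h⟩).not_gt hx.2
  have hy0 : ∀ x ∈ Icc a T, 0 ≤ y x := fun x hx => by
    have h := (hmono T hTI hbefore).monotoneOn (left_mem_Icc.2 hTI.1.le) hx hx.1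
    rwa [hya] at h
  have hemono : StrictMonoOn e (Icc a T) :=
    strictMonoOn_of_hasDerivAt (convex_Icc a T) (fun x hx => he x ⟨hx.1, hx.2.trans hTI.2⟩)
      fun x hx => add_pos_of_nonneg_of_pos
        (mul_nonneg (hβ x ⟨hx.1, hx.2.trans hTI.2⟩) (hy0 x hx)) (hδ x ⟨hx.1, hx.2.trans hTI.2⟩)
  have h := hemono (left_mem_Icc.2 hTI.1.le) (right_mem_Icc.2 hTI.1.le) hTI.1
  have hTe : e T ≤ 0 := hTe
  linarith

/-! ### Uniqueness for the two-boundary problem in analytic form. -/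

/-- The data of the two-boundary problem, expressed through fluxes. -/
structure TwoBoundary (μ σ μ' S m : ℝ → ℝ) (r s : ℝ) (ψ Ψ φ Φ p P q Q : ℝ → ℝ) (c : ℝ)
    (gd Gd θd θd' κd gu Gu θu θu' κu : ℝ → ℝ) : Prop where
  dens : Densities S m
  vol_pos : ∀ x, 0 < x → 0 < σ x
  scale_deriv : ∀ x, 0 < x → HasDerivAt S (-(2 * μ x / σ x ^ 2) * S x) x
  speed_eq : ∀ x, 0 < x → m x = 2 / (σ x ^ 2 * S x)
  drift_deriv : ∀ x, 0 < x → HasDerivAt μ (μ' x) x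
  drift_deriv_lt : ∀ x, 0 < x → μ' x < r
  r_pos : 0 < r
  r_lt_s : r < s
  inc_r : IncSol S m r ψ Ψ
  dec_r : DecSol S m r φ Φ
  inc_s : IncSol S m s p P
  dec_s : DecSol S m s q Q
  K_neg : ∀ x, 0 < x → r * ψ x * P x - s * Ψ x * p x < 0
  c_neg : c < 0
  flux_d : HasFlux S m (fun x => r * gd x + θd x) gd Gd
  flux_u : HasFlux S m (fun x => r * gu x + θu x) gu Gu
  flux_sub : ∀ x, 0 < x → S x * Gd x - S x * Gu x = c
  theta_d : ∀ x, 0 < x → HasDerivAt θd (θd' x) x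
  theta_u : ∀ x, 0 < x → HasDerivAt θu (θu' x) x
  kappa_d : ∀ x, 0 < x → HasDerivAt κd (θd' x * Q x) x
  kappa_u : ∀ x, 0 < x → HasDerivAt κu (-(θu' x * P x)) x
  theta_d_pos : ∀ b, 0 < b → 0 ≤ κd b → ∀ y, 0 < y → y ≤ b → 0 < θd' y
  theta_u_neg : ∀ a, 0 < a → 0 ≤ κu a → ∀ y, a ≤ y → θu' y < 0
  kappa_d_neg : ∀ b, 0 < b → κd b < 0 → ∀ x, b ≤ x → κd x < 0
  kappa_u_neg : ∀ a, 0 < a → κu a < 0 → ∀ x, 0 < x → x ≤ a → κu x < 0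

namespace TwoBoundary

variable {μ σ μ' S m : ℝ → ℝ} {r s : ℝ} {ψ Ψ φ Φ p P q Q : ℝ → ℝ} {c : ℝ}
  {gd Gd θd θd' κd gu Gu θu θu' κu : ℝ → ℝ}

/-- `λ H(f, g_u; x)`. -/
noncomputable def lowerVal (r : ℝ) (P gu Gu θu κu f F : ℝ → ℝ) (x : ℝ) : ℝ :=
  F x * (r * gu x + θu x + κu x / P x) - r * f x * Gu x

/-- `λ Q(g_d, f; x)`. -/
noncomputable def upperVal (r : ℝ) (Q gd Gd θd κd f F : ℝ → ℝ) (x : ℝ) : ℝ :=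
  F x * (r * gd x + θd x - κd x / Q x) - r * f x * Gd x

theorem hasFlux_comb {f F k K : ℝ → ℝ} (hf : HasFlux S m (fun x => r * f x) f F)
    (hk : HasFlux S m (fun x => r * k x) k K) (α β : ℝ) :
    HasFlux S m (fun x => r * (α * f x + β * k x)) (fun x => α * f x + β * k x)
      (fun x => α * F x + β * K x) where
  deriv x hx := (((hf.deriv x hx).const_mul α).fun_add
    ((hk.deriv x hx).const_mul β)).congr_deriv (by ring)
  flux_deriv x hx := (((hf.flux_deriv x hx).const_mul α).fun_add
    ((hk.flux_deriv x hx).const_mul β)).congr_deriv (by ring)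

theorem wronskian_eq {f F k K : ℝ → ℝ} (hf : HasFlux S m (fun x => r * f x) f F)
    (hk : HasFlux S m (fun x => r * k x) k K) {x y : ℝ} (hx : 0 < x) (hy : 0 < y) :
    K x * f x - F x * k x = K y * f y - F y * k y :=
  eq_of_hasDerivAt_zero (F := fun x => K x * f x - F x * k x)
    (fun z hz => (hasDerivAt_wronskian hf hk hz).congr_deriv (by ring)) hx hy

theorem wronskian_pos (h : TwoBoundary μ σ μ' S m r s ψ Ψ φ Φ p P q Q c
    gd Gd θd θd' κd gu Gu θu θu' κu) {x : ℝ} (hx : 0 < x) : 0 < Ψ x * φ x - Φ x * ψ x := by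
  nlinarith [mul_pos (h.inc_r.flux_pos x hx) (h.dec_r.pos x hx),
    mul_pos (neg_pos.2 (h.dec_r.flux_neg x hx)) (h.inc_r.pos x hx)]

/-- The derivative system of `u = k - g`, where `(𝒜 - r) k = 0` and `(𝒜 - r) g = θ`. -/
theorem deriv_system (h : TwoBoundary μ σ μ' S m r s ψ Ψ φ Φ p P q Q c
    gd Gd θd θd' κd gu Gu θu θu' κu) {k K g G θ θ' : ℝ → ℝ}
    (hk : HasFlux S m (fun x => r * k x) k K) (hg : HasFlux S m (fun x => r * g x + θ x) g G)
    (hθ : ∀ x, 0 < x → HasDerivAt θ (θ' x) x) {x : ℝ} (hx : 0 < x) :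
    HasDerivAt (fun x => S x * (K x - G x))
      (2 * S x / σ x ^ 2 * ((r * (k x - g x) - θ x - μ x * (S x * (K x - G x))) / S x)) x ∧
    HasDerivAt (fun x => (r * (k x - g x) - θ x - μ x * (S x * (K x - G x))) / S x)
      ((r - μ' x) / S x * (S x * (K x - G x)) + -θ' x / S x) x := by
  have hS := (h.dens.scale_pos x hx).ne'
  have hσ := (h.vol_pos x hx).ne'
  have h1 : HasDerivAt (fun x => S x * (K x - G x))
      (2 * S x / σ x ^ 2 * ((r * (k x - g x) - θ x - μ x * (S x * (K x - G x))) / S x)) x := by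
    refine ((h.scale_deriv x hx).fun_mul
      ((hk.flux_deriv x hx).fun_sub (hg.flux_deriv x hx))).congr_deriv ?_
    rw [h.speed_eq x hx]
    field_simp
    ring
  -- The second component is `½ σ² u'' / S`. Division by `S` acts as an integrating factor: it
  -- removes the term `μ u''` from the derivative.
  refine ⟨h1, ?_⟩
  refine ((((((hk.deriv x hx).fun_sub (hg.deriv x hx)).const_mul r).fun_sub (hθ x hx)).fun_sub
    ((h.drift_deriv x hx).fun_mul h1)).fun_div (h.scale_deriv x hx) hS).congr_deriv ?_
  field_simp
  ring

/-- At a solution, `kappa` is negative at both thresholds. -/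
theorem kappa_neg (h : TwoBoundary μ σ μ' S m r s ψ Ψ φ Φ p P q Q c
    gd Gd θd θd' κd gu Gu θu θu' κu) {a b : ℝ} (ha : 0 < a) (hab : a < b)
    (hψ : lowerVal r P gu Gu θu κu ψ Ψ a = upperVal r Q gd Gd θd κd ψ Ψ b)
    (hφ : lowerVal r P gu Gu θu κu φ Φ a = upperVal r Q gd Gd θd κd φ Φ b) :
    κu a < 0 ∧ κd b < 0 := by
  have hb := ha.trans hab
  have hW := h.wronskian_pos ha
  have hr := h.r_pos
  -- With `k a = pa` and `K a = Gu a`, the value `lowerVal` at `a` is `r (F k - f K)` for `f = ψ`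
  -- and `f = φ`. These are Wronskians of homogeneous solutions, so they are the same at `b`.
  set pa := (r * gu a + θu a + κu a / P a) / r with hpa
  set W := Ψ a * φ a - Φ a * ψ a with hWdef
  set α := (Gu a * φ a - pa * Φ a) / W with hα
  set β := (Ψ a * pa - ψ a * Gu a) / W with hβ
  set k := fun x => α * ψ x + β * φ x with hk
  set K := fun x => α * Ψ x + β * Φ x with hK
  have hkf : HasFlux S m (fun x => r * k x) k K :=
    hasFlux_comb h.inc_r.toHasFlux h.dec_r.toHasFlux α β
  have hka : k a = pa := by
    simp only [hk, hα, hβ]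
    field_simp
    rw [hWdef]
    ring
  have hKa : K a = Gu a := by
    simp only [hK, hα, hβ]
    field_simp
    rw [hWdef]
    ring
  have hrpa : r * pa = r * gu a + θu a + κu a / P a := by
    rw [hpa]
    field_simp
  have h1 := wronskian_eq h.inc_r.toHasFlux hkf ha hb
  have h2 := wronskian_eq h.dec_r.toHasFlux hkf ha hb
  unfold lowerVal upperVal at hψ hφ
  rw [← hrpa] at hψ hφ
  rw [hka, hKa] at h1 h2
  -- `X` and `Y` measure the failure of the matching at `b`. They solve a homogeneous linear system
  -- whose determinant is the Wronskian of `ψ` and `φ`, so both vanish.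
  set X := r * k b - (r * gd b + θd b - κd b / Q b) with hX
  set Y := r * (K b - Gd b) with hY
  have h3 : Ψ b * X = ψ b * Y := by
    rw [hX, hY]
    linear_combination hψ + r * h1
  have h4 : Φ b * X = φ b * Y := by
    rw [hX, hY]
    linear_combination hφ + r * h2
  have hWb := h.wronskian_pos hb
  have hX0 : X = 0 := by
    have : (Ψ b * φ b - Φ b * ψ b) * X = 0 := by linear_combination φ b * h3 - ψ b * h4
    exact (mul_eq_zero.1 this).resolve_left hWb.ne'
  have hY0 : K b - Gd b = 0 := by
    have h5 : ψ b * Y = 0 := by rw [← h3, hX0, mul_zero]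
    have h6 := (mul_eq_zero.1 h5).resolve_left (h.inc_r.pos b hb).ne'
    exact (mul_eq_zero.1 h6).resolve_left hr.ne'
  have hpos : ∀ x ∈ Icc a b, 0 < x := fun x hx => ha.trans_le hx.1
  have hcoef : ∀ x ∈ Icc a b, 0 < 2 * S x / σ x ^ 2 := fun x hx =>
    div_pos (mul_pos two_pos (h.dens.scale_pos x (hpos x hx)))
      (pow_pos (h.vol_pos x (hpos x hx)) 2)
  have hcoef' : ∀ x ∈ Icc a b, 0 ≤ (r - μ' x) / S x := fun x hx =>
    div_nonneg (sub_nonneg.2 (h.drift_deriv_lt x (hpos x hx)).le)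
      (h.dens.scale_pos x (hpos x hx)).le
  constructor
  -- Here `y = k' - g_u'` vanishes at `a`, where `e = κu / (P S) ≥ 0`, and the source `-θu' / S` is
  -- positive. So `y b > 0`, although `y b = g_d' b - g_u' b = c < 0`.
  · by_contra hcon
    have hθ := h.theta_u_neg a ha (not_lt.1 hcon)
    have hsys := fun x (hx : x ∈ Icc a b) =>
      h.deriv_system hkf h.flux_u h.theta_u (hpos x hx)
    have h5 := pos_of_cooperative_system hab (fun x hx => (hsys x hx).1)
      (fun x hx => (hsys x hx).2) hcoef hcoef'
      (fun x hx => div_pos (neg_pos.2 (hθ x hx.1)) (h.dens.scale_pos x (hpos x hx)))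
      (by rw [hKa]; ring) (by
        refine div_nonneg ?_ (h.dens.scale_pos a ha).le
        rw [hKa, hka]
        have : 0 ≤ κu a / P a := div_nonneg (not_lt.1 hcon) (h.inc_s.flux_pos a ha).le
        linarith)
    have h6 := h.flux_sub b hb
    have h7 : S b * (K b - Gu b) = c := by linear_combination h6 + S b * hY0
    rw [h7] at h5
    exact h5.not_gt h.c_neg
  -- Running from `b` to `a` with `y = -(k' - g_d')` gives the same kind of system, now with source
  -- `θd' / S > 0`; the final value of `y` is again `c`.
  · by_contra hcon
    have hθ := h.theta_d_pos b hb (not_lt.1 hcon)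
    have hmem : ∀ t ∈ Icc a b, a + b - t ∈ Icc a b := fun t ht =>
      ⟨by linarith [ht.2], by linarith [ht.1]⟩
    have hsys := fun t (ht : t ∈ Icc a b) =>
      h.deriv_system hkf h.flux_d h.theta_d (hpos _ (hmem t ht))
    have hrev : ∀ (f : ℝ → ℝ) (d t : ℝ), HasDerivAt f d (a + b - t) →
        HasDerivAt (fun t => f (a + b - t)) (-d) t := fun f d t hf =>
      hf.comp_const_sub (a + b) t
    have h5 := pos_of_cooperative_system hab
      (y := fun t => -(S (a + b - t) * (K (a + b - t) - Gd (a + b - t))))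
      (e := fun t => (r * (k (a + b - t) - gd (a + b - t)) - θd (a + b - t) -
        μ (a + b - t) * (S (a + b - t) * (K (a + b - t) - Gd (a + b - t)))) / S (a + b - t))
      (α := fun t => 2 * S (a + b - t) / σ (a + b - t) ^ 2)
      (β := fun t => (r - μ' (a + b - t)) / S (a + b - t))
      (δ := fun t => θd' (a + b - t) / S (a + b - t))
      (fun t ht => (hrev _ _ t (hsys t ht).1).fun_neg.congr_deriv (by ring))
      (fun t ht => (hrev _ _ t (hsys t ht).2).congr_deriv (by ring))
      (fun t ht => hcoef _ (hmem t ht)) (fun t ht => hcoef' _ (hmem t ht))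
      (fun t ht => div_pos (hθ _ (hpos _ (hmem t ht)) (hmem t ht).2)
        (h.dens.scale_pos _ (hpos _ (hmem t ht))))
      (by simp only [add_sub_cancel_left]; rw [hY0]; ring) (by
        simp only [add_sub_cancel_left]
        refine div_nonneg ?_ (h.dens.scale_pos b hb).le
        rw [hY0]
        have : 0 ≤ κd b / -Q b := div_nonneg (not_lt.1 hcon) (neg_pos.2 (h.dec_s.flux_neg b hb)).le
        rw [div_neg] at this
        linarith)
    simp only [add_sub_cancel_right] at h5
    have h6 := h.flux_sub a ha
    rw [hKa] at h5
    linarith [h.c_neg]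

/-- The last factor is `λ K_f`; all terms in `gu`, `Gu` and `θu` cancel, so monotonicity is the
product of the signs of `κu` and `K_f`. -/
theorem lowerVal_hasDerivAt (h : TwoBoundary μ σ μ' S m r s ψ Ψ φ Φ p P q Q c
    gd Gd θd θd' κd gu Gu θu θu' κu) {f F : ℝ → ℝ} (hf : HasFlux S m (fun x => r * f x) f F)
    {x : ℝ} (hx : 0 < x) :
    HasDerivAt (lowerVal r P gu Gu θu κu f F)
      (κu x * m x / P x ^ 2 * (r * f x * P x - s * F x * p x)) x := by
  have hP := (h.inc_s.flux_pos x hx).ne'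
  refine (((hf.flux_deriv x hx).fun_mul ((((h.flux_u.deriv x hx).const_mul r).fun_add
    (h.theta_u x hx)).fun_add ((h.kappa_u x hx).fun_div (h.inc_s.flux_deriv x hx) hP))).fun_sub
    (((hf.deriv x hx).const_mul r).fun_mul (h.flux_u.flux_deriv x hx))).congr_deriv ?_
  field_simp
  ring

theorem upperVal_hasDerivAt (h : TwoBoundary μ σ μ' S m r s ψ Ψ φ Φ p P q Q c
    gd Gd θd θd' κd gu Gu θu θu' κu) {f F : ℝ → ℝ} (hf : HasFlux S m (fun x => r * f x) f F)
    {x : ℝ} (hx : 0 < x) :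
    HasDerivAt (upperVal r Q gd Gd θd κd f F)
      (κd x * m x / Q x ^ 2 * (s * F x * q x - r * f x * Q x)) x := by
  have hQ := (h.dec_s.flux_neg x hx).ne
  refine (((hf.flux_deriv x hx).fun_mul ((((h.flux_d.deriv x hx).const_mul r).fun_add
    (h.theta_d x hx)).fun_sub ((h.kappa_d x hx).fun_div (h.dec_s.flux_deriv x hx) hQ))).fun_sub
    (((hf.deriv x hx).const_mul r).fun_mul (h.flux_d.flux_deriv x hx))).congr_deriv ?_
  field_simp
  ring

theorem lower_strictMonoOn (h : TwoBoundary μ σ μ' S m r s ψ Ψ φ Φ p P q Q c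
    gd Gd θd θd' κd gu Gu θu θu' κu) {a : ℝ} (ha : 0 < a) (hκ : κu a < 0) :
    StrictMonoOn (lowerVal r P gu Gu θu κu ψ Ψ) (Ioc 0 a) :=
  strictMonoOn_of_hasDerivAt (convex_Ioc 0 a)
    (fun _ hx => h.lowerVal_hasDerivAt h.inc_r.toHasFlux hx.1) fun x hx =>
      mul_pos_of_neg_of_neg (div_neg_of_neg_of_pos
        (mul_neg_of_neg_of_pos (h.kappa_u_neg a ha hκ x hx.1 hx.2) (h.dens.speed_pos x hx.1))
        (pow_pos (h.inc_s.flux_pos x hx.1) 2)) (h.K_neg x hx.1)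

theorem upper_factor_neg (h : TwoBoundary μ σ μ' S m r s ψ Ψ φ Φ p P q Q c
    gd Gd θd θd' κd gu Gu θu θu' κu) {b x : ℝ} (hb : 0 < b) (hκ : κd b < 0) (hbx : b ≤ x) :
    κd x * m x / Q x ^ 2 < 0 :=
  div_neg_of_neg_of_pos (mul_neg_of_neg_of_pos (h.kappa_d_neg b hb hκ x hbx)
    (h.dens.speed_pos x (hb.trans_le hbx)))
    ((sq_nonneg _).lt_of_ne' (pow_ne_zero 2 (h.dec_s.flux_neg x (hb.trans_le hbx)).ne))

/-- Since `Q < 0 < q`, positivity of `f` and `F` makes `s F q - r f Q` positive, while `κd < 0` on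
`[b, ∞)`. The solution `f` is left general because a mixture of `ψ` and `φ` is needed besides `ψ`.
-/
theorem upper_strictAntiOn (h : TwoBoundary μ σ μ' S m r s ψ Ψ φ Φ p P q Q c
    gd Gd θd θd' κd gu Gu θu θu' κu) {f F : ℝ → ℝ} (hf : HasFlux S m (fun x => r * f x) f F)
    {b : ℝ} (hb : 0 < b) (hκ : κd b < 0) (hfpos : ∀ x, b ≤ x → 0 < f x)
    (hFpos : ∀ x, b ≤ x → 0 < F x) :
    StrictAntiOn (upperVal r Q gd Gd θd κd f F) (Ici b) :=
  strictAntiOn_of_hasDerivAt (convex_Ici b)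
    (fun x hx => h.upperVal_hasDerivAt hf (hb.trans_le hx)) fun x hx => by
      have hx0 := hb.trans_le (mem_Ici.1 hx)
      refine mul_neg_of_neg_of_pos (h.upper_factor_neg hb hκ hx) ?_
      have h1 := mul_pos (mul_pos (h.r_pos.trans h.r_lt_s) (hFpos x hx)) (h.dec_s.pos x hx0)
      have h2 := mul_pos (mul_pos h.r_pos (hfpos x hx)) (neg_pos.2 (h.dec_s.flux_neg x hx0))
      linarith

/-- Two solutions cannot have different lower thresholds. -/
theorem not_lt_of_solutions (h : TwoBoundary μ σ μ' S m r s ψ Ψ φ Φ p P q Q c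
    gd Gd θd θd' κd gu Gu θu θu' κu) {a₁ b₁ a₂ b₂ : ℝ} (ha₁ : 0 < a₁) (hab₁ : a₁ < b₁)
    (hab₂ : a₂ < b₂)
    (hψ₁ : lowerVal r P gu Gu θu κu ψ Ψ a₁ = upperVal r Q gd Gd θd κd ψ Ψ b₁)
    (hφ₁ : lowerVal r P gu Gu θu κu φ Φ a₁ = upperVal r Q gd Gd θd κd φ Φ b₁)
    (hψ₂ : lowerVal r P gu Gu θu κu ψ Ψ a₂ = upperVal r Q gd Gd θd κd ψ Ψ b₂)
    (hφ₂ : lowerVal r P gu Gu θu κu φ Φ a₂ = upperVal r Q gd Gd θd κd φ Φ b₂) :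
    ¬ a₁ < a₂ := by
  intro hlt
  have ha₂ := ha₁.trans hlt
  have hb₁ := ha₁.trans hab₁
  have hb₂ := ha₂.trans hab₂
  obtain ⟨hκu, -⟩ := h.kappa_neg ha₂ hab₂ hψ₂ hφ₂
  obtain ⟨-, hκd₁⟩ := h.kappa_neg ha₁ hab₁ hψ₁ hφ₁
  obtain ⟨-, hκd₂⟩ := h.kappa_neg ha₂ hab₂ hψ₂ hφ₂
  have hs := h.r_pos.trans h.r_lt_s
  rcases le_or_gt b₁ b₂ with hb | hb
  -- The equation for `ψ` alone decides: from the first solution to the second its left side grows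
  -- strictly and its right side does not grow.
  · have h1 := h.lower_strictMonoOn ha₂ hκu ⟨ha₁, hlt.le⟩ ⟨ha₂, le_rfl⟩ hlt
    have h2 := (h.upper_strictAntiOn h.inc_r.toHasFlux hb₁ hκd₁
      (fun x hx => h.inc_r.pos x (hb₁.trans_le hx))
      (fun x hx => h.inc_r.flux_pos x (hb₁.trans_le hx))).antitoneOn self_mem_Ici hb hb
    linarith
  -- The coefficients make `λ K_f` vanish at `a₂` for `f = A ψ + D φ`, and both are positive.
  · set A := r * φ a₂ * P a₂ - s * Φ a₂ * p a₂ with hA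
    set D := -(r * ψ a₂ * P a₂ - s * Ψ a₂ * p a₂) with hDdef
    have hApos : 0 < A := by
      have h1 := mul_pos (mul_pos h.r_pos (h.dec_r.pos a₂ ha₂)) (h.inc_s.flux_pos a₂ ha₂)
      have h2 := mul_pos (mul_pos hs (neg_pos.2 (h.dec_r.flux_neg a₂ ha₂))) (h.inc_s.pos a₂ ha₂)
      rw [hA]
      linarith
    have hDpos : 0 < D := neg_pos.2 (h.K_neg a₂ ha₂)
    set f := fun x => A * ψ x + D * φ x with hf
    set F := fun x => A * Ψ x + D * Φ x with hF
    have hff : HasFlux S m (fun x => r * f x) f F :=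
      hasFlux_comb h.inc_r.toHasFlux h.dec_r.toHasFlux A D
    have hfpos : ∀ x, 0 < x → 0 < f x := fun x hx =>
      add_pos (mul_pos hApos (h.inc_r.pos x hx)) (mul_pos hDpos (h.dec_r.pos x hx))
    have hKa : r * f a₂ * P a₂ - s * F a₂ * p a₂ = 0 := by
      simp only [hf, hF, hA, hDdef]
      ring
    -- `K_f(a₂) = 0` reads `s F p = r f P > 0`.
    have hFa : 0 < F a₂ := by
      have h1 := mul_pos (mul_pos h.r_pos (hfpos a₂ ha₂)) (h.inc_s.flux_pos a₂ ha₂)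
      have h2 : 0 < F a₂ * (s * p a₂) := by linarith
      exact pos_of_mul_pos_left h2 (mul_pos hs (h.inc_s.pos a₂ ha₂)).le
    have hFmono : StrictMonoOn F (Ioi 0) :=
      strictMonoOn_of_hasDerivAt (convex_Ioi 0) (fun x hx => hff.flux_deriv x hx)
        fun x hx => mul_pos (mul_pos h.r_pos (hfpos x hx)) (h.dens.speed_pos x hx)
    -- If `F x ≤ 0`, no term is negative. Otherwise `F > 0` from `x` on, and `λ K_f` decreases to
    -- its zero at `a₂`.
    have hKpos : ∀ x, 0 < x → x ≤ a₂ → 0 ≤ r * f x * P x - s * F x * p x := by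
      intro x hx hxa
      rcases le_or_gt (F x) 0 with hF0 | hF0
      · have h1 := mul_pos (mul_pos h.r_pos (hfpos x hx)) (h.inc_s.flux_pos x hx)
        have h2 := mul_nonneg (mul_nonneg hs.le (neg_nonneg.2 hF0)) (h.inc_s.pos x hx).le
        linarith
      · have hanti : AntitoneOn (fun x => r * f x * P x - s * F x * p x) (Icc x a₂) := by
          refine antitoneOn_of_hasDerivAt (f := fun x => -((s - r) * (S x * F x * P x)))
            (convex_Icc _ _) (fun y hy => ?_) fun y hy => ?_
          · have hy0 := hx.trans_le hy.1
            refine ((((hff.deriv y hy0).const_mul r).fun_mul (h.inc_s.flux_deriv y hy0)).fun_sub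
              (((hff.flux_deriv y hy0).const_mul s).fun_mul
                (h.inc_s.deriv y hy0))).congr_deriv ?_
            ring
          · have hy0 := hx.trans_le hy.1
            have h1 := hF0.trans_le (hFmono.monotoneOn hx hy0 hy.1)
            exact (neg_neg_of_pos (mul_pos (sub_pos.2 h.r_lt_s) (mul_pos (mul_pos
              (h.dens.scale_pos y hy0) h1) (h.inc_s.flux_pos y hy0)))).le
        have h1 := hanti ⟨le_rfl, hxa⟩ ⟨hxa, le_rfl⟩ hxa
        simp only [hKa] at h1
        exact h1
    have hlow : AntitoneOn (lowerVal r P gu Gu θu κu f F) (Ioc 0 a₂) :=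
      antitoneOn_of_hasDerivAt (convex_Ioc 0 a₂)
        (fun x hx => h.lowerVal_hasDerivAt hff hx.1) fun x hx =>
          mul_nonpos_of_nonpos_of_nonneg (div_nonpos_of_nonpos_of_nonneg
            (mul_neg_of_neg_of_pos (h.kappa_u_neg a₂ ha₂ hκu x hx.1 hx.2)
              (h.dens.speed_pos x hx.1)).le (sq_nonneg _)) (hKpos x hx.1 hx.2)
    have h1 := hlow ⟨ha₁, hlt.le⟩ ⟨ha₂, le_rfl⟩ hlt.le
    have h2 := h.upper_strictAntiOn hff hb₂ hκd₂ (fun x hx => hfpos x (hb₂.trans_le hx))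
      (fun x hx => hFa.trans (hFmono ha₂ (hb₂.trans_le hx) (hab₂.trans_le hx)))
      self_mem_Ici hb.le hb
    have hlin : ∀ x, lowerVal r P gu Gu θu κu f F x =
        A * lowerVal r P gu Gu θu κu ψ Ψ x + D * lowerVal r P gu Gu θu κu φ Φ x := fun x => by
      simp only [lowerVal, hf, hF]
      ring
    have hlin' : ∀ x, upperVal r Q gd Gd θd κd f F x =
        A * upperVal r Q gd Gd θd κd ψ Ψ x + D * upperVal r Q gd Gd θd κd φ Φ x := fun x => by
      simp only [upperVal, hf, hF]
      ring
    rw [hlin, hlin, hψ₁, hφ₁, hψ₂, hφ₂, ← hlin', ← hlin'] at h1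
    exact h2.not_ge h1

theorem unique (h : TwoBoundary μ σ μ' S m r s ψ Ψ φ Φ p P q Q c
    gd Gd θd θd' κd gu Gu θu θu' κu) {a₁ b₁ a₂ b₂ : ℝ} (ha₁ : 0 < a₁) (hab₁ : a₁ < b₁)
    (ha₂ : 0 < a₂) (hab₂ : a₂ < b₂)
    (hψ₁ : lowerVal r P gu Gu θu κu ψ Ψ a₁ = upperVal r Q gd Gd θd κd ψ Ψ b₁)
    (hφ₁ : lowerVal r P gu Gu θu κu φ Φ a₁ = upperVal r Q gd Gd θd κd φ Φ b₁)
    (hψ₂ : lowerVal r P gu Gu θu κu ψ Ψ a₂ = upperVal r Q gd Gd θd κd ψ Ψ b₂)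
    (hφ₂ : lowerVal r P gu Gu θu κu φ Φ a₂ = upperVal r Q gd Gd θd κd φ Φ b₂) :
    a₁ = a₂ ∧ b₁ = b₂ := by
  have ha : a₁ = a₂ := le_antisymm
    (not_lt.1 (h.not_lt_of_solutions ha₂ hab₂ hab₁ hψ₂ hφ₂ hψ₁ hφ₁))
    (not_lt.1 (h.not_lt_of_solutions ha₁ hab₁ hab₂ hψ₁ hφ₁ hψ₂ hφ₂))
  refine ⟨ha, ?_⟩
  subst ha
  have hanti : ∀ b, a₁ < b → κd b < 0 →
      StrictAntiOn (upperVal r Q gd Gd θd κd ψ Ψ) (Ici b) := fun b hb hκ =>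
    h.upper_strictAntiOn h.inc_r.toHasFlux (ha₁.trans hb) hκ
      (fun x hx => h.inc_r.pos x ((ha₁.trans hb).trans_le hx))
      (fun x hx => h.inc_r.flux_pos x ((ha₁.trans hb).trans_le hx))
  have heq : upperVal r Q gd Gd θd κd ψ Ψ b₁ = upperVal r Q gd Gd θd κd ψ Ψ b₂ :=
    hψ₁.symm.trans hψ₂
  rcases lt_trichotomy b₁ b₂ with hb | hb | hb
  · exact absurd (hanti b₁ hab₁ (h.kappa_neg ha₁ hab₁ hψ₁ hφ₁).2 self_mem_Ici hb.le hb)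
      (by rw [heq]; exact lt_irrefl _)
  · exact hb
  · exact absurd (hanti b₂ hab₂ (h.kappa_neg ha₁ hab₂ hψ₂ hφ₂).2 self_mem_Ici hb.le hb)
      (by rw [heq]; exact lt_irrefl _)

end TwoBoundary

/-! ### Compactly supported test functions, cutoffs and integrability criteria. -/

/-- Continuous functions that vanish outside a compact subinterval of `(0, ∞)`. -/
def testFun : Submodule ℝ (ℝ → ℝ) where
  carrier := {k | Continuous k ∧ ∃ c d, 0 < c ∧ c < d ∧ ∀ y, y ∉ Icc c d → k y = 0}
  zero_mem' := ⟨continuous_const, 1, 2, by norm_num, by norm_num, fun _ _ => rfl⟩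
  add_mem' := by
    rintro k l ⟨hk, c, d, hc, hcd, hk0⟩ ⟨hl, c', d', hc', hcd', hl0⟩
    refine ⟨hk.add hl, min c c', max d d', lt_min hc hc',
      (min_le_left _ _).trans_lt (hcd.trans_le (le_max_left _ _)), fun y hy => ?_⟩
    have h1 : y ∉ Icc c d := fun h => hy ⟨(min_le_left _ _).trans h.1, h.2.trans (le_max_left _ _)⟩
    have h2 : y ∉ Icc c' d' := fun h =>
      hy ⟨(min_le_right _ _).trans h.1, h.2.trans (le_max_right _ _)⟩
    simp [hk0 y h1, hl0 y h2]
  smul_mem' := by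
    rintro a k ⟨hk, c, d, hc, hcd, hk0⟩
    exact ⟨hk.const_smul a, c, d, hc, hcd, fun y hy => by simp [hk0 y hy]⟩

/-- A trapezoidal cutoff: `1` on `[a, b]` and `0` outside `[a / 2, b + 1]`. -/
noncomputable def cutoff (a b y : ℝ) : ℝ :=
  max 0 (min 1 (min (2 * y / a - 1) (b + 1 - y)))

theorem cutoff_nonneg (a b y : ℝ) : 0 ≤ cutoff a b y := le_max_left _ _

theorem cutoff_le_one (a b y : ℝ) : cutoff a b y ≤ 1 :=
  max_le zero_le_one (min_le_left _ _)

theorem cutoff_eq_one {a b y : ℝ} (ha : 0 < a) (hy : y ∈ Icc a b) : cutoff a b y = 1 := by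
  have h1 : 1 ≤ 2 * y / a - 1 := by
    have : 2 ≤ 2 * y / a := by rw [le_div_iff₀ ha]; linarith [hy.1]
    linarith
  have h2 : 1 ≤ b + 1 - y := by linarith [hy.2]
  simp [cutoff, min_eq_left (le_min h1 h2)]

theorem cutoff_eq_zero {a b y : ℝ} (ha : 0 < a) (hy : y ∉ Icc (a / 2) (b + 1)) :
    cutoff a b y = 0 := by
  refine max_eq_left ((min_le_right _ _).trans ?_)
  by_cases h : a / 2 ≤ y
  · have h2 : b + 1 < y := by
      by_contra h'
      exact hy ⟨h, not_lt.1 h'⟩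
    exact (min_le_right _ _).trans (by linarith)
  · refine (min_le_left _ _).trans ?_
    have : 2 * y / a ≤ 1 := by rw [div_le_one ha]; linarith [not_le.1 h]
    linarith

theorem continuous_cutoff (a b : ℝ) : Continuous (cutoff a b) := by
  unfold cutoff
  fun_prop

theorem continuous_of_zero_left {F : ℝ → ℝ} (hF : ContinuousOn F (Ioi 0)) {c : ℝ} (hc : 0 < c)
    (h0 : ∀ y, y < c → F y = 0) : Continuous F := by
  refine continuous_iff_continuousAt.2 fun y => ?_
  rcases lt_or_ge y c with h | h
  · refine (continuousAt_const (y := (0 : ℝ))).congr ?_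
    filter_upwards [Iio_mem_nhds h] with z hz using (h0 z hz).symm
  · exact hF.continuousAt (Ioi_mem_nhds (hc.trans_le h))

theorem hasDerivAt_of_zero_left {F F' : ℝ → ℝ} (hF : ∀ x, 0 < x → HasDerivAt F (F' x) x) {c : ℝ}
    (hc : 0 < c) (h0 : ∀ y, y < c → F y = 0) (h0' : ∀ y, y < c → F' y = 0) (y : ℝ) :
    HasDerivAt F (F' y) y := by
  rcases lt_or_ge y c with h | h
  · rw [h0' y h]
    refine (hasDerivAt_const y (0 : ℝ)).congr_of_eventuallyEq ?_
    filter_upwards [Iio_mem_nhds h] with z hz using h0 z hz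
  · exact hF y (hc.trans_le h)

theorem cutoff_mul_mem {f : ℝ → ℝ} (hf : ContinuousOn f (Ioi 0)) {a b : ℝ} (ha : 0 < a)
    (hab : a ≤ b) : (fun y => cutoff a b y * f y) ∈ testFun := by
  refine ⟨continuous_of_zero_left ((continuous_cutoff a b).continuousOn.fun_mul hf)
    (half_pos ha) fun y hy => ?_, a / 2, b + 1, half_pos ha, by linarith, fun y hy => ?_⟩
  · rw [cutoff_eq_zero ha fun h => hy.not_ge h.1, zero_mul]
  · simp only [cutoff_eq_zero ha hy, zero_mul]

theorem integrableOn_mul_testFun {ψ m k : ℝ → ℝ} (hψ : ContinuousOn ψ (Ioi 0))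
    (hm : ContinuousOn m (Ioi 0)) (hk : k ∈ testFun) (t : Set ℝ) (ht : MeasurableSet t) :
    IntegrableOn (fun y => ψ y * k y * m y) t := by
  obtain ⟨hkc, c, d, hc, hcd, hk0⟩ := hk
  refine (integrableOn_Icc_of_continuousOn
    ((hψ.fun_mul hkc.continuousOn).fun_mul hm) hc d).of_forall_sdiff_eq_zero ht fun y hy => ?_
  simp [hk0 y hy.2]

theorem contDiff_two_of_hasDerivAt {f f₁ f₂ : ℝ → ℝ} (h1 : ∀ x, HasDerivAt f (f₁ x) x)
    (h2 : ∀ x, HasDerivAt f₁ (f₂ x) x) (hc : Continuous f₂) : ContDiff ℝ 2 f := by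
  have e1 : deriv f = f₁ := funext fun x => (h1 x).deriv
  have e2 : deriv f₁ = f₂ := funext fun x => (h2 x).deriv
  rw [show (2 : WithTop ℕ∞) = 1 + 1 from rfl, contDiff_succ_iff_deriv]
  refine ⟨fun x => (h1 x).differentiableAt, by simp, ?_⟩
  rw [e1, contDiff_one_iff_deriv, e2]
  exact ⟨fun x => (h2 x).differentiableAt, hc⟩

theorem integrableOn_Ioc_of_bounded {f : ℝ → ℝ} (hf : ContinuousOn f (Ioi 0))
    (hpos : ∀ x, 0 < x → 0 ≤ f x) {c C : ℝ} (hc : 0 < c)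
    (h : ∀ ε, 0 < ε → ε ≤ c → ∫ y in Ioc ε c, f y ≤ C) : IntegrableOn f (Ioc 0 c) := by
  refine integrableOn_of_hasDerivAt_of_le (F := fun x => -∫ y in x..c, f y) (C := -C) hc
    (fun x hx => ?_) hf (fun x hx _ => hpos x hx) fun x hx hxc => ?_
  · have := (intervalIntegral.integral_hasDerivAt_left
      (intervalIntegrable_of_continuousOn hf hx hc)
      (hf.stronglyMeasurableAtFilter isOpen_Ioi x hx)
      (hf.continuousAt (Ioi_mem_nhds hx))).fun_neg
    rwa [neg_neg] at this
  · rw [intervalIntegral.integral_of_le hxc]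
    exact neg_le_neg (h x hx hxc)

theorem integrableOn_Ioi_of_bounded {f : ℝ → ℝ} (hf : ContinuousOn f (Ioi 0))
    (hpos : ∀ x, 0 < x → 0 ≤ f x) {c C : ℝ} (hc : 0 < c)
    (h : ∀ N, c ≤ N → ∫ y in Ioc c N, f y ≤ C) : IntegrableOn f (Ioi c) := by
  refine integrableOn_Ioi_of_intervalIntegral_norm_bounded (l := atTop) (b := id) C c
    (fun N => integrableOn_Ioc_of_continuousOn hf hc N) tendsto_id ?_
  filter_upwards [eventually_ge_atTop c] with N hN
  rw [id, intervalIntegral.integral_of_le hN]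
  refine (setIntegral_congr_fun measurableSet_Ioc fun y hy => ?_).trans_le (h N hN)
  exact Real.norm_of_nonneg (hpos y (hc.trans hy.1))

/-! ### A finite measure that solves the resolvent equation is the Green measure. -/

/-- The Green functional `∫ G(x, y) k(y) m(y) dy`. -/
noncomputable def greenInt (m ψ φ : ℝ → ℝ) (B x : ℝ) (k : ℝ → ℝ) : ℝ :=
  (φ x * (∫ y in Ioc 0 x, ψ y * k y * m y) + ψ x * ∫ y in Ioi x, φ y * k y * m y) / B

theorem isGreen_testFun {S m ψ Ψ φ Φ k : ℝ → ℝ} {r B : ℝ} (hD : Densities S m)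
    (hψ : IncSol S m r ψ Ψ) (hφ : DecSol S m r φ Φ)
    (hB : ∀ x, 0 < x → Ψ x * φ x - Φ x * ψ x = B) (hk : k ∈ testFun) :
    IsGreen m ψ Ψ φ Φ k (fun x => ∫ y in Ioc 0 x, ψ y * k y * m y)
      (fun x => ∫ y in Ioi x, φ y * k y * m y) B
      (fun x => -(φ x * (∫ y in Ioc 0 x, ψ y * k y * m y) + ψ x *
        ∫ y in Ioi x, φ y * k y * m y) / B)
      (fun x => -(Φ x * (∫ y in Ioc 0 x, ψ y * k y * m y) + Ψ x *
        ∫ y in Ioi x, φ y * k y * m y) / B) := by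
  have hkc : Continuous k := hk.1
  refine ⟨hkc.continuousOn, ?_, fun x hx => ?_, fun x hx => ?_, ?_, hB, fun _ _ => rfl,
    fun _ _ => rfl⟩
  · exact integrableOn_mul_testFun hψ.cont hD.speed_cont hk _ measurableSet_Ioc
  · exact hasDerivAt_integral_Ioc ((hψ.cont.fun_mul hkc.continuousOn).fun_mul hD.speed_cont)
      (fun c => integrableOn_mul_testFun hψ.cont hD.speed_cont hk _ measurableSet_Ioc) hx
  · exact hasDerivAt_integral_Ioi ((hφ.cont.fun_mul hkc.continuousOn).fun_mul hD.speed_cont)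
      (fun c _ => integrableOn_mul_testFun hφ.cont hD.speed_cont hk _ measurableSet_Ioi) hx
  · exact tendsto_integral_Ioc_zero one_pos
      (integrableOn_mul_testFun hψ.cont hD.speed_cont hk _ measurableSet_Ioc)

section Representation

variable {μ σ S m ψ Ψ φ Φ : ℝ → ℝ} {r B : ℝ} {ν : Measure ℝ} {x : ℝ}

/-- A measure that solves the resolvent equation agrees with the Green measure on test functions
that are orthogonal to `ψ` and `φ`. -/
theorem integral_eq_greenInt_of_orthogonal (hD : Densities S m)
    (hS : ∀ x, 0 < x → HasDerivAt S (-(2 * μ x / σ x ^ 2) * S x) x)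
    (hm : ∀ x, 0 < x → m x = 2 / (σ x ^ 2 * S x)) (hσ : ∀ x, 0 < x → 0 < σ x)
    (hσc : ContinuousOn σ (Ioi 0)) (hμc : ContinuousOn μ (Ioi 0))
    (hψ : IncSol S m r ψ Ψ) (hφ : DecSol S m r φ Φ)
    (hB : ∀ x, 0 < x → Ψ x * φ x - Φ x * ψ x = B) (hν0 : ∀ᵐ y ∂ν, 0 < y)
    (hν : ∀ f : ℝ → ℝ, ContDiff ℝ 2 f → HasCompactSupport f → tsupport f ⊆ Ioi 0 →
      ∫ y, (r * f y - generator μ σ f y) ∂ν = f x)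
    {k : ℝ → ℝ} (hk : k ∈ testFun) (hkψ : ∫ y in Ioi 0, ψ y * k y * m y = 0)
    (hkφ : ∫ y in Ioi 0, φ y * k y * m y = 0) : ∫ y, k y ∂ν = greenInt m ψ φ B x k := by
  have hg := isGreen_testFun hD hψ hφ hB hk
  have hgf := hg.hasFlux hψ hφ
  obtain ⟨hkc, c, d, hc, hcd, hk0⟩ := id hk
  set I := fun x => ∫ y in Ioc 0 x, ψ y * k y * m y with hI
  set J := fun x => ∫ y in Ioi x, φ y * k y * m y with hJ
  have hzero : ∀ (w : ℝ → ℝ) (t : Set ℝ), MeasurableSet t → (∀ y ∈ t, y ∉ Icc c d) →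
      ∫ y in t, w y * k y * m y = 0 := fun w t ht h =>
    setIntegral_eq_zero_of_forall_eq_zero fun y hy => by simp [hk0 y (h y hy)]
  have hIc : ∀ y, y < c → I y = 0 := fun y hy =>
    hzero ψ _ measurableSet_Ioc fun z hz h => (hz.2.trans_lt hy).not_ge h.1
  have hJd : ∀ y, d ≤ y → J y = 0 := fun y hy =>
    hzero φ _ measurableSet_Ioi fun z hz h => (hy.trans_lt hz).not_ge h.2
  -- To the left of the support of `k`, `J` is the full integral, which is zero by orthogonality to
  -- `φ`. Likewise orthogonality to `ψ` kills `I` on the right, so the potential has compact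
  -- support.
  have hJc : ∀ y, y < c → J y = 0 := by
    intro y hy
    have h1 : ∀ t, t < c → J t = ∫ z in Icc c d, φ z * k z * m z := fun t ht =>
      (setIntegral_eq_of_subset_of_forall_sdiff_eq_zero measurableSet_Ioi
        (fun z hz => ht.trans_le hz.1) fun z hz => by simp [hk0 z hz.2])
    rw [h1 y hy, ← h1 0 hc]
    exact hkφ
  have hId : ∀ y, d ≤ y → I y = 0 := by
    intro y hy
    have h1 : I y = ∫ z in Icc c d, ψ z * k z * m z :=
      setIntegral_eq_of_subset_of_forall_sdiff_eq_zero measurableSet_Ioc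
        (fun z hz => ⟨hc.trans_le hz.1, hz.2.trans hy⟩) fun z hz => by simp [hk0 z hz.2]
    have h2 : ∫ z in Ioi 0, ψ z * k z * m z = ∫ z in Icc c d, ψ z * k z * m z :=
      setIntegral_eq_of_subset_of_forall_sdiff_eq_zero measurableSet_Ioi
        (fun z hz => hc.trans_le hz.1) fun z hz => by simp [hk0 z hz.2]
    rw [h1, ← h2, hkψ]
  set g := fun x => -(φ x * I x + ψ x * J x) / B with hgdef
  set G := fun x => -(Φ x * I x + Ψ x * J x) / B with hGdef
  have hgc : ∀ y, y < c → g y = 0 := fun y hy => by simp [hgdef, hIc y hy, hJc y hy]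
  have hGc : ∀ y, y < c → G y = 0 := fun y hy => by simp [hGdef, hIc y hy, hJc y hy]
  have hgd : ∀ y, d ≤ y → g y = 0 := fun y hy => by simp [hgdef, hId y hy, hJd y hy]
  set f₂ := fun y => -(2 * μ y / σ y ^ 2) * S y * G y + S y * ((r * g y + k y) * m y) with hf₂
  have hkc0 : ∀ y, y < c → k y = 0 := fun y hy => hk0 y fun h => hy.not_ge h.1
  have h1 : ∀ y, HasDerivAt g (S y * G y) y :=
    hasDerivAt_of_zero_left hgf.deriv hc hgc fun y hy => by rw [hGc y hy, mul_zero]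
  have h2 : ∀ y, HasDerivAt (fun y => S y * G y) (f₂ y) y :=
    hasDerivAt_of_zero_left (fun y hy => (hS y hy).fun_mul (hgf.flux_deriv y hy)) hc
      (fun y hy => by rw [hGc y hy, mul_zero])
      fun y hy => by simp [hf₂, hGc y hy, hgc y hy, hkc0 y hy]
  have h3 : Continuous f₂ := by
    refine continuous_of_zero_left ?_ hc fun y hy => by
      simp [hf₂, hGc y hy, hgc y hy, hkc0 y hy]
    refine ContinuousOn.add ?_ ?_
    · exact ((((continuousOn_const.fun_mul hμc).div (hσc.pow 2) fun y hy =>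
        (pow_pos (hσ y hy) 2).ne').fun_neg.fun_mul hD.scale_cont).fun_mul hgf.flux_cont)
    · exact hD.scale_cont.fun_mul (((continuousOn_const.fun_mul hgf.cont).fun_add
        hkc.continuousOn).fun_mul hD.speed_cont)
  have hgC : ContDiff ℝ 2 g := contDiff_two_of_hasDerivAt h1 h2 h3
  have hsub : tsupport g ⊆ Icc c d := by
    refine closure_minimal (fun y hy => ?_) isClosed_Icc
    by_contra h
    rw [mem_Icc, not_and_or, not_le, not_le] at h
    exact hy (h.elim (hgc y) fun h => hgd y h.le)
  -- The function `-g` is an admissible test function, and `(r - 𝒜)(-g) = k` on `(0, ∞)`.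
  have h4 := hν (fun y => -g y) hgC.neg
    (HasCompactSupport.intro isCompact_Icc (K := Icc c d) fun y hy => by
      rw [image_eq_zero_of_notMem_tsupport fun h => hy (hsub h), neg_zero])
    (by
      rw [show (fun y => -g y) = -g from rfl, tsupport_neg]
      exact fun y hy => hc.trans_le (hsub hy).1)
  have hgen : ∀ y, 0 < y → r * -g y - generator μ σ (fun y => -g y) y = k y := by
    intro y hy
    have e1 : deriv (fun y => -g y) = fun y => -(S y * G y) :=
      funext fun z => (h1 z).fun_neg.deriv
    have e2 : deriv (fun y => -(S y * G y)) y = -f₂ y := (h2 y).fun_neg.deriv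
    have hσy := (hσ y hy).ne'
    have hSy := (hD.scale_pos y hy).ne'
    rw [generator, e1, e2]
    simp only [hf₂]
    rw [hm y hy]
    field_simp
    ring
  rw [integral_congr_ae (hν0.mono fun y hy => hgen y hy)] at h4
  rw [h4, greenInt]
  simp only [hgdef, hI, hJ]
  ring

/-- The difference of the two functionals vanishes on the common kernel of `∫ ψ k m` and `∫ φ k m`,
hence is a combination of them. It is bounded for `0 ≤ k ≤ 1`, whereas natural boundaries make `∫ φ
m` diverge at `0` and `∫ ψ m` diverge at `∞`; so both coefficients are zero. -/
theorem integral_eq_greenInt_testFun [IsFiniteMeasure ν] (hD : Densities S m)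
    (hN0 : NaturalAtZero S m) (hN1 : NaturalAtInfty S m) (hr : 0 < r)
    (hS : ∀ x, 0 < x → HasDerivAt S (-(2 * μ x / σ x ^ 2) * S x) x)
    (hm : ∀ x, 0 < x → m x = 2 / (σ x ^ 2 * S x)) (hσ : ∀ x, 0 < x → 0 < σ x)
    (hσc : ContinuousOn σ (Ioi 0)) (hμc : ContinuousOn μ (Ioi 0))
    (hψ : IncSol S m r ψ Ψ) (hφ : DecSol S m r φ Φ)
    (hB : ∀ x, 0 < x → Ψ x * φ x - Φ x * ψ x = B) (hBpos : 0 < B) (hν0 : ∀ᵐ y ∂ν, 0 < y)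
    (hx : 0 < x)
    (hν : ∀ f : ℝ → ℝ, ContDiff ℝ 2 f → HasCompactSupport f → tsupport f ⊆ Ioi 0 →
      ∫ y, (r * f y - generator μ σ f y) ∂ν = f x)
    {k : ℝ → ℝ} (hk : k ∈ testFun) : ∫ y, k y ∂ν = greenInt m ψ φ B x k := by
  have hintν : ∀ k ∈ testFun, Integrable k ν := by
    rintro k ⟨hkc, c, d, hc, hcd, hk0⟩
    exact hkc.integrable_of_hasCompactSupport
      (HasCompactSupport.intro isCompact_Icc (K := Icc c d) hk0)
  have hiψ : ∀ k ∈ testFun, ∀ t, MeasurableSet t → IntegrableOn (fun y => ψ y * k y * m y) t :=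
    fun k hk t ht => integrableOn_mul_testFun hψ.cont hD.speed_cont hk t ht
  have hiφ : ∀ k ∈ testFun, ∀ t, MeasurableSet t → IntegrableOn (fun y => φ y * k y * m y) t :=
    fun k hk t ht => integrableOn_mul_testFun hφ.cont hD.speed_cont hk t ht
  have hadd : ∀ (w k l : ℝ → ℝ) (t : Set ℝ), IntegrableOn (fun y => w y * k y * m y) t →
      IntegrableOn (fun y => w y * l y * m y) t →
      ∫ y in t, w y * (k + l) y * m y =
        (∫ y in t, w y * k y * m y) + ∫ y in t, w y * l y * m y := fun w k l t h1 h2 => by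
    rw [← integral_add h1 h2]
    refine integral_congr_ae (ae_of_all _ fun y => ?_)
    simp only [Pi.add_apply]
    ring
  have hsmul : ∀ (w : ℝ → ℝ) (a : ℝ) (k : ℝ → ℝ) (t : Set ℝ),
      ∫ y in t, w y * (a • k) y * m y = a * ∫ y in t, w y * k y * m y := fun w a k t => by
    rw [← integral_const_mul]
    refine integral_congr_ae (ae_of_all _ fun y => ?_)
    simp only [Pi.smul_apply, smul_eq_mul]
    ring
  let L : Fin 2 → testFun →ₗ[ℝ] ℝ := ![
    { toFun := fun k => ∫ y in Ioi 0, ψ y * (k : ℝ → ℝ) y * m y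
      map_add' := fun k l => hadd ψ k l _ (hiψ k k.2 _ measurableSet_Ioi)
        (hiψ l l.2 _ measurableSet_Ioi)
      map_smul' := fun a k => hsmul ψ a k _ },
    { toFun := fun k => ∫ y in Ioi 0, φ y * (k : ℝ → ℝ) y * m y
      map_add' := fun k l => hadd φ k l _ (hiφ k k.2 _ measurableSet_Ioi)
        (hiφ l l.2 _ measurableSet_Ioi)
      map_smul' := fun a k => hsmul φ a k _ }]
  let D : testFun →ₗ[ℝ] ℝ :=
    { toFun := fun k => (∫ y, (k : ℝ → ℝ) y ∂ν) - greenInt m ψ φ B x k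
      map_add' := fun k l => by
        have h1 : ∫ y, ((k : ℝ → ℝ) + (l : ℝ → ℝ)) y ∂ν =
            (∫ y, (k : ℝ → ℝ) y ∂ν) + ∫ y, (l : ℝ → ℝ) y ∂ν :=
          integral_add (hintν k k.2) (hintν l l.2)
        simp only [greenInt, Submodule.coe_add]
        rw [h1, hadd ψ k l _ (hiψ k k.2 _ measurableSet_Ioc) (hiψ l l.2 _ measurableSet_Ioc),
          hadd φ k l _ (hiφ k k.2 _ measurableSet_Ioi) (hiφ l l.2 _ measurableSet_Ioi)]
        ring
      map_smul' := fun a k => by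
        have h1 : ∫ y, (a • (k : ℝ → ℝ)) y ∂ν = a * ∫ y, (k : ℝ → ℝ) y ∂ν := by
          simp only [Pi.smul_apply, smul_eq_mul]
          exact integral_const_mul _ _
        simp only [greenInt, Submodule.coe_smul, RingHom.id_apply, smul_eq_mul]
        rw [h1, hsmul, hsmul]
        ring }
  have hspan : D ∈ Submodule.span ℝ (range L) := by
    refine mem_span_of_iInf_ker_le_ker fun k hk => ?_
    rw [Submodule.mem_iInf] at hk
    have h1 : ∫ y in Ioi 0, ψ y * (k : ℝ → ℝ) y * m y = 0 := hk 0
    have h2 : ∫ y in Ioi 0, φ y * (k : ℝ → ℝ) y * m y = 0 := hk 1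
    exact sub_eq_zero.2 (integral_eq_greenInt_of_orthogonal hD hS hm hσ hσc hμc hψ hφ hB hν0 hν
      k.2 h1 h2)
  obtain ⟨w, hw⟩ := (Submodule.mem_span_range_iff_exists_fun ℝ).1 hspan
  have hDk : ∀ k ∈ testFun, (∫ y, k y ∂ν) - greenInt m ψ φ B x k =
      w 0 * (∫ y in Ioi 0, ψ y * k y * m y) + w 1 * ∫ y in Ioi 0, φ y * k y * m y := by
    intro k hk
    have := LinearMap.congr_fun hw ⟨k, hk⟩
    simp only [Fin.sum_univ_two, LinearMap.add_apply, LinearMap.smul_apply, smul_eq_mul] at this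
    exact this.symm
  have hψm := hψ.integrableOn hD hr
  have hφm : IntegrableOn (fun y => φ y * m y) (Ioi x) := by
    have h1 := hφ.reflect.integrableOn hD.reflect hr x⁻¹
    rw [integrableOn_Ioi_iff_reflDens hx, ← integrableOn_Ioc_iff_integrableOn_Ioo]
    refine h1.congr_fun (fun y _ => ?_) measurableSet_Ioc
    simp only [reflDens, reflFun]
    ring
  have hmono : ∀ {v k : ℝ → ℝ} {t : Set ℝ}, MeasurableSet t → t ⊆ Ioi 0 →
      (∀ y, 0 < y → 0 < v y) → (∀ y, 0 ≤ k y) → (∀ y, k y ≤ 1) →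
      IntegrableOn (fun y => v y * k y * m y) t → IntegrableOn (fun y => v y * m y) t →
      0 ≤ (∫ y in t, v y * k y * m y) ∧
      ∫ y in t, v y * k y * m y ≤ ∫ y in t, v y * m y := by
    intro v k t ht hsub hv hk0 hk1 h1 h2
    refine ⟨setIntegral_nonneg ht fun y hy => ?_, setIntegral_mono_on h1 h2 ht fun y hy => ?_⟩
    · exact mul_nonneg (mul_nonneg (hv y (hsub hy)).le (hk0 y)) (hD.speed_pos y (hsub hy)).le
    · have := mul_pos (hv y (hsub hy)) (hD.speed_pos y (hsub hy))
      nlinarith [mul_le_mul_of_nonneg_left (hk1 y) this.le]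
  -- The bound is the total mass of `ν` plus the Green integral of the constant `1`, finite because
  -- `ψ m` is integrable at `0` and `φ m` at `∞`.
  obtain ⟨C, hC⟩ : ∃ C, ∀ k ∈ testFun, (∀ y, 0 ≤ k y) → (∀ y, k y ≤ 1) →
      |w 0 * (∫ y in Ioi 0, ψ y * k y * m y) + w 1 * ∫ y in Ioi 0, φ y * k y * m y| ≤ C := by
    refine ⟨ν.real univ + (φ x * (∫ y in Ioc 0 x, ψ y * m y) +
      ψ x * ∫ y in Ioi x, φ y * m y) / B, fun k hk hk0 hk1 => ?_⟩
    rw [← hDk k hk]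
    obtain ⟨h1, h2⟩ := hmono measurableSet_Ioc Ioc_subset_Ioi_self hψ.pos hk0 hk1
      (hiψ k hk _ measurableSet_Ioc) (hψm x)
    obtain ⟨h3, h4⟩ := hmono measurableSet_Ioi (Ioi_subset_Ioi hx.le) hφ.pos hk0 hk1
      (hiφ k hk _ measurableSet_Ioi) hφm
    have h5 : 0 ≤ ∫ y, k y ∂ν := integral_nonneg hk0
    have h6 : ∫ y, k y ∂ν ≤ ν.real univ := by
      have := integral_mono (hintν k hk) (integrable_const (1 : ℝ)) hk1
      simpa using this
    have h7 : 0 ≤ greenInt m ψ φ B x k :=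
      div_nonneg (add_nonneg (mul_nonneg (hφ.pos x hx).le h1)
        (mul_nonneg (hψ.pos x hx).le h3)) hBpos.le
    have h8 : greenInt m ψ φ B x k ≤ (φ x * (∫ y in Ioc 0 x, ψ y * m y) +
        ψ x * ∫ y in Ioi x, φ y * m y) / B :=
      div_le_div_of_nonneg_right (add_le_add (mul_le_mul_of_nonneg_left h2 (hφ.pos x hx).le)
        (mul_le_mul_of_nonneg_left h4 (hψ.pos x hx).le)) hBpos.le
    rw [abs_le]
    constructor <;> linarith
  have hone : ∀ {a b : ℝ}, 0 < a → a ≤ b → cutoff a b ∈ testFun := fun {a b} ha hab => by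
    simpa using cutoff_mul_mem (f := fun _ => 1) continuousOn_const ha hab
  have hcut : ∀ {v : ℝ → ℝ} {a b : ℝ}, 0 < a → a ≤ b → (∀ y, 0 < y → 0 < v y) →
      ContinuousOn v (Ioi 0) →
      ∫ y in Ioc a b, v y * m y ≤ ∫ y in Ioi 0, v y * cutoff a b y * m y := by
    intro v a b ha hab hv hvc
    have h1 := integrableOn_mul_testFun hvc hD.speed_cont (hone ha hab) _
      (measurableSet_Ioi (a := 0))
    have h2 : ∫ y in Ioc a b, v y * m y = ∫ y in Ioc a b, v y * cutoff a b y * m y :=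
      setIntegral_congr_fun measurableSet_Ioc fun y hy => by
        simp only [cutoff_eq_one ha ⟨hy.1.le, hy.2⟩, mul_one]
    rw [h2]
    refine setIntegral_mono_set h1 ?_ (LE.le.eventuallyLE fun y hy => ha.trans hy.1)
    exact (ae_restrict_mem measurableSet_Ioi).mono fun y hy =>
      mul_nonneg (mul_nonneg (hv y hy).le (cutoff_nonneg a b y)) (hD.speed_pos y hy).le
  -- Cutoffs on `[ε, 1]` with `ε → 0` keep the `ψ` part bounded, so `w 1 ≠ 0` would make `φ m`
  -- integrable at `0`.
  have hw1 : w 1 = 0 := by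
    by_contra hne
    have hpos := abs_pos.2 hne
    refine hφ.not_integrableOn hD hN0 hr (integrableOn_Ioc_of_bounded
      (C := (C + |w 0| * ∫ y in Ioc 0 2, ψ y * m y) / |w 1|)
      (hφ.cont.fun_mul hD.speed_cont) (fun y hy => (mul_pos (hφ.pos y hy)
        (hD.speed_pos y hy)).le) one_pos fun ε hε hε1 => ?_)
    refine (hcut hε hε1 hφ.pos hφ.cont).trans ?_
    have h1 := hC _ (hone hε hε1) (cutoff_nonneg ε 1) (cutoff_le_one ε 1)
    -- The end `2 = 1 + 1` is where the cutoff at `1` reaches zero.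
    have h2 : ∫ y in Ioi 0, ψ y * cutoff ε 1 y * m y =
        ∫ y in Ioc 0 2, ψ y * cutoff ε 1 y * m y :=
      setIntegral_eq_of_subset_of_forall_sdiff_eq_zero measurableSet_Ioi Ioc_subset_Ioi_self
        fun y hy => by
          rw [cutoff_eq_zero hε fun h => hy.2 ⟨hy.1, by linarith [h.2]⟩]
          ring
    obtain ⟨h3, h4⟩ := hmono measurableSet_Ioc Ioc_subset_Ioi_self hψ.pos (cutoff_nonneg ε 1)
      (cutoff_le_one ε 1) (hiψ _ (hone hε hε1) _ measurableSet_Ioc) (hψm 2)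
    rw [h2] at h1
    set X := ∫ y in Ioc 0 2, ψ y * cutoff ε 1 y * m y
    set Y := ∫ y in Ioi 0, φ y * cutoff ε 1 y * m y
    have h5 : |w 1| * Y ≤ C + |w 0| * X := by
      have h6 := abs_sub_abs_le_abs_sub (w 1 * Y) (-(w 0 * X))
      rw [abs_neg, sub_neg_eq_add, add_comm (w 1 * Y)] at h6
      rw [abs_mul (w 0), abs_of_nonneg h3, abs_mul] at h6
      nlinarith [le_abs_self Y, mul_le_mul_of_nonneg_left (le_abs_self Y) hpos.le]
    rw [le_div_iff₀ hpos]
    nlinarith [mul_le_mul_of_nonneg_left h4 (abs_nonneg (w 0))]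
  have hw0 : w 0 = 0 := by
    by_contra hne
    have hpos := abs_pos.2 hne
    have hnot : ¬ IntegrableOn (fun y => ψ y * m y) (Ioi 1) := by
      intro h
      refine hψ.reflect.not_integrableOn hD.reflect (hN1.reflect hD) hr ?_
      rw [integrableOn_Ioi_iff_reflDens one_pos, inv_one,
        ← integrableOn_Ioc_iff_integrableOn_Ioo] at h
      refine h.congr_fun (fun y _ => ?_) measurableSet_Ioc
      simp only [reflDens, reflFun]
      ring
    refine hnot (integrableOn_Ioi_of_bounded (C := C / |w 0|)
      (hψ.cont.fun_mul hD.speed_cont) (fun y hy => (mul_pos (hψ.pos y hy)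
        (hD.speed_pos y hy)).le) one_pos fun N hN => ?_)
    refine (hcut one_pos hN hψ.pos hψ.cont).trans ?_
    have h1 := hC _ (hone one_pos hN) (cutoff_nonneg 1 N) (cutoff_le_one 1 N)
    rw [hw1, zero_mul, add_zero, abs_mul] at h1
    rw [le_div_iff₀ hpos]
    nlinarith [mul_le_mul_of_nonneg_left
      (le_abs_self (∫ y in Ioi 0, ψ y * cutoff 1 N y * m y)) hpos.le]
  have := hDk k hk
  rw [hw0, hw1, zero_mul, zero_mul, add_zero] at this
  exact sub_eq_zero.1 this

/-- If `ν` agrees with the Green measure on test functions, it does so on all `ν`-integrable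
functions that are continuous on `(0, ∞)`. -/
theorem integral_eq_greenInt_of_integrable [IsFiniteMeasure ν] (hD : Densities S m)
    (hψ : IncSol S m r ψ Ψ) (hφ : DecSol S m r φ Φ) (hBpos : 0 < B) (hν0 : ∀ᵐ y ∂ν, 0 < y)
    (hx : 0 < x) (hν : ∀ k ∈ testFun, ∫ y, k y ∂ν = greenInt m ψ φ B x k)
    {f : ℝ → ℝ} (hf : ContinuousOn f (Ioi 0)) (hfi : Integrable f ν) :
    IntegrableOn (fun y => ψ y * f y * m y) (Ioc 0 x) ∧
    IntegrableOn (fun y => φ y * f y * m y) (Ioi x) ∧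
    ∫ y, f y ∂ν = greenInt m ψ φ B x f := by
  have hcψ : ContinuousOn (fun y => ψ y * f y * m y) (Ioi 0) :=
    (hψ.cont.fun_mul hf).fun_mul hD.speed_cont
  have hcφ : ContinuousOn (fun y => φ y * f y * m y) (Ioi 0) :=
    (hφ.cont.fun_mul hf).fun_mul hD.speed_cont
  have hbound : ∀ {a b : ℝ}, 0 < a → a ≤ b →
      greenInt m ψ φ B x (fun y => cutoff a b y * |f y|) ≤ ∫ y, |f y| ∂ν := by
    intro a b ha hab
    rw [← hν _ (cutoff_mul_mem hf.abs ha hab)]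
    refine integral_mono_of_nonneg (ae_of_all _ fun y => mul_nonneg (cutoff_nonneg a b y)
      (abs_nonneg _)) hfi.abs (ae_of_all _ fun y => ?_)
    exact mul_le_of_le_one_left (abs_nonneg _) (cutoff_le_one a b y)
  have habs : ∀ {v : ℝ → ℝ}, (∀ y, 0 < y → 0 < v y) → ∀ y, 0 < y →
      |v y * f y * m y| = v y * |f y| * m y := fun {v} hv y hy => by
    rw [abs_mul, abs_mul, abs_of_pos (hv y hy), abs_of_pos (hD.speed_pos y hy)]
  have hnn : ∀ {v : ℝ → ℝ} {a b : ℝ}, (∀ y, 0 < y → 0 < v y) → ∀ y, 0 < y →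
      0 ≤ v y * (cutoff a b y * |f y|) * m y := fun {v a b} hv y hy =>
    mul_nonneg (mul_nonneg (hv y hy).le (mul_nonneg (cutoff_nonneg a b y) (abs_nonneg _)))
      (hD.speed_pos y hy).le
  have hpart : ∀ {v : ℝ → ℝ} {a b : ℝ} {t : Set ℝ}, 0 < a → a ≤ b → (∀ y, 0 < y → 0 < v y) →
      ContinuousOn v (Ioi 0) → MeasurableSet t → t ⊆ Ioi 0 → Ioc a b ⊆ t →
      ∫ y in Ioc a b, |v y * f y * m y| ≤ ∫ y in t, v y * (cutoff a b y * |f y|) * m y := by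
    intro v a b t ha hab hv hvc ht ht0 hsub
    have h1 := integrableOn_mul_testFun hvc hD.speed_cont (cutoff_mul_mem hf.abs ha hab) t ht
    have h2 : ∫ y in Ioc a b, |v y * f y * m y| =
        ∫ y in Ioc a b, v y * (cutoff a b y * |f y|) * m y :=
      setIntegral_congr_fun measurableSet_Ioc fun y hy => by
        simp only [habs hv y (ha.trans hy.1), cutoff_eq_one ha ⟨hy.1.le, hy.2⟩, one_mul]
    rw [h2]
    exact setIntegral_mono_set h1 ((ae_restrict_mem ht).mono fun y hy => hnn hv y (ht0 hy))
      (LE.le.eventuallyLE hsub)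
  -- The Green functional of a truncated `|f|` is at most `∫ |f| dν`; dropping its other nonnegative
  -- term leaves a bound uniform in `ε`.
  have hIψ : IntegrableOn (fun y => ψ y * f y * m y) (Ioc 0 x) := by
    have h1 : IntegrableOn (fun y => |ψ y * f y * m y|) (Ioc 0 x) := by
      refine integrableOn_Ioc_of_bounded (C := B * (∫ y, |f y| ∂ν) / φ x) hcψ.abs
        (fun _ _ => abs_nonneg _) hx fun ε hε hεx => ?_
      rw [le_div_iff₀ (hφ.pos x hx)]
      have h2 := hbound hε hεx
      rw [greenInt, div_le_iff₀ hBpos] at h2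
      have h3 := hpart hε hεx hψ.pos hψ.cont measurableSet_Ioc Ioc_subset_Ioi_self
        (Ioc_subset_Ioc_left hε.le)
      have h4 : 0 ≤ ∫ y in Ioi x, φ y * (cutoff ε x y * |f y|) * m y :=
        setIntegral_nonneg measurableSet_Ioi fun y hy => hnn hφ.pos y (hx.trans hy)
      nlinarith [mul_le_mul_of_nonneg_left h3 (hφ.pos x hx).le,
        mul_nonneg (hψ.pos x hx).le h4]
    exact (integrable_norm_iff ((hcψ.mono Ioc_subset_Ioi_self).aestronglyMeasurable
      measurableSet_Ioc)).1 h1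
  have hIφ : IntegrableOn (fun y => φ y * f y * m y) (Ioi x) := by
    have h1 : IntegrableOn (fun y => |φ y * f y * m y|) (Ioi x) := by
      refine integrableOn_Ioi_of_bounded (C := B * (∫ y, |f y| ∂ν) / ψ x) hcφ.abs
        (fun _ _ => abs_nonneg _) hx fun N hN => ?_
      rw [le_div_iff₀ (hψ.pos x hx)]
      have h2 := hbound hx hN
      rw [greenInt, div_le_iff₀ hBpos] at h2
      have h3 := hpart hx hN hφ.pos hφ.cont measurableSet_Ioi (Ioi_subset_Ioi hx.le)
        Ioc_subset_Ioi_self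
      have h4 : 0 ≤ ∫ y in Ioc 0 x, ψ y * (cutoff x N y * |f y|) * m y :=
        setIntegral_nonneg measurableSet_Ioc fun y hy => hnn hψ.pos y hy.1
      nlinarith [mul_le_mul_of_nonneg_left h3 (hψ.pos x hx).le,
        mul_nonneg (hφ.pos x hx).le h4]
    exact (integrable_norm_iff ((hcφ.mono (Ioi_subset_Ioi hx.le)).aestronglyMeasurable
      measurableSet_Ioi)).1 h1
  refine ⟨hIψ, hIφ, ?_⟩
  set χ : ℕ → ℝ → ℝ := fun n => cutoff (1 / ((n : ℝ) + 1)) ((n : ℝ) + 1) with hχ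
  have hapos : ∀ n : ℕ, (0 : ℝ) < 1 / ((n : ℝ) + 1) := fun n => by positivity
  have hab : ∀ n : ℕ, 1 / ((n : ℝ) + 1) ≤ (n : ℝ) + 1 := fun n => by
    have h : (1 : ℝ) ≤ (n : ℝ) + 1 := by linarith [Nat.cast_nonneg (α := ℝ) n]
    exact (div_le_one_of_le₀ h (by linarith)).trans h
  have hχ1 : ∀ y, 0 < y → ∀ᶠ n in atTop, χ n y = 1 := by
    intro y hy
    have h1 : ∀ᶠ n : ℕ in atTop, 1 / ((n : ℝ) + 1) < y :=
      tendsto_one_div_add_atTop_nhds_zero_nat.eventually_lt_const hy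
    have h2 : ∀ᶠ n : ℕ in atTop, y ≤ (n : ℝ) + 1 :=
      (tendsto_atTop_add_const_right _ _ tendsto_natCast_atTop_atTop).eventually_ge_atTop y
    filter_upwards [h1, h2] with n h1 h2 using cutoff_eq_one (hapos n) ⟨h1.le, h2⟩
  have hlim : ∀ (v : ℝ → ℝ) (t : Set ℝ), MeasurableSet t → t ⊆ Ioi 0 → ContinuousOn v (Ioi 0) →
      IntegrableOn (fun y => v y * f y * m y) t →
      Tendsto (fun n => ∫ y in t, v y * (χ n y * f y) * m y) atTop
        (𝓝 (∫ y in t, v y * f y * m y)) := by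
    intro v t ht ht0 hvc hint
    refine tendsto_integral_of_dominated_convergence (fun y => |v y * f y * m y|)
      (fun n => ?_) hint.abs (fun n => ?_) ?_
    · exact ((integrableOn_mul_testFun hvc hD.speed_cont
        (cutoff_mul_mem hf (hapos n) (hab n)) t ht)).aestronglyMeasurable
    · refine ae_of_all _ fun y => ?_
      have h1 : v y * (χ n y * f y) * m y = χ n y * (v y * f y * m y) := by ring
      rw [h1, Real.norm_eq_abs, abs_mul, abs_of_nonneg (cutoff_nonneg _ _ _)]
      exact mul_le_of_le_one_left (abs_nonneg _) (cutoff_le_one _ _ _)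
    · refine (ae_restrict_mem ht).mono fun y hy => tendsto_const_nhds.congr' ?_
      filter_upwards [hχ1 y (ht0 hy)] with n hn
      rw [hn, one_mul]
  have hL : Tendsto (fun n => ∫ y, χ n y * f y ∂ν) atTop (𝓝 (∫ y, f y ∂ν)) := by
    refine tendsto_integral_of_dominated_convergence (fun y => |f y|)
      (fun n => (continuous_cutoff _ _).aestronglyMeasurable.mul hfi.aestronglyMeasurable)
      hfi.abs (fun n => ae_of_all _ fun y => ?_) ?_
    · rw [Real.norm_eq_abs, abs_mul, abs_of_nonneg (cutoff_nonneg _ _ _)]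
      exact mul_le_of_le_one_left (abs_nonneg _) (cutoff_le_one _ _ _)
    · refine hν0.mono fun y hy => tendsto_const_nhds.congr' ?_
      filter_upwards [hχ1 y hy] with n hn
      rw [hn, one_mul]
  have hR : Tendsto (fun n => greenInt m ψ φ B x (fun y => χ n y * f y)) atTop
      (𝓝 (greenInt m ψ φ B x f)) :=
    (((hlim ψ _ measurableSet_Ioc Ioc_subset_Ioi_self hψ.cont hIψ).const_mul (φ x)).add
      ((hlim φ _ measurableSet_Ioi (Ioi_subset_Ioi hx.le) hφ.cont hIφ).const_mul
        (ψ x))).div_const B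
  refine tendsto_nhds_unique hL (hR.congr fun n => ?_)
  exact (hν _ (cutoff_mul_mem hf (hapos n) (hab n))).symm

end Representation

/-! ### The resolvent measure of the diffusion and its equation. -/

/-- The measure `e^{-rt} dt` on `(0, ∞)`. -/
noncomputable def discount (r : ℝ) : Measure ℝ :=
  (volume.restrict (Ioi 0)).withDensity fun t => ENNReal.ofReal (Real.exp (-r * t))

theorem measurable_discount_density (r : ℝ) :
    Measurable fun t : ℝ => ENNReal.ofReal (Real.exp (-r * t)) := by
  fun_prop

theorem integrableOn_exp {r : ℝ} (hr : 0 < r) :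
    IntegrableOn (fun t : ℝ => Real.exp (-r * t)) (Ioi 0) :=
  integrableOn_exp_mul_Ioi (neg_neg_of_pos hr) 0

theorem isFiniteMeasure_discount {r : ℝ} (hr : 0 < r) : IsFiniteMeasure (discount r) :=
  isFiniteMeasure_withDensity_ofReal (integrableOn_exp hr).2

theorem integral_discount (r : ℝ) (f : ℝ → ℝ) :
    ∫ t, f t ∂(discount r) = ∫ t in Ioi 0, Real.exp (-r * t) * f t := by
  rw [discount, integral_withDensity_eq_integral_toReal_smul (measurable_discount_density r)
    (ae_of_all _ fun _ => ENNReal.ofReal_lt_top)]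
  refine integral_congr_ae (ae_of_all _ fun t => ?_)
  simp only [ENNReal.toReal_ofReal (Real.exp_pos _).le, smul_eq_mul]

theorem integrable_discount_iff (r : ℝ) (f : ℝ → ℝ) :
    Integrable f (discount r) ↔ IntegrableOn (fun t => Real.exp (-r * t) * f t) (Ioi 0) := by
  rw [discount, integrable_withDensity_iff_integrable_smul' (measurable_discount_density r)
    (ae_of_all _ fun _ => ENNReal.ofReal_lt_top)]
  simp only [ENNReal.toReal_ofReal (Real.exp_pos _).le, smul_eq_mul, IntegrableOn]

/-- Integration by parts; the primitive grows at most linearly, so the boundary term at `∞`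
vanishes. -/
theorem integral_exp_mul_primitive {r C : ℝ} (hr : 0 < r) {h : ℝ → ℝ} (hh : Continuous h)
    (hC : ∀ t, |h t| ≤ C) :
    ∫ t in Ioi 0, Real.exp (-r * t) * (r * ∫ s in (0 : ℝ)..t, h s) =
      ∫ t in Ioi 0, Real.exp (-r * t) * h t := by
  set Φ : ℝ → ℝ := fun t => ∫ s in (0 : ℝ)..t, h s with hΦ
  have hd : ∀ t, HasDerivAt Φ (h t) t := fun t => hh.integral_hasStrictDerivAt 0 t |>.hasDerivAt
  have hΦb : ∀ t, 0 < t → |Φ t| ≤ C * t := fun t ht => by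
    have := intervalIntegral.norm_integral_le_of_norm_le_const (a := 0) (b := t) (f := h)
      fun s _ => hC s
    rwa [sub_zero, abs_of_pos ht] at this
  have hΦc : Continuous Φ := continuous_iff_continuousAt.2 fun t => (hd t).continuousAt
  have h1 : IntegrableOn (fun t => Real.exp (-r * t) * h t) (Ioi 0) := by
    refine ((integrableOn_exp hr).mul_const C).mono'
      (Continuous.aestronglyMeasurable (by fun_prop)) (ae_of_all _ fun t => ?_)
    rw [Real.norm_eq_abs, abs_mul, abs_of_pos (Real.exp_pos _)]
    exact mul_le_mul_of_nonneg_left (hC t) (Real.exp_pos _).le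
  have hte : IntegrableOn (fun t : ℝ => t * Real.exp (-r * t)) (Ioi 0) := by
    have := integrableOn_rpow_mul_exp_neg_mul_rpow (s := 1) (p := 1) (b := r) (by norm_num)
      one_pos hr
    simpa using this
  have h2 : IntegrableOn (fun t => Real.exp (-r * t) * (r * Φ t)) (Ioi 0) := by
    refine (hte.const_mul (r * C)).mono' (Continuous.aestronglyMeasurable (by fun_prop))
      ((ae_restrict_mem measurableSet_Ioi).mono fun t ht => ?_)
    rw [Real.norm_eq_abs, abs_mul, abs_mul, abs_of_pos (Real.exp_pos _), abs_of_pos hr]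
    have := mul_le_mul_of_nonneg_left (hΦb t ht) (mul_pos (Real.exp_pos (-r * t)) hr).le
    linarith
  have hlim : Tendsto (fun t => Real.exp (-r * t) * Φ t) atTop (𝓝 0) := by
    have h3 : Tendsto (fun t : ℝ => C * (t * Real.exp (-r * t))) atTop (𝓝 0) := by
      have := (Real.tendsto_pow_mul_exp_neg_atTop_nhds_zero 1).comp
        (tendsto_id.const_mul_atTop hr)
      have h4 := (this.const_mul (C / r))
      rw [mul_zero] at h4
      refine h4.congr fun t => ?_
      simp only [Function.comp, id, pow_one]
      rw [neg_mul]
      field_simp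
    refine squeeze_zero_norm' ?_ h3
    filter_upwards [eventually_gt_atTop 0] with t ht
    rw [Real.norm_eq_abs, abs_mul, abs_of_pos (Real.exp_pos _)]
    nlinarith [mul_le_mul_of_nonneg_left (hΦb t ht) (Real.exp_pos (-r * t)).le]
  have hder : ∀ t ∈ Ioi (0 : ℝ), HasDerivAt (fun t => Real.exp (-r * t) * Φ t)
      (Real.exp (-r * t) * h t - Real.exp (-r * t) * (r * Φ t)) t := by
    intro t _
    have he : HasDerivAt (fun t : ℝ => Real.exp (-r * t)) (Real.exp (-r * t) * (-r)) t := by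
      simpa using ((hasDerivAt_id t).const_mul (-r)).exp
    exact (he.fun_mul (hd t)).congr_deriv (by ring)
  have h5 := integral_Ioi_of_hasDerivAt_of_tendsto
    (Continuous.continuousWithinAt (by fun_prop)) hder (h1.sub h2) hlim
  rw [integral_sub h1 h2] at h5
  simp only [hΦ, intervalIntegral.integral_same, mul_zero, sub_zero] at h5
  exact (sub_eq_zero.1 h5).symm

section Discounted

variable {Ω : Type*} [mΩ : MeasurableSpace Ω] {μ σ : ℝ → ℝ} {𝓕 : Filtration ℝ≥0 mΩ}
  {X : ℝ≥0 → Ω → ℝ} {P : Measure Ω} {x r : ℝ}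

/-- The resolvent measure `E ∫₀^∞ e^{-rt} 1(X_t ∈ dy) dt`. -/
noncomputable def resolventMeasure (X : ℝ≥0 → Ω → ℝ) (P : Measure Ω) (r : ℝ) : Measure ℝ :=
  (P.prod (discount r)).map fun z => X z.2.toNNReal z.1

theorem IsDiffusionFrom.measurable_process (hX : IsDiffusionFrom μ σ 𝓕 X P x) :
    Measurable fun z : Ω × ℝ => X z.2.toNNReal z.1 := by
  have h1 : Measurable (Function.uncurry X) :=
    measurable_uncurry_of_continuous_of_measurable hX.continuous_paths
      fun t => (hX.adapted t).mono (𝓕.le t) le_rfl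
  exact h1.comp ((measurable_real_toNNReal.comp measurable_snd).prodMk measurable_fst)

theorem resolventMeasure_pos (hX : IsDiffusionFrom μ σ 𝓕 X P x) :
    ∀ᵐ y ∂(resolventMeasure X P r), 0 < y := by
  rw [resolventMeasure, ae_map_iff hX.measurable_process.aemeasurable measurableSet_Ioi]
  exact ae_of_all _ fun z => hX.pos _ _

theorem aestronglyMeasurable_of_continuousOn {ν : Measure ℝ} (hν : ∀ᵐ y ∂ν, 0 < y) {f : ℝ → ℝ}
    (hf : ContinuousOn f (Ioi 0)) : AEStronglyMeasurable f ν := by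
  have h1 : ν.restrict (Ioi 0) = ν := Measure.restrict_eq_self_of_ae_mem hν
  rw [← h1]
  exact hf.aestronglyMeasurable measurableSet_Ioi

theorem integrable_resolventMeasure_iff (hX : IsDiffusionFrom μ σ 𝓕 X P x) {f : ℝ → ℝ}
    (hf : ContinuousOn f (Ioi 0)) : Integrable f (resolventMeasure X P r) ↔
      Integrable (fun z : Ω × ℝ => f (X z.2.toNNReal z.1)) (P.prod (discount r)) :=
  integrable_map_measure (aestronglyMeasurable_of_continuousOn (resolventMeasure_pos hX) hf)
    hX.measurable_process.aemeasurable

theorem integral_resolventMeasure (hr : 0 < r) (hX : IsDiffusionFrom μ σ 𝓕 X P x) {f : ℝ → ℝ}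
    (hf : ContinuousOn f (Ioi 0)) (hi : Integrable f (resolventMeasure X P r)) :
    ∫ y, f y ∂(resolventMeasure X P r) =
      ∫ ω, (∫ t in Ioi (0 : ℝ), Real.exp (-r * t) * f (X t.toNNReal ω)) ∂P := by
  have := hX.isProbabilityMeasure
  have := isFiniteMeasure_discount hr
  rw [resolventMeasure, integral_map hX.measurable_process.aemeasurable
    (aestronglyMeasurable_of_continuousOn (resolventMeasure_pos hX) hf),
    integral_prod _ ((integrable_resolventMeasure_iff hX hf).1 hi)]
  exact integral_congr_ae (ae_of_all _ fun ω => integral_discount r _)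

theorem integrable_resolventMeasure (hr : 0 < r) (hX : IsDiffusionFrom μ σ 𝓕 X P x) {f : ℝ → ℝ}
    (hf : ContinuousOn f (Ioi 0))
    (hfin : ∫⁻ ω, (∫⁻ t in Ioi (0 : ℝ),
      ENNReal.ofReal (Real.exp (-r * t) * |f (X t.toNNReal ω)|)) ∂P < ∞) :
    Integrable f (resolventMeasure X P r) := by
  have := hX.isProbabilityMeasure
  have := isFiniteMeasure_discount hr
  have hm := aestronglyMeasurable_of_continuousOn (resolventMeasure_pos (r := r) hX) hf
  rw [integrable_resolventMeasure_iff hX hf]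
  have hm' : AEStronglyMeasurable (fun z : Ω × ℝ => f (X z.2.toNNReal z.1))
      (P.prod (discount r)) := hm.comp_measurable hX.measurable_process
  refine ⟨hm', ?_⟩
  rw [hasFiniteIntegral_iff_enorm, lintegral_prod _ hm'.enorm]
  refine lt_of_eq_of_lt (lintegral_congr fun ω => ?_) hfin
  have hpath : Measurable fun t : ℝ => ‖f (X t.toNNReal ω)‖ₑ := by
    have hc : Continuous fun t : ℝ => f (X t.toNNReal ω) :=
      hf.comp_continuous ((hX.continuous_paths ω).comp continuous_real_toNNReal)
        fun t => hX.pos _ _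
    exact hc.measurable.enorm
  rw [discount, lintegral_withDensity_eq_lintegral_mul _ (measurable_discount_density r) hpath]
  refine lintegral_congr fun t => ?_
  simp only [Pi.mul_apply]
  rw [ENNReal.ofReal_mul (Real.exp_pos _).le, Real.enorm_eq_ofReal_abs]

/-- The resolvent equation tested against smooth compactly supported functions. -/
theorem integral_resolvent_equation (hr : 0 < r) (hX : IsDiffusionFrom μ σ 𝓕 X P x)
    (hσc : ContinuousOn σ (Ioi 0)) (hμc : ContinuousOn μ (Ioi 0))
    {f : ℝ → ℝ} (hf : ContDiff ℝ 2 f) (hfc : HasCompactSupport f) (hfs : tsupport f ⊆ Ioi 0) :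
    ∫ y, (r * f y - generator μ σ f y) ∂(resolventMeasure X P r) = f x := by
  have := hX.isProbabilityMeasure
  have := isFiniteMeasure_discount hr
  have hd1 : Continuous (deriv f) := hf.continuous_deriv (by norm_num)
  have hd2 : Continuous (deriv (deriv f)) := by
    rw [show (2 : WithTop ℕ∞) = 1 + 1 from rfl, contDiff_succ_iff_deriv] at hf
    exact hf.2.2.continuous_deriv le_rfl
  set h := generator μ σ f with hh
  have hh0 : ∀ y, y ∉ tsupport f → h y = 0 := by
    intro y hy
    have h1 : y ∉ tsupport (deriv f) := fun h => hy (tsupport_deriv_subset h)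
    have h2 : y ∉ tsupport (deriv (deriv f)) := fun h => h1 (tsupport_deriv_subset h)
    simp only [hh, generator, image_eq_zero_of_notMem_tsupport h1,
      image_eq_zero_of_notMem_tsupport h2, mul_zero, add_zero]
  have hhcont : ContinuousOn h (Ioi 0) :=
    (hμc.fun_mul hd1.continuousOn).add (((hσc.pow 2).div_const 2).mul hd2.continuousOn)
  have hhc : Continuous h := by
    refine continuous_iff_continuousAt.2 fun y => ?_
    by_cases hy : y ∈ tsupport f
    · exact hhcont.continuousAt (Ioi_mem_nhds (hfs hy))
    · refine (continuousAt_const (y := (0 : ℝ))).congr ?_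
      filter_upwards [(isClosed_tsupport f).isOpen_compl.mem_nhds hy] with z hz
        using (hh0 z hz).symm
  obtain ⟨C, hC⟩ := (HasCompactSupport.intro (f := h) hfc.isCompact
    hh0).exists_bound_of_continuous hhc
  obtain ⟨A, hA⟩ := hfc.exists_bound_of_continuous hf.continuous
  have hmart := hX.martingale f hf hfc hfs
  set M : ℝ≥0 → Ω → ℝ := fun t ω =>
    f (X t ω) - ∫ s in (0 : ℝ)..(t : ℝ), h (X s.toNNReal ω) with hM
  have hpathc : ∀ ω, Continuous fun t : ℝ => X t.toNNReal ω := fun ω =>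
    (hX.continuous_paths ω).comp continuous_real_toNNReal
  have hprim : ∀ ω, Continuous fun t : ℝ => ∫ s in (0 : ℝ)..t, h (X s.toNNReal ω) := fun ω =>
    intervalIntegral.continuous_primitive
      (fun a b => (hhc.comp (hpathc ω)).intervalIntegrable a b) 0
  have hMc : ∀ ω, Continuous fun t => M t ω := fun ω =>
    (hf.continuous.comp (hX.continuous_paths ω)).sub ((hprim ω).comp NNReal.continuous_coe)
  have hMm : ∀ t, Measurable (M t) := fun t =>
    ((hmart.1 t).mono (𝓕.le t)).measurable
  have hMj : Measurable fun z : Ω × ℝ => M z.2.toNNReal z.1 :=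
    (measurable_uncurry_of_continuous_of_measurable hMc hMm).comp
      ((measurable_real_toNNReal.comp measurable_snd).prodMk measurable_fst)
  -- The expectation of the martingale is constant, and at time `0` it is `f x`.
  have hEM : ∀ t, ∫ ω, M t ω ∂P = f x := by
    intro t
    have h1 := hmart.setIntegral_eq (zero_le (a := t)) MeasurableSet.univ
    rw [setIntegral_univ, setIntegral_univ] at h1
    rw [← h1]
    have h2 : ∀ᵐ ω ∂P, f (X 0 ω) - ∫ s in (0 : ℝ)..((0 : ℝ≥0) : ℝ), h (X s.toNNReal ω) = f x := by
      filter_upwards [hX.start] with ω hω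
      simp [hω]
    rw [integral_congr_ae h2]
    simp
  have hMb : ∀ (t : ℝ) (ω : Ω), 0 < t → |M t.toNNReal ω| ≤ A + C * t := by
    intro t ω ht
    have h1 := intervalIntegral.norm_integral_le_of_norm_le_const (a := 0) (b := t)
      (f := fun s => h (X s.toNNReal ω)) fun s _ => hC _
    rw [sub_zero, abs_of_pos ht] at h1
    simp only [hM, Real.coe_toNNReal t ht.le]
    exact (abs_sub _ _).trans (add_le_add (hA _) h1)
  have hbound : Integrable (fun t => A + C * t) (discount r) := by
    rw [integrable_discount_iff]
    have hte : IntegrableOn (fun t : ℝ => t * Real.exp (-r * t)) (Ioi 0) := by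
      have := integrableOn_rpow_mul_exp_neg_mul_rpow (s := 1) (p := 1) (b := r) (by norm_num)
        one_pos hr
      simpa using this
    refine IntegrableOn.congr_fun (((integrableOn_exp hr).const_mul A).add (hte.const_mul C))
      (fun t _ => ?_) measurableSet_Ioi
    simp only [Pi.add_apply]
    ring
  have hdpos : ∀ᵐ t ∂(discount r), 0 < t :=
    (withDensity_absolutelyContinuous _ _).ae_le (ae_restrict_mem measurableSet_Ioi)
  have hMi : Integrable (fun z : Ω × ℝ => M z.2.toNNReal z.1) (P.prod (discount r)) := by
    refine (hbound.comp_snd P).mono' hMj.aestronglyMeasurable ?_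
    have h1 : ∀ᵐ z ∂(P.prod (discount r)), 0 < z.2 :=
      Measure.quasiMeasurePreserving_snd.ae hdpos
    filter_upwards [h1] with z hz using hMb z.2 z.1 hz
  have hrate : ∫ t in Ioi (0 : ℝ), Real.exp (-r * t) = 1 / r := by
    rw [integral_exp_mul_Ioi (neg_neg_of_pos hr) 0]
    simp
  have h1 : ∫ ω, (∫ t, M t.toNNReal ω ∂(discount r)) ∂P = f x / r := by
    rw [integral_integral_swap (f := fun ω (t : ℝ) => M t.toNNReal ω) hMi]
    simp only [hEM]
    rw [integral_discount, integral_mul_const, hrate]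
    ring
  have hki : Integrable (fun y => r * f y - h y) (resolventMeasure X P r) := by
    have : IsFiniteMeasure (resolventMeasure X P r) := by
      unfold resolventMeasure
      infer_instance
    exact ((hf.continuous.integrable_of_hasCompactSupport hfc).const_mul r).sub
      (hhc.integrable_of_hasCompactSupport (HasCompactSupport.intro hfc.isCompact hh0))
  rw [integral_resolventMeasure (f := fun y => r * f y - h y) hr hX
    ((hf.continuous.continuousOn.const_smul r).sub hhcont) hki]
  -- Pathwise, integration by parts replaces the discounted integral of `h` by `r` times that of its
  -- time primitive, so that `r M` appears.
  have h2 : ∀ ω, ∫ t in Ioi (0 : ℝ), Real.exp (-r * t) *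
      (r * f (X t.toNNReal ω) - h (X t.toNNReal ω)) =
      r * ∫ t, M t.toNNReal ω ∂(discount r) := by
    intro ω
    have hhp : Continuous fun t : ℝ => h (X t.toNNReal ω) := hhc.comp (hpathc ω)
    have hfp : Continuous fun t : ℝ => f (X t.toNNReal ω) := hf.continuous.comp (hpathc ω)
    have hexp : Continuous fun t : ℝ => Real.exp (-r * t) := by fun_prop
    have hif : IntegrableOn (fun t => Real.exp (-r * t) * (r * f (X t.toNNReal ω))) (Ioi 0) := by
      refine ((integrableOn_exp hr).mul_const (r * A)).mono'
        (hexp.mul (continuous_const.mul hfp)).aestronglyMeasurable (ae_of_all _ fun t => ?_)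
      rw [Real.norm_eq_abs, abs_mul, abs_of_pos (Real.exp_pos _), abs_mul, abs_of_pos hr]
      exact mul_le_mul_of_nonneg_left (mul_le_mul_of_nonneg_left (hA _) hr.le)
        (Real.exp_pos _).le
    have hih : IntegrableOn (fun t => Real.exp (-r * t) * h (X t.toNNReal ω)) (Ioi 0) := by
      refine ((integrableOn_exp hr).mul_const C).mono'
        (hexp.mul hhp).aestronglyMeasurable (ae_of_all _ fun t => ?_)
      rw [Real.norm_eq_abs, abs_mul, abs_of_pos (Real.exp_pos _)]
      exact mul_le_mul_of_nonneg_left (hC _) (Real.exp_pos _).le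
    have hΦc := hprim ω
    have hip : IntegrableOn (fun t => Real.exp (-r * t) *
        (r * ∫ s in (0 : ℝ)..t, h (X s.toNNReal ω))) (Ioi 0) := by
      have h3 : Integrable (fun t : ℝ => C * t) (discount r) := by
        have := hbound.sub (integrable_const A)
        refine this.congr (ae_of_all _ fun t => ?_)
        simp
      have h4 := (integrable_discount_iff r _).1 (h3.const_mul r)
      refine h4.mono' (Continuous.aestronglyMeasurable (by fun_prop))
        ((ae_restrict_mem measurableSet_Ioi).mono fun t ht => ?_)
      have ht : 0 < t := ht
      have h1 := intervalIntegral.norm_integral_le_of_norm_le_const (a := 0) (b := t)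
        (f := fun s => h (X s.toNNReal ω)) fun s _ => hC _
      rw [sub_zero, abs_of_pos ht] at h1
      rw [Real.norm_eq_abs, abs_mul, abs_of_pos (Real.exp_pos _), abs_mul, abs_of_pos hr]
      exact mul_le_mul_of_nonneg_left (mul_le_mul_of_nonneg_left h1 hr.le) (Real.exp_pos _).le
    have h3 := integral_exp_mul_primitive hr hhp fun t => hC _
    rw [integral_discount, ← integral_const_mul]
    calc ∫ t in Ioi (0 : ℝ), Real.exp (-r * t) *
          (r * f (X t.toNNReal ω) - h (X t.toNNReal ω))
        = (∫ t in Ioi (0 : ℝ), Real.exp (-r * t) * (r * f (X t.toNNReal ω))) -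
          ∫ t in Ioi (0 : ℝ), Real.exp (-r * t) * h (X t.toNNReal ω) := by
          rw [← integral_sub hif hih]
          refine integral_congr_ae (ae_of_all _ fun t => ?_)
          simp only
          ring
      _ = ∫ t in Ioi (0 : ℝ), r * (Real.exp (-r * t) * M t.toNNReal ω) := by
          rw [← h3, ← integral_sub hif hip]
          refine setIntegral_congr_fun measurableSet_Ioi fun t ht => ?_
          have ht : 0 < t := ht
          simp only [hM, Real.coe_toNNReal t ht.le]
          ring
  simp only [h2]
  rw [integral_const_mul, h1]
  field_simp

end Discounted

/-! ### From the generator equation to densities and fluxes. -/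

section Conversion

variable {μ σ : ℝ → ℝ}

theorem scaleDensity_pos (μ σ : ℝ → ℝ) (x : ℝ) : 0 < scaleDensity μ σ x := Real.exp_pos _

theorem hasDerivAt_scaleDensity (hσ : ContinuousOn σ (Ioi 0)) (hσ_pos : ∀ x, 0 < x → 0 < σ x)
    (hμ : ContinuousOn μ (Ioi 0)) {x : ℝ} (hx : 0 < x) :
    HasDerivAt (scaleDensity μ σ) (-(2 * μ x / σ x ^ 2) * scaleDensity μ σ x) x := by
  have hc : ContinuousOn (fun z => 2 * μ z / σ z ^ 2) (Ioi 0) :=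
    (continuousOn_const.fun_mul hμ).div (hσ.pow 2) fun y hy => (pow_pos (hσ_pos y hy) 2).ne'
  have h1 := (intervalIntegral.integral_hasDerivAt_right
    (intervalIntegrable_of_continuousOn hc one_pos hx)
    (hc.stronglyMeasurableAtFilter isOpen_Ioi x hx)
    (hc.continuousAt (Ioi_mem_nhds hx))).fun_neg.exp
  exact h1.congr_deriv (by rw [scaleDensity]; ring)

theorem densities (hσ : ContinuousOn σ (Ioi 0)) (hσ_pos : ∀ x, 0 < x → 0 < σ x)
    (hμ : ContinuousOn μ (Ioi 0)) : Densities (scaleDensity μ σ) (speedDensity μ σ) := by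
  have hS : ContinuousOn (scaleDensity μ σ) (Ioi 0) :=
    continuousOn_of_hasDerivAt fun x hx => hasDerivAt_scaleDensity hσ hσ_pos hμ hx
  have hpos : ∀ x, 0 < x → 0 < σ x ^ 2 * scaleDensity μ σ x := fun x hx =>
    mul_pos (pow_pos (hσ_pos x hx) 2) (scaleDensity_pos μ σ x)
  exact ⟨hS, fun x _ => scaleDensity_pos μ σ x,
    continuousOn_const.div ((hσ.pow 2).fun_mul hS) fun x hx => (hpos x hx).ne',
    fun x hx => div_pos two_pos (hpos x hx)⟩

theorem NaturalBoundaries.atZero (h : NaturalBoundaries μ σ) :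
    NaturalAtZero (scaleDensity μ σ) (speedDensity μ σ) :=
  ⟨fun hi => (Integrable.lintegral_lt_top hi).ne h.zero_not_exit,
    fun hi => (Integrable.lintegral_lt_top hi).ne h.zero_not_entrance⟩

theorem NaturalBoundaries.atInfty (h : NaturalBoundaries μ σ) :
    NaturalAtInfty (scaleDensity μ σ) (speedDensity μ σ) :=
  ⟨fun hi => (Integrable.lintegral_lt_top hi).ne h.infty_not_exit,
    fun hi => (Integrable.lintegral_lt_top hi).ne h.infty_not_entrance⟩

theorem IsPositiveSolution.hasFlux {s : ℝ} {f : ℝ → ℝ} (hf : IsPositiveSolution μ σ s f)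
    (hσ : ContinuousOn σ (Ioi 0)) (hσ_pos : ∀ x, 0 < x → 0 < σ x) (hμ : ContinuousOn μ (Ioi 0)) :
    HasFlux (scaleDensity μ σ) (speedDensity μ σ) (fun x => s * f x) f
      (fun x => deriv f x / scaleDensity μ σ x) := by
  have hd : ContDiffOn ℝ 1 (deriv f) (Ioi 0) :=
    hf.contDiffOn.deriv_of_isOpen isOpen_Ioi (by norm_num)
  constructor
  · intro x hx
    have h1 := ((hf.contDiffOn.differentiableOn (by norm_num)).differentiableAt
      (Ioi_mem_nhds hx)).hasDerivAt
    exact h1.congr_deriv (by rw [mul_div_cancel₀ _ (scaleDensity_pos μ σ x).ne'])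
  · intro x hx
    have h1 := ((hd.differentiableOn (by norm_num)).differentiableAt
      (Ioi_mem_nhds hx)).hasDerivAt
    have h2 := hasDerivAt_scaleDensity hσ hσ_pos hμ hx
    have hS := (scaleDensity_pos μ σ x).ne'
    have hσx := (hσ_pos x hx).ne'
    have h3 := hf.eqn x hx
    rw [generator] at h3
    refine (h1.fun_div h2 hS).congr_deriv ?_
    rw [speedDensity]
    field_simp
    linear_combination 2 * h3

/-- Monotonicity gives only a nonnegative flux. As the flux is strictly increasing, comparison with
`x / 2` makes it positive; in the decreasing case the comparison point is `x + 1`. -/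
theorem IsIncreasingFundamental.incSol {s : ℝ} (hs : 0 < s) {f : ℝ → ℝ}
    (hf : IsIncreasingFundamental μ σ s f) (hσ : ContinuousOn σ (Ioi 0))
    (hσ_pos : ∀ x, 0 < x → 0 < σ x) (hμ : ContinuousOn μ (Ioi 0)) :
    IncSol (scaleDensity μ σ) (speedDensity μ σ) s f
      (fun x => deriv f x / scaleDensity μ σ x) := by
  have hfl := hf.1.hasFlux hσ hσ_pos hμ
  have hD := densities hσ hσ_pos hμ
  have hmono : StrictMonoOn (fun x => deriv f x / scaleDensity μ σ x) (Ioi 0) :=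
    strictMonoOn_of_hasDerivAt (convex_Ioi 0) (fun x hx => hfl.flux_deriv x hx)
      fun x hx => mul_pos (mul_pos hs (hf.1.pos x hx)) (hD.speed_pos x hx)
  have hnn : ∀ x, 0 < x → 0 ≤ deriv f x / scaleDensity μ σ x := fun x hx => by
    refine div_nonneg ?_ (scaleDensity_pos μ σ x).le
    rw [← derivWithin_of_isOpen isOpen_Ioi hx]
    exact hf.2.monotoneOn.derivWithin_nonneg
  exact ⟨hfl, hf.1.pos, fun x hx =>
    (hnn _ (half_pos hx)).trans_lt (hmono (half_pos hx) hx (half_lt_self hx))⟩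

theorem IsDecreasingFundamental.decSol {s : ℝ} (hs : 0 < s) {f : ℝ → ℝ}
    (hf : IsDecreasingFundamental μ σ s f) (hσ : ContinuousOn σ (Ioi 0))
    (hσ_pos : ∀ x, 0 < x → 0 < σ x) (hμ : ContinuousOn μ (Ioi 0)) :
    DecSol (scaleDensity μ σ) (speedDensity μ σ) s f
      (fun x => deriv f x / scaleDensity μ σ x) := by
  have hfl := hf.1.hasFlux hσ hσ_pos hμ
  have hD := densities hσ hσ_pos hμ
  have hmono : StrictMonoOn (fun x => deriv f x / scaleDensity μ σ x) (Ioi 0) :=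
    strictMonoOn_of_hasDerivAt (convex_Ioi 0) (fun x hx => hfl.flux_deriv x hx)
      fun x hx => mul_pos (mul_pos hs (hf.1.pos x hx)) (hD.speed_pos x hx)
  have hnp : ∀ x, 0 < x → deriv f x / scaleDensity μ σ x ≤ 0 := fun x hx => by
    refine div_nonpos_of_nonpos_of_nonneg ?_ (scaleDensity_pos μ σ x).le
    rw [← derivWithin_of_isOpen isOpen_Ioi hx]
    exact hf.2.antitoneOn.derivWithin_nonpos
  refine ⟨hfl, hf.1.pos, fun x hx => ?_⟩
  have h2 : x < x + 1 := lt_add_one x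
  exact (hmono hx (hx.trans h2) h2).trans_le (hnp _ (hx.trans h2))

end Conversion

/-! ### The identity function as a potential of `μ - r x`. -/

section Wronskians

variable {μ σ S m ψ Ψ φ Φ : ℝ → ℝ} {r B : ℝ}

theorem hasFlux_id (hD : Densities S m)
    (hS : ∀ x, 0 < x → HasDerivAt S (-(2 * μ x / σ x ^ 2) * S x) x)
    (hm : ∀ x, 0 < x → m x = 2 / (σ x ^ 2 * S x)) (hσ : ∀ x, 0 < x → 0 < σ x) (r : ℝ) :
    HasFlux S m (fun x => r * x + (μ x - r * x)) (fun x => x) (fun x => 1 / S x) := by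
  refine ⟨fun x hx => ?_, fun x hx => ?_⟩
  · refine (hasDerivAt_id x).congr_deriv ?_
    rw [mul_one_div_cancel (hD.scale_pos x hx).ne']
  · have hSx := (hD.scale_pos x hx).ne'
    have hσx := (hσ x hx).ne'
    refine ((hasDerivAt_const x (1 : ℝ)).fun_div (hS x hx) hSx).congr_deriv ?_
    rw [hm x hx]
    field_simp
    ring

/-- The Wronskian of `x` and `ψ` has derivative `ψ (μ - r x) m` and vanishes at `0`. Paired with its
counterpart at `∞` it evaluates the Green integral of `μ - r x`. -/
theorem integral_id_lower (hD : Densities S m) (hN0 : NaturalAtZero S m) (hr : 0 < r)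
    (hS : ∀ x, 0 < x → HasDerivAt S (-(2 * μ x / σ x ^ 2) * S x) x)
    (hm : ∀ x, 0 < x → m x = 2 / (σ x ^ 2 * S x)) (hσ : ∀ x, 0 < x → 0 < σ x)
    (hμ : ContinuousOn μ (Ioi 0)) (hψ : IncSol S m r ψ Ψ)
    (hid : IntegrableOn (fun x => ψ x * x * m x) (Ioc 0 1))
    (hθ : IntegrableOn (fun x => ψ x * (μ x - r * x) * m x) (Ioc 0 1)) {x : ℝ} (hx : 0 < x) :
    1 / S x * ψ x - Ψ x * x = ∫ y in Ioc 0 x, ψ y * (μ y - r * y) * m y := by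
  have hq := hasFlux_id hD hS hm hσ r
  have hθc : ContinuousOn (fun x => μ x - r * x) (Ioi 0) :=
    hμ.sub (continuousOn_const.mul continuousOn_id)
  have hcont : ContinuousOn (fun x => ψ x * (μ x - r * x) * m x) (Ioi 0) :=
    (hψ.cont.fun_mul hθc).fun_mul hD.speed_cont
  have hlim : Tendsto (fun x => x * Ψ x) (𝓝[>] 0) (𝓝 0) := by
    have h1 : Tendsto (fun x : ℝ => x) (𝓝[>] 0) (𝓝 0) := nhdsWithin_le_nhds
    simpa using h1.mul (hψ.tendsto_flux hD hN0 hr)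
  refine eq_integral_Ioc_of_hasDerivAt (F := fun x => 1 / S x * ψ x - Ψ x * x)
    (fun y hy => (hasDerivAt_wronskian hψ.toHasFlux hq hy).congr_deriv (by ring)) hcont
    (integrableOn_Ioc_zero_extend hcont one_pos hθ) ?_ hx
  exact tendsto_wronskian_zero hψ hD hN0 hr hq (fun _ h => h)
    (fun y hy => (one_div_pos.2 (hD.scale_pos y hy)).ne') hθc hθ hid hlim

theorem integrableOn_reflDens_mul {f : ℝ → ℝ}
    (h : IntegrableOn (fun x => φ x * f x * m x) (Ioi 1)) :
    IntegrableOn (fun y => reflFun φ y * reflFun f y * reflDens m y) (Ioc 0 1) := by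
  rw [integrableOn_Ioi_iff_reflDens one_pos, inv_one, ← integrableOn_Ioc_iff_integrableOn_Ioo] at h
  refine h.congr_fun (fun y _ => ?_) measurableSet_Ioc
  simp only [reflDens, reflFun]
  ring

theorem integral_id_upper (hD : Densities S m) (hN1 : NaturalAtInfty S m) (hr : 0 < r)
    (hS : ∀ x, 0 < x → HasDerivAt S (-(2 * μ x / σ x ^ 2) * S x) x)
    (hm : ∀ x, 0 < x → m x = 2 / (σ x ^ 2 * S x)) (hσ : ∀ x, 0 < x → 0 < σ x)
    (hμ : ContinuousOn μ (Ioi 0)) (hφ : DecSol S m r φ Φ)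
    (hid : IntegrableOn (fun x => φ x * x * m x) (Ioi 1))
    (hθ : IntegrableOn (fun x => φ x * (μ x - r * x) * m x) (Ioi 1)) {x : ℝ} (hx : 0 < x) :
    Φ x * x - 1 / S x * φ x = ∫ y in Ioi x, φ y * (μ y - r * y) * m y := by
  have hq := (hasFlux_id hD hS hm hσ r).reflect
  have hD' := hD.reflect
  have hN' := hN1.reflect hD
  have hφ' := hφ.reflect
  have hθc : ContinuousOn (reflFun fun x => μ x - r * x) (Ioi 0) :=
    continuousOn_reflFun (hμ.sub (continuousOn_const.mul continuousOn_id))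
  have hqc : ContinuousOn (reflFun fun x => x) (Ioi 0) := continuousOn_reflFun continuousOn_id
  have hid' := integrableOn_reflDens_mul (f := fun x => x) hid
  have hθ' := integrableOn_reflDens_mul (f := fun x => μ x - r * x) hθ
  have hcont := (hφ'.cont.fun_mul hθc).fun_mul hD'.speed_cont
  -- The identity is unbounded at `∞`, so `x Φ → 0` is not immediate. After reflection it becomes
  -- the decreasing function `1 / y`, whose product with `φ m` is integrable.
  have hlim : Tendsto (fun x => reflFun (fun x => x) x * reflFlux Φ x) (𝓝[>] 0) (𝓝 0) := by
    refine hφ'.tendsto_antitone_mul_flux hD' hN' hr hqc (by simpa only [mul_comm] using hid')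
      one_pos (fun y hy z _ hyz => ?_) fun y hy _ => ?_
    · exact inv_anti₀ hy.1 hyz
    · exact (inv_pos.2 hy).le
  have h1 := eq_integral_Ioc_of_hasDerivAt
    (F := fun y => reflFlux (fun x => 1 / S x) y * reflFun φ y - reflFlux Φ y * reflFun (fun x => x) y)
    (f := fun y => reflFun φ y * reflFun (fun x => μ x - r * x) y * reflDens m y)
    (fun y hy => (hasDerivAt_wronskian hφ'.toHasFlux hq hy).congr_deriv (by
      simp only [reflFun]
      ring)) hcont (integrableOn_Ioc_zero_extend hcont one_pos hθ')
    (tendsto_wronskian_zero hφ' hD' hN' hr hq (fun y hy => inv_pos.2 hy)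
      (fun y hy => (neg_neg_of_pos (one_div_pos.2 (hD.scale_pos _ (inv_pos.2 hy)))).ne)
      hθc hθ' hid' hlim) (inv_pos.2 hx)
  rw [integral_Ioi_eq_reflDens _ hx]
  have h2 : ∀ y, reflDens (fun y => φ y * (μ y - r * y) * m y) y =
      reflFun φ y * reflFun (fun x => μ x - r * x) y * reflDens m y := fun y => by
    simp only [reflDens, reflFun]
    ring
  simp only [h2]
  rw [← h1]
  simp only [reflFlux, reflFun, inv_inv]
  ring

theorem tendsto_integral_Ioi_atTop {f : ℝ → ℝ} (hf : IntegrableOn f (Ioi 1)) :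
    Tendsto (fun x => ∫ y in Ioi x, f y) atTop (𝓝 0) := by
  rw [integrableOn_Ioi_iff_reflDens one_pos, inv_one, ← integrableOn_Ioc_iff_integrableOn_Ioo] at hf
  rw [tendsto_atTop_iff_reflFun]
  refine (tendsto_integral_Ioc_zero one_pos hf).congr' ?_
  filter_upwards [self_mem_nhdsWithin] with y hy
  rw [reflFun, integral_Ioi_eq_reflDens _ (inv_pos.2 hy), inv_inv]

theorem isGreen_of_integrable {θ g : ℝ → ℝ} (hD : Densities S m) (hψ : IncSol S m r ψ Ψ)
    (hφ : DecSol S m r φ Φ) (hB : ∀ x, 0 < x → Ψ x * φ x - Φ x * ψ x = B)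
    (hθ : ContinuousOn θ (Ioi 0))
    (h0 : IntegrableOn (fun y => ψ y * θ y * m y) (Ioc 0 1))
    (h1 : ∀ x, 0 < x → IntegrableOn (fun y => φ y * θ y * m y) (Ioi x))
    (hg : ∀ x, 0 < x → g x = -greenInt m ψ φ B x θ) :
    IsGreen m ψ Ψ φ Φ θ (fun x => ∫ y in Ioc 0 x, ψ y * θ y * m y)
      (fun x => ∫ y in Ioi x, φ y * θ y * m y) B g
      (fun x => -(Φ x * (∫ y in Ioc 0 x, ψ y * θ y * m y) + Ψ x *
        ∫ y in Ioi x, φ y * θ y * m y) / B) where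
  theta_cont := hθ
  integrableOn := h0
  I_deriv x hx := by
    have hc := (hψ.cont.fun_mul hθ).fun_mul hD.speed_cont
    exact hasDerivAt_integral_Ioc hc (integrableOn_Ioc_zero_extend hc one_pos h0) hx
  J_deriv x hx := hasDerivAt_integral_Ioi ((hφ.cont.fun_mul hθ).fun_mul hD.speed_cont) h1 hx
  I_tendsto := tendsto_integral_Ioc_zero one_pos h0
  wronskian := hB
  eq x hx := by
    rw [hg x hx, greenInt]
    ring
  flux_eq _ _ := rfl

end Wronskians

/-! ### Signs of `kappa` for a unimodal `θ`. -/

section Unimodal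

variable {Ω : Type*} [MeasurableSpace Ω] {X : ℝ≥0 → Ω → ℝ} {P : ℝ → Measure Ω}
  {S m : ℝ → ℝ} {r s : ℝ} {ψ Ψ φ Φ p Pf q Q θ I J g G : ℝ → ℝ} {B : ℝ}

theorem YieldConditions.hasDerivAt (hY : YieldConditions X P r θ) {x : ℝ} (hx : 0 < x) :
    HasDerivAt θ (deriv θ x) x :=
  (hY.differentiableOn.differentiableAt (Ioi_mem_nhds hx)).hasDerivAt

theorem YieldConditions.nonneg_of_increasing (hY : YieldConditions X P r θ) {xs : ℝ}
    (hinc : ∀ y, 0 < y → y < xs → 0 < deriv θ y) {x : ℝ} (hx : 0 < x) (hxs : x < xs) :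
    0 ≤ θ x := by
  obtain ⟨l, hl0, hl⟩ := hY.limit_zero
  have hmono : StrictMonoOn θ (Ioo 0 xs) :=
    strictMonoOn_of_hasDerivAt (convex_Ioo 0 xs) (fun y hy => hY.hasDerivAt hy.1)
      fun y hy => hinc y hy.1 hy.2
  have h1 : l ≤ (θ x : EReal) := by
    refine le_of_tendsto hl ?_
    filter_upwards [Ioo_mem_nhdsGT hx] with y hy
    exact EReal.coe_le_coe_iff.2 (hmono ⟨hy.1, hy.2.trans hxs⟩ ⟨hx, hxs⟩ hy.2).le
  exact EReal.coe_nonneg.1 (hl0.trans h1)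

/-- Sign structure of `kappa` at the lower threshold. -/
theorem kappa_lower_signs (hY : YieldConditions X P r θ) (hg : IsGreen m ψ Ψ φ Φ θ I J B g G)
    (hψ : IncSol S m r ψ Ψ) (hφ : DecSol S m r φ Φ) (hp : IncSol S m s p Pf)
    (hD : Densities S m) (hN : NaturalAtZero S m) (hr : 0 < r) (hrs : r < s) :
    (∀ a, 0 < a → 0 ≤ kappa m r s θ g G p Pf a → ∀ y, a ≤ y → deriv θ y < 0) ∧
    (∀ a, 0 < a → kappa m r s θ g G p Pf a < 0 → ∀ x, 0 < x → x ≤ a →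
      kappa m r s θ g G p Pf x < 0) := by
  obtain ⟨xs, ⟨-, hxs⟩, -⟩ := hY.unimodal
  have hinc : ∀ y, 0 < y → y < xs → 0 < deriv θ y := fun y hy => (hxs y hy).1
  have hdec : ∀ y, 0 < y → xs < y → deriv θ y < 0 := fun y hy => (hxs y hy).2.2
  -- On `(0, xs)` the function `θ` increases from a nonnegative limit, so `θ P ≥ 0` there, as the
  -- limit of `kappa` at `0` requires.
  have hneg : ∀ x, 0 < x → x ≤ xs → kappa m r s θ g G p Pf x < 0 := by
    intro x hx hxx
    refine hg.kappa_neg_of_pos_deriv hψ hφ hp hD hN hr hrs (fun y hy => hY.hasDerivAt hy)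
      (fun ε hε => ?_) hx fun y hy hyx => hinc y hy (hyx.trans_le hxx)
    filter_upwards [Ioo_mem_nhdsGT (hx.trans_le hxx)] with y hy
    exact (neg_nonpos.2 hε.le).trans (mul_nonneg (hY.nonneg_of_increasing hinc hy.1 hy.2)
      (hp.flux_pos y hy.1).le)
  refine ⟨fun a ha hκ y hy => ?_, fun a _ hκ x hx hxa => ?_⟩
  · have h1 : xs < a := by
      by_contra h
      exact (hneg a ha (not_lt.1 h)).not_ge hκ
    exact hdec y (ha.trans_le hy) (h1.trans_le hy)
  · refine hg.kappa_neg_of_le hψ hφ hp hD hrs (fun y hy => hY.hasDerivAt hy) hx hxa hκ ?_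
    rcases le_or_gt x xs with h | h
    · exact Or.inl (hneg x hx h)
    · exact Or.inr fun y hy => hdec y (hx.trans hy) (h.trans hy)

/-- Sign structure of the reflected `kappa` at the upper threshold. -/
theorem kappa_upper_signs (hY : YieldConditions X P r θ)
    (hg : IsGreen (reflDens m) (reflFun φ) (reflFlux Φ) (reflFun ψ) (reflFlux Ψ) (reflFun θ)
      (reflFun J) (reflFun I) B (reflFun g) (reflFlux G))
    (hψ : IncSol S m r ψ Ψ) (hφ : DecSol S m r φ Φ) (hq : DecSol S m s q Q)
    (hD : Densities S m) (hN : NaturalAtInfty S m) (hr : 0 < r) (hrs : r < s) {κ : ℝ → ℝ}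
    (hκ : ∀ x, κ x = kappa (reflDens m) r s (reflFun θ) (reflFun g) (reflFlux G) (reflFun q)
      (reflFlux Q) x⁻¹) :
    (∀ x, 0 < x → HasDerivAt κ (deriv θ x * Q x) x) ∧
    (∀ b, 0 < b → 0 ≤ κ b → ∀ y, 0 < y → y ≤ b → 0 < deriv θ y) ∧
    (∀ b, 0 < b → κ b < 0 → ∀ x, b ≤ x → κ x < 0) := by
  have hD' := hD.reflect
  have hN' := hN.reflect hD
  have hφ' := hφ.reflect
  have hψ' := hψ.reflect
  have hq' := hq.reflect
  have hθ' : ∀ y, 0 < y → HasDerivAt (reflFun θ) (-(deriv θ y⁻¹ / y ^ 2)) y := fun y hy =>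
    hasDerivAt_comp_inv hy (hY.hasDerivAt (inv_pos.2 hy))
  obtain ⟨xs, ⟨hxs0, hxs⟩, -⟩ := hY.unimodal
  have hinc : ∀ y, 0 < y → y < xs → 0 < deriv θ y := fun y hy => (hxs y hy).1
  have hdec : ∀ y, 0 < y → xs < y → deriv θ y < 0 := fun y hy => (hxs y hy).2.2
  -- At `∞` no lower bound on `θ` is available. Instead `θ Q → 0`, because the reflected `θ` is
  -- nonpositive and nondecreasing near `0`.
  have hlim : Tendsto (fun x => reflFun θ x * reflFlux Q x) (𝓝[>] 0) (𝓝 0) := by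
    obtain ⟨N, hN1, hN2⟩ := (((hY.limit_infty.eventually_le_atBot 0).and
      (eventually_gt_atTop xs)).exists_forall_of_atTop).imp fun N h =>
        (⟨(h N le_rfl).2, fun y hy => (h y hy).1⟩ : xs < N ∧ ∀ y, N ≤ y → θ y ≤ 0)
    have hN0 : 0 < N := hxs0.trans_lt hN1
    have hanti : AntitoneOn θ (Ici N) :=
      antitoneOn_of_hasDerivAt (convex_Ici N) (fun y hy => hY.hasDerivAt (hN0.trans_le hy))
        fun y hy => (hdec y (hN0.trans_le hy) (hN1.trans_le hy)).le
    have hle : ∀ y, 0 < y → y ≤ N⁻¹ → N ≤ y⁻¹ := fun y hy hyN =>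
      (le_inv_comm₀ hN0 hy).2 hyN
    refine hg.tendsto_theta_mul_flux hφ' hq' hD' hN' hr hrs (inv_pos.2 hN0)
      (fun y hy z hz hyz => ?_) fun y hy hyN => hN2 _ (hle y hy hyN)
    exact hanti (hle z hz.1 hz.2) (hle y hy.1 hy.2) (inv_anti₀ hy.1 hyz)
  have hneg : ∀ b, 0 < b → xs ≤ b → κ b < 0 := by
    intro b hb hxb
    rw [hκ]
    refine hg.kappa_neg_of_pos_deriv hφ' hψ' hq' hD' hN' hr hrs hθ' (fun ε hε => ?_)
      (inv_pos.2 hb) fun y hy hyb => ?_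
    · exact (hlim.eventually_const_lt (neg_neg_of_pos hε)).mono fun y hy => hy.le
    · exact neg_pos.2 (div_neg_of_neg_of_pos (hdec _ (inv_pos.2 hy)
        (hxb.trans_lt ((lt_inv_comm₀ hy hb).1 hyb))) (pow_pos hy 2))
  refine ⟨fun x hx => ?_, fun b hb hκb y hy hyb => ?_, fun b hb hκb x hbx => ?_⟩
  · have h1 := hasDerivAt_comp_inv hx
      (hg.hasDerivAt_kappa hφ' hψ' hq' hD' hrs (inv_pos.2 hx) (hθ' _ (inv_pos.2 hx)))
    rw [show κ = fun x => kappa (reflDens m) r s (reflFun θ) (reflFun g) (reflFlux G) (reflFun q)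
      (reflFlux Q) x⁻¹ from funext hκ]
    refine h1.congr_deriv ?_
    simp only [reflFlux, inv_inv]
    field_simp
  · have h1 : b < xs := by
      by_contra h
      exact (hneg b hb (not_lt.1 h)).not_ge hκb
    exact hinc y hy (hyb.trans_lt h1)
  · have hx := hb.trans_le hbx
    rw [hκ] at hκb ⊢
    refine hg.kappa_neg_of_le hφ' hψ' hq' hD' hrs hθ' (inv_pos.2 hx) (inv_anti₀ hb hbx) hκb ?_
    rcases le_or_gt xs x with h | h
    · exact Or.inl (by rw [← hκ]; exact hneg x hx h)
    · refine Or.inr fun y hy => neg_neg_of_pos (div_pos ?_ (pow_pos ((inv_pos.2 hx).trans hy) 2))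
      have hy0 := (inv_pos.2 hx).trans hy
      exact hinc _ (inv_pos.2 hy0) (((inv_lt_comm₀ hx hy0).1 hy).trans h)

end Unimodal

/-! ### The functions `H` and `Q` in flux form. -/

section Functionals

variable {S m : ℝ → ℝ} {μ σ : ℝ → ℝ} {r s : ℝ} {ψ φ p q θ g G : ℝ → ℝ} {f F : ℝ → ℝ}

/-- Insert the closed form of `λ K_f`, and for `g` the same form with source `θ` and remainder
`kappa`; the two terms `s F G p` cancel. -/
theorem functionH_eq {x : ℝ} (hrs : r < s) (hS : 0 < scaleDensity μ σ x)
    (hp : deriv p x / scaleDensity μ σ x ≠ 0)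
    (hf : deriv f x = scaleDensity μ σ x * F x) (hg : deriv g x = scaleDensity μ σ x * G x)
    (hK : (s - r) * (s * (∫ y in Ioc 0 x, f y * p y * speedDensity μ σ y)
      - deriv p x / scaleDensity μ σ x * f x)
        = r * f x * (deriv p x / scaleDensity μ σ x) - s * F x * p x) :
    (s - r) * functionH μ σ s p f g x =
      TwoBoundary.lowerVal r (fun x => deriv p x / scaleDensity μ σ x) g G θ
        (kappa (speedDensity μ σ) r s θ g G p fun x => deriv p x / scaleDensity μ σ x) f F x := by
  have hS' := hS.ne'
  have hp' : deriv p x ≠ 0 := fun h => hp (by rw [h, zero_div])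
  have h1 : functionalK μ σ s p f x =
      (r * f x * (deriv p x / scaleDensity μ σ x) - s * F x * p x) / (s - r) := by
    rw [eq_div_iff (sub_pos.2 hrs).ne', ← hK, functionalK]
    ring
  have h2 : functionalK μ σ s p g x =
      (kappa (speedDensity μ σ) r s θ g G p (fun x => deriv p x / scaleDensity μ σ x) x +
        ((r * g x + θ x) * (deriv p x / scaleDensity μ σ x) - s * G x * p x)) / (s - r) := by
    rw [eq_div_iff (sub_pos.2 hrs).ne', functionalK, kappa]
    ring
  have hsr := (sub_pos.2 hrs).ne'
  rw [functionH, h1, h2, hf, hg, TwoBoundary.lowerVal]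
  set κ := kappa (speedDensity μ σ) r s θ g G p (fun x => deriv p x / scaleDensity μ σ x) x
  field_simp
  ring

/-- The functional `L` is the functional `K` of the reflected data at `x⁻¹`, which is why the
hypothesis is phrased there. -/
theorem functionQ_eq {x : ℝ} (hx : 0 < x) (hrs : r < s) (hS : 0 < scaleDensity μ σ x)
    (hq : deriv q x / scaleDensity μ σ x ≠ 0)
    (hf : deriv f x = scaleDensity μ σ x * F x) (hg : deriv g x = scaleDensity μ σ x * G x)
    (hL : (s - r) * (s * (∫ y in Ioc 0 x⁻¹, reflFun f y * reflFun q y *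
        reflDens (speedDensity μ σ) y)
      - reflFlux (fun x => deriv q x / scaleDensity μ σ x) x⁻¹ * reflFun f x⁻¹)
        = r * reflFun f x⁻¹ * reflFlux (fun x => deriv q x / scaleDensity μ σ x) x⁻¹
          - s * reflFlux F x⁻¹ * reflFun q x⁻¹) :
    (s - r) * functionQ μ σ s q g f x =
      TwoBoundary.upperVal r (fun x => deriv q x / scaleDensity μ σ x) g G θ
        (fun x => kappa (reflDens (speedDensity μ σ)) r s (reflFun θ) (reflFun g) (reflFlux G)
          (reflFun q) (reflFlux fun x => deriv q x / scaleDensity μ σ x) x⁻¹) f F x := by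
  have hS' := hS.ne'
  have hq' : deriv q x ≠ 0 := fun h => hq (by rw [h, zero_div])
  have hsr := (sub_pos.2 hrs).ne'
  have h1 : functionalL μ σ s q f x =
      (s * F x * q x - r * f x * (deriv q x / scaleDensity μ σ x)) / (s - r) := by
    rw [functional_reflect _ _ _ _ hx] at hL
    simp only [reflFun, reflFlux, inv_inv] at hL
    rw [eq_div_iff hsr, functionalL]
    linear_combination hL
  have h2 : functionalL μ σ s q g x =
      (kappa (reflDens (speedDensity μ σ)) r s (reflFun θ) (reflFun g) (reflFlux G)
          (reflFun q) (reflFlux fun x => deriv q x / scaleDensity μ σ x) x⁻¹ +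
        (s * G x * q x - (r * g x + θ x) * (deriv q x / scaleDensity μ σ x))) / (s - r) := by
    rw [eq_div_iff hsr, functionalL, kappa, functional_reflect _ _ _ _ hx]
    simp only [reflFun, reflFlux, inv_inv]
    ring
  rw [functionQ, h1, h2, hf, hg, TwoBoundary.upperVal]
  set κ := kappa (reflDens (speedDensity μ σ)) r s (reflFun θ) (reflFun g) (reflFlux G)
          (reflFun q) (reflFlux fun x => deriv q x / scaleDensity μ σ x) x⁻¹
  field_simp
  ring

end Functionals

/-! ### The resolvent as a Green integral, and `g_γ` as a potential. -/

section Main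

variable {Ω : Type*} [mΩ : MeasurableSpace Ω] {μ σ : ℝ → ℝ} {𝓕 : Filtration ℝ≥0 mΩ}
  {X : ℝ≥0 → Ω → ℝ} {P : ℝ → Measure Ω} {r : ℝ} {ψ φ π : ℝ → ℝ} {γ B : ℝ}

theorem resolvent_representation (hσ : ContinuousOn σ (Ioi 0)) (hσ_pos : ∀ x, 0 < x → 0 < σ x)
    (hμ : ContinuousOn μ (Ioi 0)) (hnat : NaturalBoundaries μ σ)
    (hX : ∀ x, 0 < x → IsDiffusionFrom μ σ 𝓕 X (P x) x) (hr : 0 < r)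
    {Ψ Φ : ℝ → ℝ} (hψ : IncSol (scaleDensity μ σ) (speedDensity μ σ) r ψ Ψ)
    (hφ : DecSol (scaleDensity μ σ) (speedDensity μ σ) r φ Φ)
    (hB : ∀ x, 0 < x → Ψ x * φ x - Φ x * ψ x = B) (hBpos : 0 < B) {f : ℝ → ℝ}
    (hf : ContinuousOn f (Ioi 0)) {x : ℝ} (hx : 0 < x)
    (hfi : Integrable f (resolventMeasure X (P x) r)) :
    IntegrableOn (fun y => ψ y * f y * speedDensity μ σ y) (Ioc 0 x) ∧
    IntegrableOn (fun y => φ y * f y * speedDensity μ σ y) (Ioi x) ∧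
    ∫ y, f y ∂(resolventMeasure X (P x) r) = greenInt (speedDensity μ σ) ψ φ B x f := by
  have hD := densities hσ hσ_pos hμ
  have := (hX x hx).isProbabilityMeasure
  have := isFiniteMeasure_discount hr
  have : IsFiniteMeasure (resolventMeasure X (P x) r) := by
    unfold resolventMeasure
    infer_instance
  have hpos := resolventMeasure_pos (r := r) (hX x hx)
  refine integral_eq_greenInt_of_integrable hD hψ hφ hBpos hpos hx (fun k hk => ?_) hf hfi
  exact integral_eq_greenInt_testFun hD hnat.atZero hnat.atInfty hr
    (fun y hy => hasDerivAt_scaleDensity hσ hσ_pos hμ hy) (fun _ _ => rfl) hσ_pos hσ hμ hψ hφ hB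
    hBpos hpos hx (fun f h1 h2 h3 => integral_resolvent_equation hr (hX x hx) hσ hμ h1 h2 h3) hk

/-- `g_γ = -R_r θ_γ`, in terms of the Green kernel. -/
theorem exists_isGreen_gFun (hσ : ContinuousOn σ (Ioi 0)) (hσ_pos : ∀ x, 0 < x → 0 < σ x)
    (hμ : ContinuousOn μ (Ioi 0)) (hnat : NaturalBoundaries μ σ)
    (hX : ∀ x, 0 < x → IsDiffusionFrom μ σ 𝓕 X (P x) x) (hr : 0 < r)
    {Ψ Φ : ℝ → ℝ} (hψ : IncSol (scaleDensity μ σ) (speedDensity μ σ) r ψ Ψ)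
    (hφ : DecSol (scaleDensity μ σ) (speedDensity μ σ) r φ Φ)
    (hB : ∀ x, 0 < x → Ψ x * φ x - Φ x * ψ x = B) (hBpos : 0 < B)
    (hπ : ContinuousOn π (Ioi 0))
    (hidi : ∀ x, 0 < x → Integrable (fun y => y) (resolventMeasure X (P x) r))
    (hμi : ∀ x, 0 < x → Integrable μ (resolventMeasure X (P x) r))
    (hπi : ∀ x, 0 < x → Integrable π (resolventMeasure X (P x) r)) :
    ∃ I J G : ℝ → ℝ,
      IsGreen (speedDensity μ σ) ψ Ψ φ Φ (netYield μ r π γ) I J B (gFun X P r π γ) G ∧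
      IntegrableOn (fun x => φ x * netYield μ r π γ x * speedDensity μ σ x) (Ioi 1) ∧
      Tendsto J atTop (𝓝 0) := by
  have hD := densities hσ hσ_pos hμ
  have hS := fun y (hy : 0 < y) => hasDerivAt_scaleDensity hσ hσ_pos hμ hy
  have hdc : ContinuousOn (fun x => μ x - r * x) (Ioi 0) :=
    hμ.sub (continuousOn_const.mul continuousOn_id)
  have hθc : ContinuousOn (netYield μ r π γ) (Ioi 0) := hπ.add (continuousOn_const.mul hdc)
  have hdi : ∀ x, 0 < x → Integrable (fun x => μ x - r * x) (resolventMeasure X (P x) r) :=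
    fun x hx => (hμi x hx).sub ((hidi x hx).const_mul r)
  have hθi : ∀ x, 0 < x → Integrable (netYield μ r π γ) (resolventMeasure X (P x) r) :=
    fun x hx => (hπi x hx).add ((hdi x hx).const_mul γ)
  have rep := fun {f : ℝ → ℝ} (hf : ContinuousOn f (Ioi 0)) {x : ℝ} (hx : 0 < x)
    (hfi : Integrable f (resolventMeasure X (P x) r)) =>
      resolvent_representation hσ hσ_pos hμ hnat hX hr hψ hφ hB hBpos hf hx hfi
  have hid1 := rep (f := fun y => y) continuousOn_id one_pos (hidi 1 one_pos)
  have hd1 := rep hdc one_pos (hdi 1 one_pos)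
  -- The boundary Wronskians, weighted by `φ x` and `ψ x`, add up to `-x B`.
  have hdrift : ∀ x, 0 < x →
      ∫ y, (μ y - r * y) ∂(resolventMeasure X (P x) r) = -x := by
    intro x hx
    rw [(rep hdc hx (hdi x hx)).2.2, greenInt,
      ← integral_id_lower hD hnat.atZero hr hS (fun _ _ => rfl) hσ_pos hμ hψ hid1.1 hd1.1 hx,
      ← integral_id_upper hD hnat.atInfty hr hS (fun _ _ => rfl) hσ_pos hμ hφ hid1.2.1
        hd1.2.1 hx, div_eq_iff hBpos.ne', ← hB x hx]
    ring
  have hg : ∀ x, 0 < x → gFun X P r π γ x =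
      -greenInt (speedDensity μ σ) ψ φ B x (netYield μ r π γ) := by
    intro x hx
    rw [← (rep hθc hx (hθi x hx)).2.2]
    have h1 : ∫ y, netYield μ r π γ y ∂(resolventMeasure X (P x) r) =
        (∫ y, π y ∂(resolventMeasure X (P x) r)) +
          γ * ∫ y, (μ y - r * y) ∂(resolventMeasure X (P x) r) := by
      rw [← integral_const_mul, ← integral_add (hπi x hx) ((hdi x hx).const_mul γ)]
      rfl
    rw [h1, hdrift x hx, integral_resolventMeasure hr (hX x hx) hπ (hπi x hx), gFun, resolvent]
    ring
  have hθ1 := rep hθc one_pos (hθi 1 one_pos)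
  exact ⟨_, _, _, isGreen_of_integrable hD hψ hφ hB hθc hθ1.1
    (fun x hx => (rep hθc hx (hθi x hx)).2.1) hg, hθ1.2.1, tendsto_integral_Ioi_atTop hθ1.2.1⟩

end Main

end PoissonControl

/-! ### Assembly of the data and the main theorem. -/

open PoissonControl
theorem mainTheorem3 {Ω : Type*} [mΩ : MeasurableSpace Ω]
    (μ σ : ℝ → ℝ) (hσ : ContinuousOn σ (Ioi 0)) (hσ_pos : ∀ x, 0 < x → 0 < σ x)
    (hnat : NaturalBoundaries μ σ)
    (𝓕 : Filtration ℝ≥0 mΩ) (X : ℝ≥0 → Ω → ℝ) (P : ℝ → Measure Ω)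
    (hX : ∀ x, 0 < x → IsDiffusionFrom μ σ 𝓕 X (P x) x)
    (r lam : ℝ) (hr : 0 < r) (hlam : 0 < lam)
    (ψr φr ψs φs : ℝ → ℝ)
    (hψr : IsIncreasingFundamental μ σ r ψr) (hφr : IsDecreasingFundamental μ σ r φr)
    (hψs : IsIncreasingFundamental μ σ (r + lam) ψs)
    (hφs : IsDecreasingFundamental μ σ (r + lam) φs)
    (π : ℝ → ℝ) (γd γu : ℝ) (hmain : MainAssumptions X P μ r π γd γu)
    (astar bstar : ℝ)
    (hsol : IsThresholdPair μ σ (r + lam) ψr φr ψs φs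
      (gFun X P r π γd) (gFun X P r π γu) astar bstar) :
    ∀ a b : ℝ, IsThresholdPair μ σ (r + lam) ψr φr ψs φs
      (gFun X P r π γd) (gFun X P r π γu) a b → a = astar ∧ b = bstar := by
  have hμd : ∀ x, 0 < x → HasDerivAt μ (deriv μ x) x := fun x hx =>
    (hmain.drift_differentiableOn.differentiableAt (Ioi_mem_nhds hx)).hasDerivAt
  have hμ : ContinuousOn μ (Ioi 0) := hmain.drift_differentiableOn.continuousOn
  have hs : 0 < r + lam := add_pos hr hlam
  have hrs : r < r + lam := lt_add_of_pos_right r hlam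
  have hD := densities hσ hσ_pos hμ
  have hN0 := hnat.atZero
  have hN1 := hnat.atInfty
  have hS : ∀ x, 0 < scaleDensity μ σ x := scaleDensity_pos μ σ
  have iψ := hψr.incSol hr hσ hσ_pos hμ
  have iφ := hφr.decSol hr hσ hσ_pos hμ
  have ip := hψs.incSol hs hσ hσ_pos hμ
  have iq := hφs.decSol hs hσ hσ_pos hμ
  set S := scaleDensity μ σ with hSdef
  set Ψ := fun x => deriv ψr x / S x
  set Φ := fun x => deriv φr x / S x
  set Ps := fun x => deriv ψs x / S x
  set Qs := fun x => deriv φs x / S x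
  obtain ⟨B, hB⟩ : ∃ B, ∀ x, 0 < x → Ψ x * φr x - Φ x * ψr x = B :=
    ⟨Ψ 1 * φr 1 - Φ 1 * ψr 1, fun x hx =>
      TwoBoundary.wronskian_eq iφ.toHasFlux iψ.toHasFlux hx one_pos⟩
  have hBpos : 0 < B := by
    rw [← hB 1 one_pos]
    nlinarith [mul_pos (iψ.flux_pos 1 one_pos) (iφ.pos 1 one_pos),
      mul_pos (neg_pos.2 (iφ.flux_neg 1 one_pos)) (iψ.pos 1 one_pos)]
  have hint : ∀ {f : ℝ → ℝ}, ContinuousOn f (Ioi 0) → InL1 X P r f → ∀ x, 0 < x →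
      Integrable f (resolventMeasure X (P x) r) := fun hf h x hx =>
    integrable_resolventMeasure hr (hX x hx) hf (h x hx)
  have hidi := hint continuousOn_id hmain.id_inL1
  have hθdi := hint hmain.yield_d.differentiableOn.continuousOn hmain.yield_d.inL1
  have hθui := hint hmain.yield_u.differentiableOn.continuousOn hmain.yield_u.inL1
  have hγ : γu - γd ≠ 0 := (sub_pos.2 hmain.gamma_lt).ne'
  -- The difference `θ_u - θ_d` is `(γ_u - γ_d)(μ - r x)`; since `γ_u ≠ γ_d`, the integrability of
  -- `μ`, and then of `π`, follows.
  have hμi : ∀ x, 0 < x → Integrable μ (resolventMeasure X (P x) r) := by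
    intro x hx
    refine ((((hθui x hx).sub (hθdi x hx)).const_mul (γu - γd)⁻¹).add
      ((hidi x hx).const_mul r)).congr (ae_of_all _ fun y => ?_)
    simp only [Pi.add_apply, Pi.sub_apply, netYield, id]
    field_simp
    ring
  have hπi : ∀ x, 0 < x → Integrable π (resolventMeasure X (P x) r) := by
    intro x hx
    refine ((hθui x hx).sub (((hμi x hx).sub ((hidi x hx).const_mul r)).const_mul γu)).congr
      (ae_of_all _ fun y => ?_)
    simp only [Pi.sub_apply, netYield, id]
    ring
  obtain ⟨Id, Jd, Gd, hGd, hintd, hJd⟩ := exists_isGreen_gFun (γ := γd) hσ hσ_pos hμ hnat hX hr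
    iψ iφ hB hBpos hmain.payoff_continuousOn hidi hμi hπi
  obtain ⟨Iu, Ju, Gu, hGu, -, -⟩ := exists_isGreen_gFun (γ := γu) hσ hσ_pos hμ hnat hX hr
    iψ iφ hB hBpos hmain.payoff_continuousOn hidi hμi hπi
  have hGd' := hGd.reflect hintd hJd
  set gd := gFun X P r π γd
  set gu := gFun X P r π γu
  set θd := netYield μ r π γd
  set θu := netYield μ r π γu
  have hfd := hGd.hasFlux iψ iφ
  have hfu := hGu.hasFlux iψ iφ
  have hlow := kappa_lower_signs hmain.yield_u hGu iψ iφ ip hD hN0 hr hrs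
  have hupp := kappa_upper_signs hmain.yield_d hGd' iψ iφ iq hD hN1 hr hrs (fun _ => rfl)
  -- The resolvent of `π` cancels: `g_d - g_u` is the linear function `(γ_d - γ_u) x`.
  have hsub : ∀ x, 0 < x → S x * Gd x - S x * Gu x = γd - γu := by
    intro x hx
    have h1 := (hfd.deriv x hx).fun_sub (hfu.deriv x hx)
    have h2 : HasDerivAt (fun x => gd x - gu x) (γd - γu) x := by
      have h3 := (hasDerivAt_id x).const_mul (γd - γu)
      rw [mul_one] at h3
      refine h3.congr_of_eventuallyEq (Eventually.of_forall fun y => ?_)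
      simp only [gd, gu, gFun, id]
      ring
    exact h1.unique h2
  have hTB : TwoBoundary μ σ (deriv μ) S (speedDensity μ σ) r (r + lam) ψr Ψ φr Φ ψs Ps φs Qs
      (γd - γu) gd Gd θd (deriv θd)
      (fun x => kappa (reflDens (speedDensity μ σ)) r (r + lam) (reflFun θd) (reflFun gd)
        (reflFlux Gd) (reflFun φs) (reflFlux Qs) x⁻¹)
      gu Gu θu (deriv θu) (kappa (speedDensity μ σ) r (r + lam) θu gu Gu ψs Ps) :=
    { dens := hD
      vol_pos := hσ_pos
      scale_deriv := fun x hx => hasDerivAt_scaleDensity hσ hσ_pos hμ hx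
      speed_eq := fun _ _ => rfl
      drift_deriv := hμd
      drift_deriv_lt := hmain.drift_deriv_lt
      r_pos := hr
      r_lt_s := hrs
      inc_r := iψ
      dec_r := iφ
      inc_s := ip
      dec_s := iq
      K_neg := fun x hx => iψ.functional_neg ip hD hN0 hr hrs hx
      c_neg := sub_neg.2 hmain.gamma_lt
      flux_d := hfd
      flux_u := hfu
      flux_sub := hsub
      theta_d := fun x hx => hmain.yield_d.hasDerivAt hx
      theta_u := fun x hx => hmain.yield_u.hasDerivAt hx
      kappa_d := hupp.1
      kappa_u := fun x hx =>
        hGu.hasDerivAt_kappa iψ iφ ip hD hrs hx (hmain.yield_u.hasDerivAt hx)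
      theta_d_pos := hupp.2.1
      theta_u_neg := hlow.1
      kappa_d_neg := hupp.2.2
      kappa_u_neg := hlow.2 }
  have hHψ : ∀ a, 0 < a → (r + lam - r) * functionH μ σ (r + lam) ψs ψr gu a = _ := fun a ha =>
    functionH_eq (θ := θu) (F := Ψ) (G := Gu) hrs (hS a) (ip.flux_pos a ha).ne'
      (iψ.deriv a ha).deriv (hfu.deriv a ha).deriv (mul_functional_inc iψ ip hD hN0 hr hrs ha)
  have hHφ : ∀ a, 0 < a → (r + lam - r) * functionH μ σ (r + lam) ψs φr gu a = _ := fun a ha =>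
    functionH_eq (θ := θu) (F := Φ) (G := Gu) hrs (hS a) (ip.flux_pos a ha).ne'
      (iφ.deriv a ha).deriv (hfu.deriv a ha).deriv (mul_functional_dec iφ ip hD hN0 hr hrs ha)
  -- Reflection turns `ψ_r` into a decreasing solution, so the identity for decreasing solutions
  -- applies here, and the one for increasing solutions to `φ_r`.
  have hQψ : ∀ b, 0 < b → (r + lam - r) * functionQ μ σ (r + lam) φs gd ψr b = _ := fun b hb =>
    functionQ_eq (θ := θd) (F := Ψ) (G := Gd) hb hrs (hS b) (iq.flux_neg b hb).ne
      (iψ.deriv b hb).deriv (hfd.deriv b hb).deriv (mul_functional_dec iψ.reflect iq.reflect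
        hD.reflect (hN1.reflect hD) hr hrs (inv_pos.2 hb))
  have hQφ : ∀ b, 0 < b → (r + lam - r) * functionQ μ σ (r + lam) φs gd φr b = _ := fun b hb =>
    functionQ_eq (θ := θd) (F := Φ) (G := Gd) hb hrs (hS b) (iq.flux_neg b hb).ne
      (iφ.deriv b hb).deriv (hfd.deriv b hb).deriv (mul_functional_inc iφ.reflect iq.reflect
        hD.reflect (hN1.reflect hD) hr hrs (inv_pos.2 hb))
  have hψeq : ∀ {a b}, IsThresholdPair μ σ (r + lam) ψr φr ψs φs gd gu a b → _ := fun {a b} h =>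
    (hHψ a h.pos).symm.trans ((congrArg (fun z => (r + lam - r) * z) h.eq_psi).trans
      (hQψ b (h.pos.trans h.lt)))
  have hφeq : ∀ {a b}, IsThresholdPair μ σ (r + lam) ψr φr ψs φs gd gu a b → _ := fun {a b} h =>
    (hHφ a h.pos).symm.trans ((congrArg (fun z => (r + lam - r) * z) h.eq_phi).trans
      (hQφ b (h.pos.trans h.lt)))
  intro a b hab
  exact hTB.unique hab.pos hab.lt hsol.pos hsol.lt (hψeq hab) (hφeq hab) (hψeq hsol) (hφeq hsol)
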